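/- Let $m\ge 1$ and let $\mathcal N$ be a smooth compact Riemannian manifold without boundary, isometrically (smoothly) embedded in some Euclidean space $\mathbb R^\ell$. Write $B_1^+=\{x\in\mathbb R^m: |x|<1,\ x_m>0\}$ and $T_1=\{x\in\mathbb R^m: |x|<1,\ x_m=0\}$. Let $W^{2,2}(B_1^+,\mathcal N)$ be the set of $u\in W^{2,2}(B_1^+,\mathbb R^\ell)$ with $u(x)\in\mathcal N$ for a.e. $x\in B_1^+$. A map $u\in W^{2,2}(B_1^+,\mathcal N)$ is called a minimizing biharmonic map if $$\int_{B_1^+}|\Delta u|^2\,dx\le\int_{B_1^+}|\Delta v|^2\,dx$$ for all $v\in W^{2,2}(B_1^+,\mathcal N)$ with $u-v\in W^{2,2}_0(B_1^+,\mathbb R^\ell)$. Lemma. Let $u_0\in W^{2,2}(B_1^+,\mathcal N)$ be a minimizing biharmonic map that is homogeneous of degree $0$ (for every $t\in(0,1)$, $u_0(tx)=u_0(x)$ for a.e. $x\in B_1^+$) and that has constant Dirichlet boundary values on $T_1$, that is, for some constant $c\in\mathbb R^\ell$, $$u_0=c\quad\text{and}\quad \frac{\partial u_0}{\partial x_m}=0\quad\text{on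 } T_1$$ in the sense of traces. Then $u_0$ is constant: there is $b\in\mathcal N$ with $u_0(x)=b$ for a.e. $x\in B_1^+$. -/

import Mathlib

open MeasureTheory Filter Topology
open scoped ENNReal ContDiff Manifold

noncomputable section

namespace BiharmonicMaps

/-- `ℝ^m` with the Euclidean norm. -/
abbrev E (m : ℕ) : Type := EuclideanSpace ℝ (Fin m)

/-- `φ ∈ C_c^∞(Ω; ℝ^k)` (or real valued, for `F = ℝ`). -/
def IsTestFunction {m : ℕ} {F : Type*} [NormedAddCommGroup F] [NormedSpace ℝ F]
    (Ω : Set (E m)) (φ : E m → F) : Prop :=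
  ContDiff ℝ ∞ φ ∧ HasCompactSupport φ ∧ tsupport φ ⊆ Ω

/-- The classical partial derivative `∂φ/∂x_i` of a real function. -/
def partialDeriv {m : ℕ} (i : Fin m) (φ : E m → ℝ) (x : E m) : ℝ :=
  fderiv ℝ φ x (EuclideanSpace.single i 1)

/-- `g` is a weak partial derivative `∂u/∂x_i` of `u` in the open set `Ω`. -/
def HasWeakPartial {m ℓ : ℕ} (Ω : Set (E m)) (i : Fin m) (u g : E m → E ℓ) : Prop :=
  LocallyIntegrableOn u Ω volume ∧ LocallyIntegrableOn g Ω volume ∧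
    ∀ φ : E m → ℝ, IsTestFunction Ω φ →
      ∫ x in Ω, partialDeriv i φ x • u x = - ∫ x in Ω, φ x • g x

open Classical in
/-- The weak partial derivative `∂u/∂x_i` in `Ω` (a representative of it; it is unique almost
everywhere in `Ω`, see `HasWeakPartial.ae_eq`), and `0` if it does not exist. -/
def weakPartial {m ℓ : ℕ} (Ω : Set (E m)) (i : Fin m) (u : E m → E ℓ) : E m → E ℓ :=
  if h : ∃ g, HasWeakPartial Ω i u g then h.choose else 0

/-- `u ∈ W^{k,2}(Ω; ℝ^ℓ)`. -/
def MemWk2 {m ℓ : ℕ} (Ω : Set (E m)) : ℕ → (E m → E ℓ) → Prop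
  | 0, u => MemLp u 2 (volume.restrict Ω)
  | k + 1, u => MemLp u 2 (volume.restrict Ω) ∧
      ∀ i : Fin m, ∃ g : E m → E ℓ, HasWeakPartial Ω i u g ∧ MemWk2 Ω k g

/-- The norm of `W^{k,2}(Ω; ℝ^ℓ)`: the sum of the `L^2` norms of all weak partial derivatives of
order at most `k`. Used for elements of this space only. -/
def wk2Norm {m ℓ : ℕ} (Ω : Set (E m)) : ℕ → (E m → E ℓ) → ℝ≥0∞
  | 0, u => eLpNorm u 2 (volume.restrict Ω)
  | k + 1, u => eLpNorm u 2 (volume.restrict Ω) + ∑ i : Fin m, wk2Norm Ω k (weakPartial Ω i u)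

/-- `w ∈ W_0^{k,2}(Ω; ℝ^ℓ)`, the closure of `C_c^∞(Ω; ℝ^ℓ)` in `W^{k,2}(Ω; ℝ^ℓ)`. -/
def MemWk2Zero {m ℓ : ℕ} (Ω : Set (E m)) (k : ℕ) (w : E m → E ℓ) : Prop :=
  MemWk2 Ω k w ∧
    ∀ ε : ℝ≥0∞, 0 < ε → ∃ φ : E m → E ℓ, IsTestFunction Ω φ ∧ wk2Norm Ω k (w - φ) < ε

/-- `u ∈ W^{2,2}(Ω, N)`. -/
def MemW22Into {m ℓ : ℕ} (Ω : Set (E m)) (N : Set (E ℓ)) (u : E m → E ℓ) : Prop :=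
  MemWk2 Ω 2 u ∧ ∀ᵐ x ∂(volume.restrict Ω), u x ∈ N

/-- The Laplacian `Δu = ∑ i, ∂²u/∂x_i²`, in the weak sense. -/
def weakLaplacian {m ℓ : ℕ} (Ω : Set (E m)) (u : E m → E ℓ) (x : E m) : E ℓ :=
  ∑ i : Fin m, weakPartial Ω i (weakPartial Ω i u) x

/-- The Hessian energy `H(u) = ∫_Ω |Δu|² dx`. -/
def hessianEnergy {m ℓ : ℕ} (Ω : Set (E m)) (u : E m → E ℓ) : ℝ :=
  ∫ x in Ω, ‖weakLaplacian Ω u x‖ ^ 2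

/-- `u ∈ W^{2,2}(Ω, N)` is a minimizing biharmonic map. -/
def IsMinimizingBiharmonic {m ℓ : ℕ} (Ω : Set (E m)) (N : Set (E ℓ)) (u : E m → E ℓ) : Prop :=
  MemW22Into Ω N u ∧
    ∀ v : E m → E ℓ, MemW22Into Ω N v → MemWk2Zero Ω 2 (u - v) →
      hessianEnergy Ω u ≤ hessianEnergy Ω v

/-- The open half ball `B_1^+ = {x ∈ ℝ^m : |x| < 1, x_m > 0}`, where `m = d + 1`. -/
def halfBall (d : ℕ) : Set (E (d + 1)) :=
  Metric.ball 0 1 ∩ {x | 0 < x (Fin.last d)}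

/-- The point `(y, 0)` of the hyperplane `{x_m = 0}` of `ℝ^m`, where `m = d + 1`. -/
def flatPoint {d : ℕ} (y : E d) : E (d + 1) :=
  WithLp.toLp 2 (Fin.snoc (α := fun _ => ℝ) (fun i => y i) 0)

/-- `w ∈ W^{1,2}(B_1^+; ℝ^ℓ)` has the trace `g` on the flat part
`T_1 = {(y, 0) : y ∈ ℝ^(m-1), |y| < 1}` of the boundary of `B_1^+`: there are `φ_k`, smooth up to
the boundary, with `φ_k → w` in `W^{1,2}(B_1^+)` and `φ_k → g` in `L^2(T_1)`. -/
def HasFlatTrace {d ℓ : ℕ} (w : E (d + 1) → E ℓ) (g : E d → E ℓ) : Prop :=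
  MemWk2 (halfBall d) 1 w ∧
    ∃ φ : ℕ → E (d + 1) → E ℓ, (∀ k, ContDiff ℝ ∞ (φ k)) ∧
      Tendsto (fun k => wk2Norm (halfBall d) 1 (w - φ k)) atTop (𝓝 0) ∧
      Tendsto (fun k => eLpNorm (fun y => φ k (flatPoint y) - g y) 2
        (volume.restrict (Metric.ball (0 : E d) 1))) atTop (𝓝 0)

/-- `u` takes the constant boundary value `c` on `T_1` in the sense of the Dirichlet problem for
the bi-Laplacian: `u = c` and `∂u/∂x_m = 0` on `T_1`, in the sense of traces. -/
def HasConstantFlatBoundaryValue {d ℓ : ℕ} (u : E (d + 1) → E ℓ) (c : E ℓ) : Prop :=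
  HasFlatTrace u (fun _ => c) ∧
    HasFlatTrace (weakPartial (halfBall d) (Fin.last d) u) (fun _ => 0)

/-- `u` (an almost everywhere class of maps on `B_1^+`) is homogeneous of degree `0`. -/
def IsHomogeneousDegreeZero {d ℓ : ℕ} (u : E (d + 1) → E ℓ) : Prop :=
  ∀ t : ℝ, 0 < t → t < 1 → ∀ᵐ x ∂(volume.restrict (halfBall d)), u (t • x) = u x

/-- Weak partial derivatives are unique almost everywhere. -/
theorem HasWeakPartial.ae_eq {m ℓ : ℕ} {Ω : Set (E m)} (hΩ : IsOpen Ω) {i : Fin m}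
    {u g g' : E m → E ℓ} (h : HasWeakPartial Ω i u g) (h' : HasWeakPartial Ω i u g') :
    g =ᵐ[volume.restrict Ω] g' := by
  have key : ∀ᵐ x ∂volume, x ∈ Ω → (g - g') x = 0 := by
    refine hΩ.ae_eq_zero_of_integral_contDiff_smul_eq_zero (h.2.1.sub h'.2.1) ?_
    intro φ hφ hc hs
    have int : ∀ f : E m → E ℓ, LocallyIntegrableOn f Ω volume →
        Integrable (fun x => φ x • f x) volume := by
      intro f hf
      have hK : IsCompact (tsupport φ) := hc
      have hI : IntegrableOn (fun x => φ x • f x) (tsupport φ) volume :=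
        (hf.integrableOn_compact_subset hs hK).continuousOn_smul hφ.continuous.continuousOn hK
      refine (integrableOn_iff_integrable_of_support_subset ?_).1 hI
      intro x hx
      by_contra hx'
      exact hx (by simp only [image_eq_zero_of_notMem_tsupport hx', zero_smul])
    have ext : ∀ f : E m → E ℓ, ∫ x in Ω, φ x • f x = ∫ x, φ x • f x := by
      intro f
      refine setIntegral_eq_integral_of_forall_compl_eq_zero fun x hx => ?_
      rw [image_eq_zero_of_notMem_tsupport fun hx' => hx (hs hx'), zero_smul]
    have e1 := h.2.2 φ ⟨hφ, hc, hs⟩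
    have e2 := h'.2.2 φ ⟨hφ, hc, hs⟩
    rw [ext] at e1 e2
    simp only [Pi.sub_apply, smul_sub]
    rw [integral_sub (int g h.2.1) (int g' h'.2.1)]
    exact sub_eq_zero.2 (neg_injective (e1.symm.trans e2))
  refine (ae_restrict_iff' hΩ.measurableSet).2 ?_
  filter_upwards [key] with x hx hxΩ
  exact sub_eq_zero.1 (hx hxΩ)

/-- If a weak partial derivative exists, then `weakPartial` is one. -/
theorem HasWeakPartial.weakPartial {m ℓ : ℕ} {Ω : Set (E m)} {i : Fin m} {u g : E m → E ℓ}
    (h : HasWeakPartial Ω i u g) : HasWeakPartial Ω i u (weakPartial Ω i u) := by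
  have hex : ∃ g, HasWeakPartial Ω i u g := ⟨g, h⟩
  unfold BiharmonicMaps.weakPartial
  rw [dif_pos hex]
  exact hex.choose_spec

end BiharmonicMaps

end

/-! Subtract `c` and extend by zero below the flat boundary. Both Dirichlet data of `u₀ - c` vanish
there, so near the origin the extension `w` has two weak derivatives in L² across the boundary
(`HasConstantFlatBoundaryValue.extension`), and it is a W^{2,2} limit of test functions supported in
the open half ball (`exists_isW22Limit`).

Now deform the domain instead of the target. For η ≥ 0 and t ≥ 0 the map x ↦ x - tη(x)e_m pushes
points down, and c + w(x - tη(x)e_m) is a competitor: its values are values of `u₀`, or `c` once the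
point has left the half ball, and `c` lies in the target because the target is closed
(`boundaryValue_mem`). No projection onto the target is needed. Since t ≥ 0 is forced, minimality
yields only an inequality: the derivative of the energy at t = 0⁺ is nonnegative
(`firstVariation_nonneg`).

Homogeneity makes this derivative computable for radial η. Put η = G(1/4 - |x|²) with G(s) =
exp(-1/s) for s > 0 and G = 0 otherwise. The Euler relations Σ x_j ∂_j u = 0 and Σ x_j ∂_j ∂_i u =
-∂_i u, a Pohozaev identity and a scaling identity give (`firstVariation_eq`) derivative = -2 ∫ x_m
G' |Δu|² - 4 ∫ x_m G'' |∇u|², where every dependence on the dimension has cancelled. The weights G'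
and G'' are positive for |x| < 1/2, and x_m > 0 on the half ball, so the derivative is also ≤ 0 and
∇u vanishes near the origin. As `w` is zero below the plane and its normal derivative vanishes, `w`
= 0 near the origin, and homogeneity carries u = c to the whole half ball. -/

noncomputable section

namespace BiharmonicMaps

/-! ### Convergence in `L²` -/

/-- `f k → g` in `L²(μ)`. -/
structure TendstoL2 {α F : Type*} [MeasurableSpace α] [NormedAddCommGroup F] (μ : Measure α)
    (f : ℕ → α → F) (g : α → F) : Prop where
  mem : ∀ k, MemLp (f k) 2 μ
  mem_lim : MemLp g 2 μ
  tendsto : Tendsto (fun k => eLpNorm (f k - g) 2 μ) atTop (𝓝 0)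

namespace TendstoL2

variable {α F G W : Type*} [MeasurableSpace α] [NormedAddCommGroup F] [NormedAddCommGroup G]
  [NormedAddCommGroup W] {μ : Measure α} {f f' : ℕ → α → F} {g g' : α → F}

theorem const (hg : MemLp g 2 μ) : TendstoL2 μ (fun _ => g) g :=
  ⟨fun _ => hg, hg, by simp⟩

theorem add (h : TendstoL2 μ f g) (h' : TendstoL2 μ f' g') :
    TendstoL2 μ (fun k => f k + f' k) (g + g') := by
  refine ⟨fun k => (h.mem k).add (h'.mem k), h.mem_lim.add h'.mem_lim, ?_⟩
  have := h.tendsto.add h'.tendsto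
  rw [add_zero] at this
  refine tendsto_of_tendsto_of_tendsto_of_le_of_le tendsto_const_nhds this
    (fun _ => zero_le) fun k => ?_
  have e : f k + f' k - (g + g') = (f k - g) + (f' k - g') := by abel
  simp only [e]
  exact eLpNorm_add_le ((h.mem k).sub h.mem_lim).1 ((h'.mem k).sub h'.mem_lim).1 (by norm_num)

theorem neg (h : TendstoL2 μ f g) : TendstoL2 μ (fun k => -f k) (-g) := by
  refine ⟨fun k => (h.mem k).neg, h.mem_lim.neg, ?_⟩
  refine h.tendsto.congr fun k => ?_
  rw [← eLpNorm_neg]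
  congr 1
  abel

theorem sub (h : TendstoL2 μ f g) (h' : TendstoL2 μ f' g') :
    TendstoL2 μ (fun k => f k - f' k) (g - g') := by
  simpa [sub_eq_add_neg] using h.add h'.neg

theorem mono_measure {ν : Measure α} (h : TendstoL2 μ f g) (hν : ν ≤ μ) : TendstoL2 ν f g :=
  ⟨fun k => (h.mem k).mono_measure hν, h.mem_lim.mono_measure hν,
    tendsto_of_tendsto_of_tendsto_of_le_of_le tendsto_const_nhds h.tendsto
      (fun _ => zero_le) fun _ => eLpNorm_mono_measure _ hν⟩

theorem smul_bounded [NormedSpace ℝ F] (h : TendstoL2 μ f g) {a : α → ℝ} {C : ℝ}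
    (ha : AEStronglyMeasurable a μ) (hC : ∀ x, |a x| ≤ C) :
    TendstoL2 μ (fun k x => a x • f k x) (fun x => a x • g x) := by
  have mem : ∀ u : α → F, MemLp u 2 μ → MemLp (fun x => a x • u x) 2 μ := by
    intro u hu
    refine MemLp.of_le_mul (c := C) hu (ha.smul hu.1) (Eventually.of_forall fun x => ?_)
    rw [norm_smul]
    exact mul_le_mul_of_nonneg_right (hC x) (norm_nonneg _)
  refine ⟨fun k => mem _ (h.mem k), mem _ h.mem_lim, ?_⟩
  have h1 : Tendsto (fun k => ENNReal.ofReal C * eLpNorm (f k - g) 2 μ) atTop (𝓝 0) := by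
    simpa using ENNReal.Tendsto.const_mul h.tendsto (Or.inr ENNReal.ofReal_ne_top)
  refine tendsto_of_tendsto_of_tendsto_of_le_of_le tendsto_const_nhds h1
    (fun _ => zero_le) fun k => ?_
  refine eLpNorm_le_mul_eLpNorm_of_ae_le_mul (Eventually.of_forall fun x => ?_) 2
  simp only [Pi.sub_apply, ← smul_sub, norm_smul]
  exact mul_le_mul_of_nonneg_right (hC x) (norm_nonneg _)

theorem eLpNorm_comp_le {β : Type*} [MeasurableSpace β] {ν : Measure β} {φ : β → α} {C : ℝ≥0∞}
    (hφ : Measurable φ) (hν : ν.map φ ≤ C • μ) {u : α → F} (hu : AEStronglyMeasurable u μ) :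
    eLpNorm (fun x => u (φ x)) 2 ν ≤ C ^ (1 / (2 : ℝ≥0∞)).toReal * eLpNorm u 2 μ := by
  have hac : ν.map φ ≪ μ := (Measure.absolutelyContinuous_of_le hν).trans
    Measure.smul_absolutelyContinuous
  have e : eLpNorm (fun x => u (φ x)) 2 ν = eLpNorm u 2 (ν.map φ) :=
    (eLpNorm_map_measure (hu.mono_ac hac) hφ.aemeasurable).symm
  rw [e]
  refine (eLpNorm_mono_measure _ hν).trans ?_
  rw [eLpNorm_smul_measure_of_ne_top (by norm_num), smul_eq_mul]

/-- A push-forward bounded by C • μ makes composition bounded on L². Deformations of the domain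
satisfy this with C = 2. -/
theorem comp {β : Type*} [MeasurableSpace β] {ν : Measure β} {φ : β → α} {C : ℝ≥0∞}
    (h : TendstoL2 μ f g) (hφ : Measurable φ) (hC : C ≠ ⊤) (hν : ν.map φ ≤ C • μ) :
    TendstoL2 ν (fun k x => f k (φ x)) (fun x => g (φ x)) := by
  have hac : ν.map φ ≪ μ := (Measure.absolutelyContinuous_of_le hν).trans
    Measure.smul_absolutelyContinuous
  obtain ⟨D, hD, key⟩ : ∃ D : ℝ≥0∞, D < ⊤ ∧ ∀ u : α → F, AEStronglyMeasurable u μ →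
      eLpNorm (fun x => u (φ x)) 2 ν ≤ D * eLpNorm u 2 μ :=
    ⟨C ^ (1 / (2 : ℝ≥0∞)).toReal, ENNReal.rpow_lt_top_of_nonneg ENNReal.toReal_nonneg hC,
      fun u hu => eLpNorm_comp_le hφ hν hu⟩
  have mem : ∀ u : α → F, MemLp u 2 μ → MemLp (fun x => u (φ x)) 2 ν := fun u hu =>
    ⟨(hu.1.mono_ac hac).comp_measurable hφ, (key u hu.1).trans_lt (ENNReal.mul_lt_top hD hu.2)⟩
  refine ⟨fun k => mem (f k) (h.mem k), mem g h.mem_lim, ?_⟩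
  have h1 : Tendsto (fun k => D * eLpNorm (f k - g) 2 μ) atTop (𝓝 0) := by
    simpa only [mul_zero] using ENNReal.Tendsto.const_mul h.tendsto (Or.inr hD.ne)
  exact tendsto_of_tendsto_of_tendsto_of_le_of_le tendsto_const_nhds h1
    (fun _ => zero_le) fun k => key (f k - g) ((h.mem k).sub h.mem_lim).1

theorem integrable_bilin [NormedSpace ℝ F] [NormedSpace ℝ G] [NormedSpace ℝ W]
    (B : F →L[ℝ] G →L[ℝ] W) {u : α → F} {v : α → G} (hu : MemLp u 2 μ) (hv : MemLp v 2 μ) :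
    Integrable (fun x => B (u x) (v x)) μ := by
  rw [← memLp_one_iff_integrable]
  refine MemLp.of_bilin (p := 2) (q := 2) (fun x y => B x y) ‖B‖₊ hu hv ?_ ?_
  · exact B.aestronglyMeasurable_comp₂ hu.1 hv.1
  · exact Eventually.of_forall fun x => by
      exact_mod_cast B.le_opNorm₂ (u x) (v x)

/-- Split B(f,p) - B(g,q) = B(f-g,p) + B(g,p-q) and apply Hölder. Identities quadratic in the
derivatives are proved for smooth approximants and pass to the limit in this way. -/
theorem tendsto_integral_bilin [NormedSpace ℝ F] [NormedSpace ℝ G] [NormedSpace ℝ W]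
    (B : F →L[ℝ] G →L[ℝ] W) {p : ℕ → α → G} {q : α → G}
    (h : TendstoL2 μ f g) (h' : TendstoL2 μ p q) :
    Tendsto (fun k => ∫ x, B (f k x) (p k x) ∂μ) atTop (𝓝 (∫ x, B (g x) (q x) ∂μ)) := by
  have int := fun u v => @integrable_bilin α F G W _ _ _ _ μ _ _ _ B u v
  have bd : ∀ u v, MemLp u 2 μ → MemLp v 2 μ →
      eLpNorm (fun x => B (u x) (v x)) 1 μ ≤ ‖B‖₊ * eLpNorm u 2 μ * eLpNorm v 2 μ := by
    intro u v hu hv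
    refine eLpNorm_le_eLpNorm_mul_eLpNorm_of_nnnorm (p := 2) (q := 2) (r := 1) hu.1 hv.1
      (fun x y => B x y) ‖B‖₊ (Eventually.of_forall fun x => ?_)
    exact_mod_cast B.le_opNorm₂ (u x) (v x)
  refine tendsto_integral_of_L1' _ (int _ _ h.mem_lim h'.mem_lim).1
    (Eventually.of_forall fun k => int _ _ (h.mem k) (h'.mem k)) ?_
  have t1 : Tendsto (fun k => ‖B‖₊ * eLpNorm (f k - g) 2 μ *
      (eLpNorm (p k - q) 2 μ + eLpNorm q 2 μ) + ‖B‖₊ * eLpNorm g 2 μ * eLpNorm (p k - q) 2 μ)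
      atTop (𝓝 (‖B‖₊ * 0 * (0 + eLpNorm q 2 μ) + ‖B‖₊ * eLpNorm g 2 μ * 0)) := by
    refine Tendsto.add (ENNReal.Tendsto.mul (ENNReal.Tendsto.const_mul h.tendsto
      (Or.inr ENNReal.coe_ne_top)) (Or.inr (by simpa using h'.mem_lim.2.ne))
      (h'.tendsto.add_const _) (Or.inr (by simp))) (ENNReal.Tendsto.const_mul h'.tendsto
      (Or.inr (ENNReal.mul_ne_top ENNReal.coe_ne_top h.mem_lim.2.ne)))
  simp only [mul_zero, zero_mul, add_zero] at t1
  refine tendsto_of_tendsto_of_tendsto_of_le_of_le tendsto_const_nhds t1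
    (fun _ => zero_le) fun k => ?_
  have e : ((fun x => B (f k x) (p k x)) - fun x => B (g x) (q x)) =
      (fun x => B ((f k - g) x) (p k x)) + fun x => B (g x) ((p k - q) x) := by
    ext x
    simp
  rw [e]
  refine (eLpNorm_add_le (int _ _ ((h.mem k).sub h.mem_lim) (h'.mem k)).1
    (int _ _ h.mem_lim ((h'.mem k).sub h'.mem_lim)).1 le_rfl).trans ?_
  refine add_le_add ((bd _ _ ((h.mem k).sub h.mem_lim) (h'.mem k)).trans ?_)
    (bd _ _ h.mem_lim ((h'.mem k).sub h'.mem_lim))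
  gcongr
  calc eLpNorm (p k) 2 μ = eLpNorm ((p k - q) + q) 2 μ := by simp
    _ ≤ _ := eLpNorm_add_le ((h'.mem k).sub h'.mem_lim).1 h'.mem_lim.1 (by norm_num)

theorem tendsto_integral_smul [NormedSpace ℝ F] {φ : α → ℝ} (hφ : MemLp φ 2 μ)
    (h : TendstoL2 μ f g) :
    Tendsto (fun k => ∫ x, φ x • f k x ∂μ) atTop (𝓝 (∫ x, φ x • g x ∂μ)) :=
  tendsto_integral_bilin (ContinuousLinearMap.lsmul ℝ ℝ) (const hφ) h

end TendstoL2

/-! ### Partial derivatives and test functions -/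

section Basics

variable {m ℓ : ℕ} {F : Type*} [NormedAddCommGroup F] [NormedSpace ℝ F]

/-- The classical partial derivative `∂f/∂x_i` of a vector valued function. -/
def pd (i : Fin m) (f : E m → F) (x : E m) : F :=
  fderiv ℝ f x (EuclideanSpace.single i 1)

theorem partialDeriv_eq_pd (i : Fin m) (f : E m → ℝ) : partialDeriv i f = pd i f := rfl

theorem contDiff_pd {f : E m → F} (hf : ContDiff ℝ ∞ f) (i : Fin m) : ContDiff ℝ ∞ (pd i f) :=
  (hf.fderiv_right (m := ∞) (by simp)).clm_apply contDiff_const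

theorem diffAt {f : E m → F} (hf : ContDiff ℝ ∞ f) (x : E m) : DifferentiableAt ℝ f x :=
  hf.contDiffAt.differentiableAt (by simp)

theorem pd_smul {c : E m → ℝ} {f : E m → F} (hc : ContDiff ℝ ∞ c) (hf : ContDiff ℝ ∞ f)
    (i : Fin m) (x : E m) : pd i (fun x => c x • f x) x = c x • pd i f x + pd i c x • f x := by
  have := fderiv_fun_smul (diffAt hc x) (diffAt hf x)
  simp [pd, this]

theorem pd_mul {c f : E m → ℝ} (hc : ContDiff ℝ ∞ c) (hf : ContDiff ℝ ∞ f)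
    (i : Fin m) (x : E m) : pd i (fun x => c x * f x) x = c x * pd i f x + pd i c x * f x :=
  pd_smul hc hf i x

theorem pd_sub {f g : E m → F} (hf : ContDiff ℝ ∞ f) (hg : ContDiff ℝ ∞ g)
    (i : Fin m) : pd i (f - g) = pd i f - pd i g := by
  ext x
  simp [pd, fderiv_sub (diffAt hf x) (diffAt hg x)]

theorem pd_inner {f g : E m → E ℓ} (hf : ContDiff ℝ ∞ f) (hg : ContDiff ℝ ∞ g)
    (i : Fin m) (x : E m) :
    pd i (fun x => inner ℝ (f x) (g x)) x = inner ℝ (f x) (pd i g x) + inner ℝ (pd i f x) (g x) := by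
  simp only [pd]
  rw [fderiv_inner_apply (𝕜 := ℝ) (diffAt hf x) (diffAt hg x)]

theorem pd_comm {f : E m → F} (hf : ContDiff ℝ ∞ f) (i j : Fin m) :
    pd i (pd j f) = pd j (pd i f) := by
  ext x
  have hd : DifferentiableAt ℝ (fderiv ℝ f) x :=
    (hf.fderiv_right (m := ∞) (by simp)).contDiffAt.differentiableAt (by simp)
  have e : ∀ i j : Fin m, pd i (pd j f) x =
      fderiv ℝ (fderiv ℝ f) x (EuclideanSpace.single i 1) (EuclideanSpace.single j 1) := by
    intro i j
    simp only [pd]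
    change fderiv ℝ (fun y => fderiv ℝ f y (EuclideanSpace.single j 1)) x _ = _
    rw [fderiv_clm_apply hd (by fun_prop)]
    simp
  rw [e, e]
  have := (hf.contDiffAt (x := x)).isSymmSndFDerivAt (n := ∞) (by simpa using WithTop.coe_le_coe.2 (le_top : (2 : ℕ∞) ≤ ⊤))
  exact this.eq _ _

theorem tsupport_pd_subset {f : E m → F} (i : Fin m) : tsupport (pd i f) ⊆ tsupport f :=
  (tsupport_comp_subset (g := fun L : E m →L[ℝ] F => L (EuclideanSpace.single i 1))
    (by simp) (fderiv ℝ f)).trans (tsupport_fderiv_subset ℝ)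

theorem pd_eq_zero_of_notMem {f : E m → F} {i : Fin m} {x : E m} (hx : x ∉ tsupport f) :
    pd i f x = 0 :=
  image_eq_zero_of_notMem_tsupport fun h => hx (tsupport_pd_subset i h)

namespace IsTestFunction

variable {Ω : Set (E m)} {f g : E m → F}

theorem pd (hf : IsTestFunction Ω f) (i : Fin m) : IsTestFunction Ω (pd i f) :=
  ⟨contDiff_pd hf.1 i, hf.2.1.mono' (subset_closure.trans (tsupport_pd_subset i)),
    (tsupport_pd_subset i).trans hf.2.2⟩

theorem sub (hf : IsTestFunction Ω f) (hg : IsTestFunction Ω g) : IsTestFunction Ω (f - g) := by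
  have h := tsupport_sub f g
  exact ⟨hf.1.sub hg.1, (hf.2.1.union hg.2.1).of_isClosed_subset (isClosed_tsupport _) h,
    h.trans (Set.union_subset hf.2.2 hg.2.2)⟩

theorem smul_left {a : E m → ℝ} (ha : ContDiff ℝ ∞ a) (hf : IsTestFunction Ω f) :
    IsTestFunction Ω (fun x => a x • f x) :=
  ⟨ha.smul hf.1, hf.2.1.smul_left, (tsupport_smul_subset_right a f).trans hf.2.2⟩

theorem smul_right {a : E m → ℝ} (ha : IsTestFunction Ω a) (hf : ContDiff ℝ ∞ f) :
    IsTestFunction Ω (fun x => a x • f x) :=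
  ⟨ha.1.smul hf, ha.2.1.smul_right, (tsupport_smul_subset_left a f).trans ha.2.2⟩

theorem mono {Ω' : Set (E m)} (hf : IsTestFunction Ω f) (h : Ω ⊆ Ω') : IsTestFunction Ω' f :=
  ⟨hf.1, hf.2.1, hf.2.2.trans h⟩

theorem memLp (hf : IsTestFunction Ω f) (p : ℝ≥0∞) (μ : Measure (E m)) [IsFiniteMeasureOnCompacts μ] :
    MemLp f p μ :=
  hf.1.continuous.memLp_of_hasCompactSupport hf.2.1

theorem integrable (hf : IsTestFunction Ω f) (μ : Measure (E m)) [IsFiniteMeasureOnCompacts μ] :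
    Integrable f μ :=
  hf.1.continuous.integrable_of_hasCompactSupport hf.2.1

theorem bounded (hf : IsTestFunction Ω f) : ∃ C, ∀ x, ‖f x‖ ≤ C :=
  hf.1.continuous.bounded_above_of_compact_support hf.2.1

theorem eq_zero (hf : IsTestFunction Ω f) {x : E m} (hx : x ∉ Ω) : f x = 0 :=
  image_eq_zero_of_notMem_tsupport fun h => hx (hf.2.2 h)

end IsTestFunction

theorem setIntegral_smul_of_test {Ω : Set (E m)} {φ : E m → ℝ} (hφ : IsTestFunction Ω φ)
    (f : E m → F) : ∫ x in Ω, φ x • f x = ∫ x, φ x • f x :=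
  setIntegral_eq_integral_of_forall_compl_eq_zero fun x hx => by rw [hφ.eq_zero hx, zero_smul]

theorem integral_smul_pd {Ω : Set (E m)} {φ : E m → ℝ} (hφ : IsTestFunction Ω φ)
    {f : E m → F} (hf : ContDiff ℝ ∞ f) (i : Fin m) :
    ∫ x, pd i φ x • f x = - ∫ x, φ x • pd i f x := by
  have h := integral_smul_fderiv_eq_neg_fderiv_smul_of_integrable (μ := (volume : Measure (E m)))
    (v := EuclideanSpace.single i 1) (f := φ) (g := f)
    (((hφ.pd i).smul_right hf).integrable _) ((hφ.smul_right (contDiff_pd hf i)).integrable _)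
    ((hφ.smul_right hf).integrable _) (fun x _ => diffAt hφ.1 x) (fun x _ => diffAt hf x)
  simp only [pd]
  rw [h, neg_neg]

theorem hasWeakPartial_of_contDiff {Ω : Set (E m)} {f : E m → E ℓ}
    (hf : ContDiff ℝ ∞ f) (i : Fin m) : HasWeakPartial Ω i f (pd i f) := by
  refine ⟨(hf.continuous.locallyIntegrable).locallyIntegrableOn _,
    ((contDiff_pd hf i).continuous.locallyIntegrable).locallyIntegrableOn _, fun φ hφ => ?_⟩
  rw [partialDeriv_eq_pd, setIntegral_smul_of_test (hφ.pd i), setIntegral_smul_of_test hφ]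
  exact integral_smul_pd hφ hf i

end Basics

/-! ### Weak derivatives -/

namespace HasWeakPartial

variable {m ℓ : ℕ} {Ω : Set (E m)} {i : Fin m} {u u' g g' : E m → E ℓ}

theorem congr (hΩ : IsOpen Ω) (h : HasWeakPartial Ω i u g)
    (hu : u =ᵐ[volume.restrict Ω] u') (hg : g =ᵐ[volume.restrict Ω] g') :
    HasWeakPartial Ω i u' g' := by
  have loc : ∀ {a b : E m → E ℓ}, a =ᵐ[volume.restrict Ω] b → LocallyIntegrableOn a Ω volume →
      LocallyIntegrableOn b Ω volume := by
    intro a b hab ha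
    rw [locallyIntegrableOn_iff (hΩ.isLocallyClosed)] at ha ⊢
    intro K hK hKc
    exact (ha K hK hKc).congr_fun_ae (ae_restrict_of_ae_restrict_of_subset hK hab)
  refine ⟨loc hu h.1, loc hg h.2.1, fun φ hφ => ?_⟩
  have e1 : ∫ x in Ω, partialDeriv i φ x • u' x = ∫ x in Ω, partialDeriv i φ x • u x := by
    refine integral_congr_ae ?_
    filter_upwards [hu] with x hx
    rw [hx]
  have e2 : ∫ x in Ω, φ x • g' x = ∫ x in Ω, φ x • g x := by
    refine integral_congr_ae ?_
    filter_upwards [hg] with x hx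
    rw [hx]
  rw [e1, e2, h.2.2 φ hφ]

theorem weakPartial_ae (hΩ : IsOpen Ω) (h : HasWeakPartial Ω i u g) :
    BiharmonicMaps.weakPartial Ω i u =ᵐ[volume.restrict Ω] g :=
  h.weakPartial.ae_eq hΩ h

theorem of_memLp (hΩ : IsOpen Ω) (hu : MemLp u 2 (volume.restrict Ω))
    (hg : MemLp g 2 (volume.restrict Ω))
    (h : ∀ φ : E m → ℝ, IsTestFunction Ω φ →
      ∫ x in Ω, pd i φ x • u x = - ∫ x in Ω, φ x • g x) : HasWeakPartial Ω i u g := by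
  have loc : ∀ {a : E m → E ℓ}, MemLp a 2 (volume.restrict Ω) →
      LocallyIntegrableOn a Ω volume := by
    intro a ha
    rw [locallyIntegrableOn_iff (hΩ.isLocallyClosed)]
    intro K hK hKc
    have : IsFiniteMeasure (volume.restrict K) := ⟨by simpa using hKc.measure_lt_top⟩
    exact (ha.mono_measure (Measure.restrict_mono hK le_rfl)).integrable (by norm_num)
  exact ⟨loc hu, loc hg, h⟩

theorem sub (hΩ : IsOpen Ω) (hu : MemLp u 2 (volume.restrict Ω))
    (hg : MemLp g 2 (volume.restrict Ω)) (hu' : MemLp u' 2 (volume.restrict Ω))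
    (hg' : MemLp g' 2 (volume.restrict Ω)) (h : HasWeakPartial Ω i u g)
    (h' : HasWeakPartial Ω i u' g') : HasWeakPartial Ω i (u - u') (g - g') := by
  refine of_memLp hΩ (hu.sub hu') (hg.sub hg') fun φ hφ => ?_
  have int : ∀ {a : E m → E ℓ} {φ : E m → ℝ}, IsTestFunction Ω φ →
      MemLp a 2 (volume.restrict Ω) → IntegrableOn (fun x => φ x • a x) Ω volume := fun hφ ha =>
    TendstoL2.integrable_bilin (ContinuousLinearMap.lsmul ℝ ℝ) (hφ.memLp 2 _) ha
  simp only [Pi.sub_apply, smul_sub]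
  rw [integral_sub (int (hφ.pd i) hu) (int (hφ.pd i) hu'), integral_sub (int hφ hg) (int hφ hg')]
  have e1 := h.2.2 φ hφ
  have e2 := h'.2.2 φ hφ
  rw [partialDeriv_eq_pd] at e1 e2
  rw [e1, e2]
  abel

theorem add (hΩ : IsOpen Ω) (hu : MemLp u 2 (volume.restrict Ω))
    (hg : MemLp g 2 (volume.restrict Ω)) (hu' : MemLp u' 2 (volume.restrict Ω))
    (hg' : MemLp g' 2 (volume.restrict Ω)) (h : HasWeakPartial Ω i u g)
    (h' : HasWeakPartial Ω i u' g') : HasWeakPartial Ω i (u + u') (g + g') := by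
  refine of_memLp hΩ (hu.add hu') (hg.add hg') fun φ hφ => ?_
  have int : ∀ {a : E m → E ℓ} {φ : E m → ℝ}, IsTestFunction Ω φ →
      MemLp a 2 (volume.restrict Ω) → IntegrableOn (fun x => φ x • a x) Ω volume := fun hφ ha =>
    TendstoL2.integrable_bilin (ContinuousLinearMap.lsmul ℝ ℝ) (hφ.memLp 2 _) ha
  simp only [Pi.add_apply, smul_add]
  rw [integral_add (int (hφ.pd i) hu) (int (hφ.pd i) hu'), integral_add (int hφ hg) (int hφ hg')]
  have e1 := h.2.2 φ hφ
  have e2 := h'.2.2 φ hφ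
  rw [partialDeriv_eq_pd] at e1 e2
  rw [e1, e2, neg_add]

/-- Weak differentiation is a closed operator: both sides of the defining identity are continuous in
L². -/
theorem of_tendstoL2 (hΩ : IsOpen Ω) {f : ℕ → E m → E ℓ} (hf : ∀ k, ContDiff ℝ ∞ (f k))
    (h : TendstoL2 (volume.restrict Ω) f u)
    (h' : TendstoL2 (volume.restrict Ω) (fun k => pd i (f k)) g) : HasWeakPartial Ω i u g := by
  refine of_memLp hΩ h.mem_lim h'.mem_lim fun φ hφ => ?_
  have t1 := h.tendsto_integral_smul ((hφ.pd i).memLp 2 _)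
  have t2 := (h'.tendsto_integral_smul (hφ.memLp 2 _)).neg
  refine tendsto_nhds_unique t1 (t2.congr fun k => ?_)
  rw [setIntegral_smul_of_test (hφ.pd i), setIntegral_smul_of_test hφ, integral_smul_pd hφ (hf k)]

end HasWeakPartial

/-! ### Limits of test functions in `W^{2,2}` -/

section Limits

variable {m ℓ : ℕ} {Ω : Set (E m)}

/-- The test functions `f k` in `Ω` converge in `W^{2,2}` to `w`, whose first and second
derivatives are `g i` and `h i j = ∂_j (g i)`. -/
structure IsW22Limit (Ω : Set (E m)) (f : ℕ → E m → E ℓ) (w : E m → E ℓ)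
    (g : Fin m → E m → E ℓ) (h : Fin m → Fin m → E m → E ℓ) : Prop where
  test : ∀ k, IsTestFunction Ω (f k)
  lim : TendstoL2 volume f w
  lim_pd : ∀ i, TendstoL2 volume (fun k => pd i (f k)) (g i)
  lim_pd_pd : ∀ i j, TendstoL2 volume (fun k => pd j (pd i (f k))) (h i j)

namespace IsW22Limit

variable {f : ℕ → E m → E ℓ} {w : E m → E ℓ} {g : Fin m → E m → E ℓ}
  {h : Fin m → Fin m → E m → E ℓ}

theorem hasWeakPartial (hΩ : IsOpen Ω) (H : IsW22Limit Ω f w g h) (i : Fin m) :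
    HasWeakPartial Ω i w (g i) :=
  .of_tendstoL2 hΩ (fun k => (H.test k).1) (H.lim.mono_measure Measure.restrict_le_self)
    ((H.lim_pd i).mono_measure Measure.restrict_le_self)

theorem hasWeakPartial' (hΩ : IsOpen Ω) (H : IsW22Limit Ω f w g h) (i j : Fin m) :
    HasWeakPartial Ω j (g i) (h i j) :=
  .of_tendstoL2 hΩ (fun k => contDiff_pd (H.test k).1 i)
    ((H.lim_pd i).mono_measure Measure.restrict_le_self)
    ((H.lim_pd_pd i j).mono_measure Measure.restrict_le_self)

theorem memWk2 (hΩ : IsOpen Ω) (H : IsW22Limit Ω f w g h) : MemWk2 Ω 2 w :=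
  ⟨H.lim.mem_lim.restrict _, fun i => ⟨g i, H.hasWeakPartial hΩ i, (H.lim_pd i).mem_lim.restrict _,
    fun j => ⟨h i j, H.hasWeakPartial' hΩ i j, (H.lim_pd_pd i j).mem_lim.restrict _⟩⟩⟩

/-- `weakPartial` is a chosen representative, so the norm of w - f k is first rewritten, by almost
everywhere uniqueness, in terms of the explicit derivatives. -/
theorem memWk2Zero (hΩ : IsOpen Ω) (H : IsW22Limit Ω f w g h) : MemWk2Zero Ω 2 w := by
  refine ⟨H.memWk2 hΩ, fun ε hε => ?_⟩
  have H0 := H.lim.mono_measure (Measure.restrict_le_self (s := Ω))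
  have H1 := fun i => (H.lim_pd i).mono_measure (Measure.restrict_le_self (s := Ω))
  have H2 := fun i j => (H.lim_pd_pd i j).mono_measure (Measure.restrict_le_self (s := Ω))
  have e : ∀ k, wk2Norm Ω 2 (w - f k) = eLpNorm (f k - w) 2 (volume.restrict Ω) +
      ∑ i, (eLpNorm (pd i (f k) - g i) 2 (volume.restrict Ω) +
        ∑ j, eLpNorm (pd j (pd i (f k)) - h i j) 2 (volume.restrict Ω)) := by
    intro k
    have a1 : ∀ i, HasWeakPartial Ω i (w - f k) (g i - pd i (f k)) := fun i =>
      .sub hΩ H0.mem_lim (H1 i).mem_lim (H0.mem k) ((H1 i).mem k) (H.hasWeakPartial hΩ i)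
        (hasWeakPartial_of_contDiff (H.test k).1 i)
    have a2 : ∀ i j, HasWeakPartial Ω j (g i - pd i (f k)) (h i j - pd j (pd i (f k))) :=
      fun i j => .sub hΩ (H1 i).mem_lim (H2 i j).mem_lim ((H1 i).mem k) ((H2 i j).mem k)
        (H.hasWeakPartial' hΩ i j) (hasWeakPartial_of_contDiff (contDiff_pd (H.test k).1 i) j)
    have a3 : ∀ i j, HasWeakPartial Ω j (weakPartial Ω i (w - f k)) (h i j - pd j (pd i (f k))) :=
      fun i j => (a2 i j).congr hΩ ((a1 i).weakPartial_ae hΩ).symm EventuallyEq.rfl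
    have sw : ∀ a b : E m → E ℓ, eLpNorm (a - b) 2 (volume.restrict Ω) =
        eLpNorm (b - a) 2 (volume.restrict Ω) := fun a b => by
      rw [← eLpNorm_neg, neg_sub]
    simp only [wk2Norm]
    rw [sw]
    congr 1
    refine Finset.sum_congr rfl fun i _ => ?_
    rw [eLpNorm_congr_ae ((a1 i).weakPartial_ae hΩ), sw]
    congr 1
    refine Finset.sum_congr rfl fun j _ => ?_
    rw [eLpNorm_congr_ae ((a3 i j).weakPartial_ae hΩ), sw]
  have t : Tendsto (fun k => wk2Norm Ω 2 (w - f k)) atTop (𝓝 0) := by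
    simp only [e]
    have := H0.tendsto.add (tendsto_finsetSum Finset.univ fun i _ => (H1 i).tendsto.add
      (tendsto_finsetSum Finset.univ fun j _ => (H2 i j).tendsto))
    simpa using this
  obtain ⟨k, hk⟩ := (t.eventually (gt_mem_nhds hε)).exists
  exact ⟨f k, H.test k, hk⟩

end IsW22Limit

end Limits

/-! ### Integration by parts on the half ball. -/

section HalfBall

variable {d ℓ : ℕ}

theorem isOpen_halfBall : IsOpen (halfBall d) := by
  refine Metric.isOpen_ball.inter (isOpen_lt continuous_const ?_)
  fun_prop

theorem halfBall_subset_ball : halfBall d ⊆ Metric.ball 0 1 := Set.inter_subset_left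

theorem memLp_halfBall_of_continuous {F : Type*} [NormedAddCommGroup F] {f : E (d + 1) → F}
    (hf : Continuous f) : MemLp f 2 (volume.restrict (halfBall d)) := by
  have hK : IsCompact (Metric.closedBall (0 : E (d + 1)) 1) := isCompact_closedBall _ _
  have : IsFiniteMeasure (volume.restrict (Metric.closedBall (0 : E (d + 1)) 1)) :=
    ⟨by simpa using hK.measure_lt_top⟩
  obtain ⟨C, hC⟩ := hK.exists_bound_of_continuousOn hf.continuousOn
  refine MemLp.mono_measure (Measure.restrict_mono
    (halfBall_subset_ball.trans Metric.ball_subset_closedBall) le_rfl) ?_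
  refine MemLp.of_bound hf.aestronglyMeasurable C ?_
  exact (ae_restrict_iff' hK.measurableSet).2 (Eventually.of_forall hC)

/-! ### The divergence theorem on the half space -/

/-- The point `(y, s)` of `ℝ^(d+1)`. -/
def slicePoint (p : E d × ℝ) : E (d + 1) :=
  flatPoint p.1 + p.2 • EuclideanSpace.single (Fin.last d) 1

theorem slicePoint_last (p : E d × ℝ) : slicePoint p (Fin.last d) = p.2 := by
  simp [slicePoint, flatPoint]

/-- Splitting off the last coordinate, as a measurable equivalence. -/
def sliceEquiv (d : ℕ) : E d × ℝ ≃ᵐ E (d + 1) :=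
  (((MeasurableEquiv.toLp 2 (Fin d → ℝ)).symm.prodCongr (MeasurableEquiv.refl ℝ)).trans
    MeasurableEquiv.prodComm).trans
    ((MeasurableEquiv.piFinSuccAbove (fun _ => ℝ) (Fin.last d)).symm.trans
      (MeasurableEquiv.toLp 2 (Fin (d + 1) → ℝ)))

theorem sliceEquiv_apply (p : E d × ℝ) : sliceEquiv d p = slicePoint p := by
  ext i
  refine Fin.lastCases ?_ (fun j => ?_) i
  · simp [sliceEquiv, slicePoint, flatPoint, MeasurableEquiv.prodCongr]
    rfl
  · have : (Fin.castSucc j) ≠ Fin.last d := (Fin.castSucc_lt_last j).ne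
    simp [sliceEquiv, slicePoint, flatPoint, MeasurableEquiv.prodCongr, this]
    rfl

theorem measurePreserving_sliceEquiv :
    MeasurePreserving (sliceEquiv d) ((volume : Measure (E d)).prod volume) volume := by
  have h1 : MeasurePreserving ((MeasurableEquiv.toLp 2 (Fin d → ℝ)).symm.prodCongr
      (MeasurableEquiv.refl ℝ)) ((volume : Measure (E d)).prod (volume : Measure ℝ))
      ((volume : Measure (Fin d → ℝ)).prod volume) :=
    (PiLp.volume_preserving_ofLp (Fin d)).prod (MeasurePreserving.id _)
  have h2 : MeasurePreserving MeasurableEquiv.prodComm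
      ((volume : Measure (Fin d → ℝ)).prod (volume : Measure ℝ)) (volume.prod volume) :=
    Measure.measurePreserving_swap
  have h3 := (volume_preserving_piFinSuccAbove (fun _ : Fin (d + 1) => ℝ) (Fin.last d)).symm
  have h4 := PiLp.volume_preserving_toLp (Fin (d + 1))
  exact h4.comp (h3.comp (h2.comp h1))

/-- Fubini and the fundamental theorem of calculus on vertical half lines. Since f is supported in
the open unit ball, the flat boundary is the only one that contributes. -/
theorem integral_pd_last_halfSpace {f : E (d + 1) → E ℓ}
    (hf : IsTestFunction (Metric.ball 0 1) f) :
    ∫ x in halfBall d, pd (Fin.last d) f x =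
      - ∫ y in Metric.ball (0 : E d) 1, f (flatPoint y) := by
  set e : E (d + 1) := EuclideanSpace.single (Fin.last d) 1 with he
  have e1 : ∫ x in halfBall d, pd (Fin.last d) f x =
      ∫ x, ({x : E (d + 1) | 0 < x (Fin.last d)}.indicator (pd (Fin.last d) f)) x := by
    rw [← integral_indicator isOpen_halfBall.measurableSet]
    refine integral_congr_ae (Eventually.of_forall fun x => ?_)
    by_cases hx : x ∈ Metric.ball (0 : E (d + 1)) 1
    · by_cases hx' : 0 < x (Fin.last d)
      · rw [Set.indicator_of_mem (show x ∈ halfBall d from ⟨hx, hx'⟩),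
          Set.indicator_of_mem (show x ∈ {x : E (d + 1) | 0 < x (Fin.last d)} from hx')]
      · rw [Set.indicator_of_notMem (fun h : x ∈ halfBall d => hx' h.2),
          Set.indicator_of_notMem (show x ∉ {x : E (d + 1) | 0 < x (Fin.last d)} from hx')]
    · have : pd (Fin.last d) f x = 0 := (hf.pd _).eq_zero hx
      simp [Set.indicator, this]
  have hint : Integrable
      ({x : E (d + 1) | 0 < x (Fin.last d)}.indicator (pd (Fin.last d) f)) volume :=
    ((hf.pd _).integrable _).indicator (isOpen_lt continuous_const (by fun_prop)).measurableSet
  have hmp := measurePreserving_sliceEquiv (d := d)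
  rw [e1, ← hmp.integral_comp (sliceEquiv d).measurableEmbedding, integral_prod]
  swap
  · exact (hmp.integrable_comp_emb (sliceEquiv d).measurableEmbedding).2 hint
  have inner : ∀ y : E d, ∫ s : ℝ, ({x : E (d + 1) | 0 < x (Fin.last d)}.indicator
      (pd (Fin.last d) f)) (sliceEquiv d (y, s)) = - f (flatPoint y) := by
    intro y
    have hiso : Isometry (fun s : ℝ => flatPoint y + s • e) := by
      refine Isometry.of_dist_eq fun a b => ?_
      rw [dist_add_left, dist_eq_norm, ← sub_smul, norm_smul]
      simp [he, Real.dist_eq]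
    have hcs : HasCompactSupport (fun s : ℝ => f (flatPoint y + s • e)) :=
      hf.2.1.comp_isClosedEmbedding hiso.isClosedEmbedding
    have hcd : ContDiff ℝ 1 (fun s : ℝ => f (flatPoint y + s • e)) :=
      (hf.1.of_le (by exact_mod_cast le_top)).comp (by fun_prop)
    have hd : ∀ s, deriv (fun s : ℝ => f (flatPoint y + s • e)) s =
        pd (Fin.last d) f (flatPoint y + s • e) := by
      intro s
      have h1 : HasDerivAt (fun s : ℝ => flatPoint y + s • e) e s := by
        simpa using ((hasDerivAt_id s).smul_const e).const_add (flatPoint y)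
      exact ((diffAt hf.1 _).hasFDerivAt.comp_hasDerivAt s h1).deriv
    have h2 := hcs.integral_Ioi_deriv_eq hcd 0
    simp only [hd, zero_smul, add_zero] at h2
    rw [← h2, ← integral_indicator measurableSet_Ioi]
    refine integral_congr_ae (Eventually.of_forall fun s => ?_)
    simp only [sliceEquiv_apply]
    by_cases hs : 0 < s
    · rw [Set.indicator_of_mem (show slicePoint (y, s) ∈ {x : E (d + 1) | 0 < x (Fin.last d)} by
        simpa [slicePoint_last] using hs), Set.indicator_of_mem (show s ∈ Set.Ioi 0 from hs)]
      rfl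
    · rw [Set.indicator_of_notMem (show slicePoint (y, s) ∉ {x : E (d + 1) | 0 < x (Fin.last d)} by
        simpa [slicePoint_last] using hs), Set.indicator_of_notMem (show s ∉ Set.Ioi 0 from hs)]
  simp only [inner]
  rw [integral_neg, setIntegral_eq_integral_of_forall_compl_eq_zero]
  intro y hy
  refine hf.eq_zero fun h => hy ?_
  have hn : ‖flatPoint y‖ = ‖y‖ := by
    simp [EuclideanSpace.norm_eq, flatPoint, Fin.sum_univ_castSucc]
  simpa [hn] using h

/-! ### Extension by a constant across the flat boundary -/

/-- For the smooth functions f k that realize the trace, the divergence theorem leaves the boundary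
term -∫ φ (f k - c), which tends to zero. -/
theorem integral_pd_last_of_flatTrace {u g : E (d + 1) → E ℓ} {c : E ℓ}
    (hu : MemLp u 2 (volume.restrict (halfBall d)))
    (hg : MemLp g 2 (volume.restrict (halfBall d)))
    (hug : HasWeakPartial (halfBall d) (Fin.last d) u g)
    (htr : HasFlatTrace u (fun _ => c)) {φ : E (d + 1) → ℝ}
    (hφ : IsTestFunction (Metric.ball 0 1) φ) :
    ∫ x in halfBall d, pd (Fin.last d) φ x • (u x - c) = - ∫ x in halfBall d, φ x • g x := by
  obtain ⟨-, f, hf, hlim, hbd⟩ := htr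
  have hfc := fun k => memLp_halfBall_of_continuous (hf k).continuous
  have hfd := fun k => memLp_halfBall_of_continuous (contDiff_pd (hf k) (Fin.last d)).continuous
  have T0 : TendstoL2 (volume.restrict (halfBall d)) f u := by
    refine ⟨hfc, hu, tendsto_of_tendsto_of_tendsto_of_le_of_le tendsto_const_nhds hlim
      (fun _ => zero_le) fun k => ?_⟩
    rw [← eLpNorm_neg, neg_sub]
    simp only [wk2Norm]
    exact le_self_add
  have T1 : TendstoL2 (volume.restrict (halfBall d)) (fun k => pd (Fin.last d) (f k)) g := by
    refine ⟨hfd, hg, tendsto_of_tendsto_of_tendsto_of_le_of_le tendsto_const_nhds hlim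
      (fun _ => zero_le) fun k => ?_⟩
    have h1 : HasWeakPartial (halfBall d) (Fin.last d) (u - f k) (g - pd (Fin.last d) (f k)) :=
      .sub isOpen_halfBall hu hg (hfc k) (hfd k) hug (hasWeakPartial_of_contDiff (hf k) _)
    rw [← eLpNorm_neg, neg_sub, ← eLpNorm_congr_ae (h1.weakPartial_ae isOpen_halfBall)]
    simp only [wk2Norm]
    exact (Finset.single_le_sum (f := fun i => eLpNorm (weakPartial (halfBall d) i (u - f k)) 2
      (volume.restrict (halfBall d))) (fun _ _ => zero_le) (Finset.mem_univ (Fin.last d))).trans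
      le_add_self
  have hcont : Continuous (flatPoint : E d → E (d + 1)) := by
    unfold flatPoint
    refine (PiLp.continuous_toLp 2 _).comp (continuous_pi fun i => ?_)
    refine Fin.lastCases ?_ (fun j => ?_) i
    · simpa using continuous_const
    · simp only [Fin.snoc_castSucc]
      fun_prop
  have ball_mem : ∀ {F : Type} [NormedAddCommGroup F] {a : E d → F}, Continuous a →
      MemLp a 2 (volume.restrict (Metric.ball (0 : E d) 1)) := by
    intro F _ a ha
    have hK : IsCompact (Metric.closedBall (0 : E d) 1) := isCompact_closedBall _ _
    have : IsFiniteMeasure (volume.restrict (Metric.closedBall (0 : E d) 1)) :=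
      ⟨by simpa using hK.measure_lt_top⟩
    obtain ⟨C, hC⟩ := hK.exists_bound_of_continuousOn ha.continuousOn
    refine MemLp.mono_measure (Measure.restrict_mono Metric.ball_subset_closedBall le_rfl) ?_
    exact MemLp.of_bound ha.aestronglyMeasurable C
      ((ae_restrict_iff' hK.measurableSet).2 (Eventually.of_forall hC))
  have T2 : TendstoL2 (volume.restrict (Metric.ball (0 : E d) 1))
      (fun k y => f k (flatPoint y) - c) (fun _ => 0) := by
    refine ⟨fun k => ball_mem (by have := (hf k).continuous; fun_prop), MemLp.zero', ?_⟩
    refine hbd.congr fun k => ?_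
    congr 1
    ext y
    simp
  have Tc : TendstoL2 (volume.restrict (halfBall d)) (fun k => f k - fun _ => c)
      (u - fun _ => c) := T0.sub (.const (memLp_halfBall_of_continuous continuous_const))
  have L1 := Tc.tendsto_integral_smul ((hφ.pd (Fin.last d)).memLp 2 _)
  have L2 := T1.tendsto_integral_smul (hφ.memLp 2 _)
  have L3 := T2.tendsto_integral_smul (φ := fun y => φ (flatPoint y))
    (ball_mem (by have := hφ.1.continuous; fun_prop))
  have id : ∀ k, (∫ x in halfBall d, pd (Fin.last d) φ x • (f k - fun _ : E (d + 1) => c) x) +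
      ∫ x in halfBall d, φ x • pd (Fin.last d) (f k) x =
      - ∫ y in Metric.ball (0 : E d) 1, φ (flatPoint y) • (f k (flatPoint y) - c) := by
    intro k
    have hs : ContDiff ℝ ∞ (f k - fun _ => c) := (hf k).sub contDiff_const
    have h := integral_pd_last_halfSpace (hφ.smul_right hs)
    have hpd : pd (Fin.last d) (f k - fun _ => c) = pd (Fin.last d) (f k) := by
      rw [pd_sub (hf k) contDiff_const]
      ext x
      simp [pd]
    simp only [pd_smul hφ.1 hs, hpd] at h
    rw [integral_add] at h
    · rw [add_comm]
      exact h
    · exact (hφ.smul_right (contDiff_pd (hf k) _)).integrable _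
    · exact ((hφ.pd _).smul_right hs).integrable _
  have L4 := tendsto_nhds_unique ((L1.add L2).congr id) L3.neg
  simp only [smul_zero, integral_zero, neg_zero] at L4
  exact eq_neg_of_add_eq_zero_left L4

/-- The cutoffs depend on x_m alone, so tangential derivatives do not see them, however steep they
become. -/
theorem exists_cutoff (d : ℕ) : ∃ τ : ℕ → E (d + 1) → ℝ, (∀ k, ContDiff ℝ ∞ (τ k)) ∧
    (∀ k i, i ≠ Fin.last d → ∀ x, pd i (τ k) x = 0) ∧ (∀ k x, 0 ≤ τ k x) ∧ (∀ k x, τ k x ≤ 1) ∧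
    (∀ x, 0 < x (Fin.last d) → ∀ᶠ k in atTop, τ k x = 1) ∧
    ∀ k, tsupport (τ k) ⊆ {x | 0 < x (Fin.last d)} := by
  have hτ : ∀ k : ℕ, ContDiff ℝ ∞ fun x : E (d + 1) =>
      Real.smoothTransition (((k : ℝ) + 1) * x (Fin.last d) - 1) := fun k =>
    Real.smoothTransition.contDiff.comp (by fun_prop)
  refine ⟨fun k x => Real.smoothTransition (((k : ℝ) + 1) * x (Fin.last d) - 1), hτ, ?_,
    fun _ _ => Real.smoothTransition.nonneg _, fun _ _ => Real.smoothTransition.le_one _, ?_, ?_⟩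
  · intro k i hi x
    have h2 : HasDerivAt (fun t : ℝ => x + t • (EuclideanSpace.single i (1 : ℝ)))
        (EuclideanSpace.single i 1) 0 := by
      simpa using ((hasDerivAt_id (0 : ℝ)).smul_const _).const_add x
    have h4 := (diffAt (hτ k) (x + (0 : ℝ) • EuclideanSpace.single i (1 : ℝ))
      ).hasFDerivAt.comp_hasDerivAt (0 : ℝ) h2
    simp only [zero_smul, add_zero] at h4
    refine h4.unique ?_
    convert hasDerivAt_const (0 : ℝ) (Real.smoothTransition (((k : ℝ) + 1) * x (Fin.last d) - 1))
      using 1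
    ext t
    simp [hi.symm]
  · intro x hx0
    obtain ⟨N, hN⟩ := exists_nat_gt (2 / x (Fin.last d))
    filter_upwards [eventually_ge_atTop N] with k hk
    refine Real.smoothTransition.one_of_one_le ?_
    rw [div_lt_iff₀ hx0] at hN
    have : (N : ℝ) ≤ k := by exact_mod_cast hk
    nlinarith
  · intro k x hx
    have hcl : IsClosed {x : E (d + 1) | 1 ≤ ((k : ℝ) + 1) * x (Fin.last d)} :=
      isClosed_le continuous_const (by fun_prop)
    have h2 : x ∈ {x : E (d + 1) | 1 ≤ ((k : ℝ) + 1) * x (Fin.last d)} := by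
      refine closure_minimal (fun y hy => ?_) hcl hx
      by_contra hy'
      refine hy (Real.smoothTransition.zero_of_nonpos ?_)
      simp only [Set.mem_ofPred_eq, not_le] at hy'
      linarith
    have h3 : (0 : ℝ) < (k : ℝ) + 1 := by positivity
    exact pos_of_mul_pos_right (lt_of_lt_of_le one_pos h2) h3.le

/-- Tangential integration by parts needs no trace: test with τ_k φ, which vanishes near the flat
boundary, and let k → ∞ by dominated convergence. -/
theorem integral_pd_tangential {u g : E (d + 1) → E ℓ} {i : Fin (d + 1)} (hi : i ≠ Fin.last d)
    (hu : MemLp u 2 (volume.restrict (halfBall d)))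
    (hg : MemLp g 2 (volume.restrict (halfBall d)))
    (hug : HasWeakPartial (halfBall d) i u g) {φ : E (d + 1) → ℝ}
    (hφ : IsTestFunction (Metric.ball 0 1) φ) :
    ∫ x in halfBall d, pd i φ x • u x = - ∫ x in halfBall d, φ x • g x := by
  obtain ⟨τ, hτ, hpdτ, hτ0, hτ1, hlim, hsupp⟩ := exists_cutoff d
  have htest : ∀ k, IsTestFunction (halfBall d) (fun x => τ k x • φ x) := by
    intro k
    have h0 := hφ.smul_left (hτ k)
    exact ⟨h0.1, h0.2.1, fun x hx => ⟨h0.2.2 hx,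
      hsupp k (tsupport_smul_subset_left (τ k) φ hx)⟩⟩
  have dct : ∀ {F : E (d + 1) → E ℓ}, IntegrableOn F (halfBall d) volume →
      Tendsto (fun k => ∫ x in halfBall d, τ k x • F x) atTop (𝓝 (∫ x in halfBall d, F x)) := by
    intro F hF
    refine tendsto_integral_of_dominated_convergence (fun x => ‖F x‖)
      (fun k => (hτ k).continuous.aestronglyMeasurable.smul hF.1) hF.norm ?_ ?_
    · intro k
      refine Eventually.of_forall fun x => ?_
      rw [norm_smul, Real.norm_of_nonneg (hτ0 k x)]
      exact mul_le_of_le_one_left (norm_nonneg _) (hτ1 k x)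
    · refine (ae_restrict_iff' isOpen_halfBall.measurableSet).2 (Eventually.of_forall ?_)
      intro x hx
      refine tendsto_const_nhds.congr' ?_
      filter_upwards [hlim x hx.2] with k hk
      rw [hk, one_smul]
  have int : ∀ {a : E (d + 1) → E ℓ} {φ : E (d + 1) → ℝ}, IsTestFunction (Metric.ball 0 1) φ →
      MemLp a 2 (volume.restrict (halfBall d)) →
      IntegrableOn (fun x => φ x • a x) (halfBall d) volume := fun hφ ha =>
    TendstoL2.integrable_bilin (ContinuousLinearMap.lsmul ℝ ℝ) (hφ.memLp 2 _) ha
  refine tendsto_nhds_unique (dct (int (hφ.pd i) hu)) ((dct (int hφ hg)).neg.congr fun k => ?_)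
  have h := hug.2.2 _ (htest k)
  rw [partialDeriv_eq_pd] at h
  simp only [pd_smul (hτ k) hφ.1, hpdτ k i hi, zero_smul, add_zero] at h
  simp only [smul_smul, smul_eq_mul] at h ⊢
  exact h.symm

end HalfBall

/-- The first and second weak derivatives of a `W^{2,2}` function are in `L²`. -/
theorem MemWk2.weakPartial_props {m ℓ : ℕ} {Ω : Set (E m)} (hΩ : IsOpen Ω) {u : E m → E ℓ}
    (hu : MemWk2 Ω 2 u) (i : Fin m) :
    HasWeakPartial Ω i u (weakPartial Ω i u) ∧ MemLp (weakPartial Ω i u) 2 (volume.restrict Ω) ∧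
      ∀ j, HasWeakPartial Ω j (weakPartial Ω i u) (weakPartial Ω j (weakPartial Ω i u)) ∧
        MemLp (weakPartial Ω j (weakPartial Ω i u)) 2 (volume.restrict Ω) := by
  obtain ⟨g, hg, hgm, hgd⟩ := hu.2 i
  have e := hg.weakPartial_ae hΩ
  refine ⟨hg.weakPartial, hgm.ae_eq e.symm, fun j => ?_⟩
  obtain ⟨k, hk, hkm⟩ := hgd j
  have hk' := hk.congr hΩ e.symm EventuallyEq.rfl
  exact ⟨hk'.weakPartial, MemLp.ae_eq (hk'.weakPartial_ae hΩ).symm hkm⟩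

/-! ### Gluing weak derivatives across the flat boundary, and cutting off. -/

section Extension

variable {d ℓ : ℕ}

/-- The extension by zero is weakly differentiable exactly when integration by parts on the half
ball has no boundary term, even for φ that do not vanish on the flat part. -/
theorem hasWeakPartial_indicator {i : Fin (d + 1)} {a b : E (d + 1) → E ℓ}
    (ha : MemLp a 2 (volume.restrict (halfBall d)))
    (hb : MemLp b 2 (volume.restrict (halfBall d)))
    (h : ∀ φ : E (d + 1) → ℝ, IsTestFunction (Metric.ball 0 1) φ →
      ∫ x in halfBall d, pd i φ x • a x = - ∫ x in halfBall d, φ x • b x) :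
    HasWeakPartial (Metric.ball 0 1) i ((halfBall d).indicator a) ((halfBall d).indicator b) := by
  have hm := (isOpen_halfBall (d := d)).measurableSet
  refine .of_memLp Metric.isOpen_ball (((memLp_indicator_iff_restrict hm).2 ha).restrict _)
    (((memLp_indicator_iff_restrict hm).2 hb).restrict _) fun φ hφ => ?_
  rw [setIntegral_smul_of_test (hφ.pd i), setIntegral_smul_of_test hφ]
  have e : ∀ (ψ : E (d + 1) → ℝ) (f : E (d + 1) → E ℓ),
      ∫ x, ψ x • (halfBall d).indicator f x = ∫ x in halfBall d, ψ x • f x := by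
    intro ψ f
    rw [← integral_indicator hm]
    congr 1
    ext1 x
    exact (Set.indicator_smul_apply (halfBall d) ψ f x).symm
  rw [e, e, h φ hφ]

/-- Tangential directions produce no boundary term, ∂_m u is handled by u = c, and ∂_m ∂_m u by the
zero trace of ∂_m u. The remaining case, ∂_m of a tangential derivative, has no trace hypothesis of
its own. -/
theorem HasConstantFlatBoundaryValue.extension {u : E (d + 1) → E ℓ} {c : E ℓ}
    (hu : MemWk2 (halfBall d) 2 u) (hc : HasConstantFlatBoundaryValue u c) (i : Fin (d + 1)) :
    HasWeakPartial (Metric.ball 0 1) i ((halfBall d).indicator fun x => u x - c)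
        ((halfBall d).indicator (weakPartial (halfBall d) i u)) ∧
      ∀ j, HasWeakPartial (Metric.ball 0 1) j ((halfBall d).indicator (weakPartial (halfBall d) i u))
        ((halfBall d).indicator (weakPartial (halfBall d) j (weakPartial (halfBall d) i u))) := by
  have P := fun i => hu.weakPartial_props isOpen_halfBall i
  have hu0 : MemLp u 2 (volume.restrict (halfBall d)) := hu.1
  have hconst : MemLp (fun _ : E (d + 1) => c) 2 (volume.restrict (halfBall d)) :=
    memLp_halfBall_of_continuous continuous_const
  have huc := hu0.sub hconst
  have first : ∀ (i : Fin (d + 1)) (φ : E (d + 1) → ℝ), IsTestFunction (Metric.ball 0 1) φ →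
      ∫ x in halfBall d, pd i φ x • (u x - c) =
        - ∫ x in halfBall d, φ x • weakPartial (halfBall d) i u x := by
    intro i φ hφ
    by_cases hi : i = Fin.last d
    · subst hi
      exact integral_pd_last_of_flatTrace hu0 (P _).2.1 (P _).1 hc.1 hφ
    · refine integral_pd_tangential hi huc (P i).2.1 ?_ hφ
      have h0 : HasWeakPartial (halfBall d) i (fun _ => c) (0 : E (d + 1) → E ℓ) := by
        have := hasWeakPartial_of_contDiff (Ω := halfBall d) (f := fun _ : E (d + 1) => c)
          contDiff_const i
        convert this using 1
        ext1 x
        simp [pd]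
      have := (P i).1.sub isOpen_halfBall hu0 (P i).2.1 hconst MemLp.zero h0
      simpa using this
  refine ⟨hasWeakPartial_indicator huc (P i).2.1 (first i), fun j =>
    hasWeakPartial_indicator (P i).2.1 ((P i).2.2 j).2 fun φ hφ => ?_⟩
  by_cases hj : j = Fin.last d
  · subst hj
    by_cases hi : i = Fin.last d
    · subst hi
      have := integral_pd_last_of_flatTrace (P _).2.1 ((P _).2.2 _).2 ((P _).2.2 _).1 hc.2 hφ
      simpa using this
    -- The order of differentiation is exchanged on the test function: ∫ ∂_mφ ∂_i u = -∫ ∂_i∂_mφ (u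
    -- - c) = ∫ ∂_iφ ∂_m u = -∫ φ ∂_i∂_m u, and the last step is tangential.
    · have swap : ∀ φ : E (d + 1) → ℝ, IsTestFunction (Metric.ball 0 1) φ →
          ∫ x in halfBall d, pd (Fin.last d) φ x • weakPartial (halfBall d) i u x =
          - ∫ x in halfBall d, φ x • weakPartial (halfBall d) i
            (weakPartial (halfBall d) (Fin.last d) u) x := by
        intro φ hφ
        have a1 := first i _ (hφ.pd (Fin.last d))
        have a2 := first (Fin.last d) _ (hφ.pd i)
        have a3 := integral_pd_tangential hi (P (Fin.last d)).2.1 ((P (Fin.last d)).2.2 i).2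
          ((P (Fin.last d)).2.2 i).1 hφ
        rw [pd_comm hφ.1, a2, neg_inj] at a1
        rw [← a1, a3]
      have hw : HasWeakPartial (halfBall d) (Fin.last d) (weakPartial (halfBall d) i u)
          (weakPartial (halfBall d) i (weakPartial (halfBall d) (Fin.last d) u)) :=
        .of_memLp isOpen_halfBall (P i).2.1 ((P (Fin.last d)).2.2 i).2
          fun φ hφ => swap φ (hφ.mono halfBall_subset_ball)
      rw [swap φ hφ]
      congr 1
      refine integral_congr_ae ?_
      filter_upwards [hw.weakPartial_ae isOpen_halfBall] with x hx
      rw [hx]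
  · exact integral_pd_tangential hj (P i).2.1 ((P i).2.2 j).2 ((P i).2.2 j).1 hφ

/-! ### Cutting off -/

theorem IsTestFunction.memLp_smul {m : ℕ} {Ω : Set (E m)} {χ : E m → ℝ} {a : E m → E ℓ}
    (hχ : IsTestFunction Ω χ) (ha : MemLp a 2 volume) : MemLp (fun x => χ x • a x) 2 volume := by
  obtain ⟨C, hC⟩ := hχ.bounded
  exact ((TendstoL2.const ha).smul_bounded hχ.1.continuous.aestronglyMeasurable hC).mem_lim

/-- For arbitrary test φ on the whole space, φχ is a test function in Ω; this turns a local weak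
derivative into a global one. -/
theorem HasWeakPartial.smul_test {m : ℕ} {Ω : Set (E m)} {i : Fin m} {a b : E m → E ℓ}
    (ha : MemLp a 2 volume) (hb : MemLp b 2 volume) (h : HasWeakPartial Ω i a b)
    {χ : E m → ℝ} (hχ : IsTestFunction Ω χ) :
    HasWeakPartial Set.univ i (fun x => χ x • a x) (fun x => χ x • b x + pd i χ x • a x) := by
  refine .of_memLp isOpen_univ ((hχ.memLp_smul ha).restrict _)
    (((hχ.memLp_smul hb).add ((hχ.pd i).memLp_smul ha)).restrict _) fun φ hφ => ?_
  have ht : IsTestFunction Ω (fun x => φ x • χ x) := hχ.smul_left hφ.1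
  have e := h.2.2 _ ht
  rw [partialDeriv_eq_pd, setIntegral_smul_of_test ht, setIntegral_smul_of_test (ht.pd i)] at e
  have int : ∀ {ψ : E m → ℝ} {v : E m → E ℓ}, IsTestFunction Ω ψ → MemLp v 2 volume →
      Integrable (fun x => ψ x • v x) volume := fun hψ hv =>
    TendstoL2.integrable_bilin (ContinuousLinearMap.lsmul ℝ ℝ) (hψ.memLp 2 _) hv
  have i1 := int ((hχ.pd i).smul_left hφ.1) ha
  have i2 := int (hχ.smul_left (hφ.pd i).1) ha
  have i3 := int ht hb
  simp only [pd_smul hφ.1 hχ.1, add_smul] at e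
  rw [integral_add i1 i2] at e
  simp only [Measure.restrict_univ, smul_add, smul_smul]
  simp only [smul_eq_mul] at e i1 i2 i3
  rw [integral_add i3 i1, neg_add, ← e]
  abel

/-- Near the origin, `u - c` extended by `0` across the flat part of the boundary agrees with a
compactly supported function on `ℝ^(d+1)` which has two weak derivatives in `L²`. -/
theorem HasConstantFlatBoundaryValue.exists_extension {u : E (d + 1) → E ℓ} {c : E ℓ}
    (hu : MemWk2 (halfBall d) 2 u) (hc : HasConstantFlatBoundaryValue u c) :
    ∃ (w : E (d + 1) → E ℓ) (g : Fin (d + 1) → E (d + 1) → E ℓ)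
      (h : Fin (d + 1) → Fin (d + 1) → E (d + 1) → E ℓ),
      MemLp w 2 volume ∧ (∀ i, MemLp (g i) 2 volume) ∧ (∀ i j, MemLp (h i j) 2 volume) ∧
      (∀ i, HasWeakPartial Set.univ i w (g i)) ∧
      (∀ i j, HasWeakPartial Set.univ j (g i) (h i j)) ∧
      (∀ x, x ∉ halfBall d ∩ Metric.closedBall 0 (7 / 8) →
        w x = 0 ∧ (∀ i, g i x = 0) ∧ ∀ i j, h i j x = 0) ∧
      ∀ x ∈ halfBall d ∩ Metric.ball 0 (3 / 4), w x = u x - c ∧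
        (∀ i, g i x = weakPartial (halfBall d) i u x) ∧
        ∀ i j, h i j x = weakPartial (halfBall d) j (weakPartial (halfBall d) i u) x := by
  have hm := (isOpen_halfBall (d := d)).measurableSet
  have P := fun i => hu.weakPartial_props isOpen_halfBall i
  have Ex := hc.extension hu
  -- The cutoff equals 1 on the ball of radius 3/4, where all comparisons happen; 7/8 < 1 leaves
  -- room for the mollification.
  let b : ContDiffBump (0 : E (d + 1)) := ⟨3 / 4, 7 / 8, by norm_num, by norm_num⟩
  let χ : E (d + 1) → ℝ := b
  have hsupp : tsupport χ = Metric.closedBall 0 (7 / 8) := b.tsupport_eq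
  have hχ : IsTestFunction (Metric.ball (0 : E (d + 1)) 1) χ :=
    ⟨b.contDiff, b.hasCompactSupport, by
      rw [hsupp]; exact Metric.closedBall_subset_ball (by norm_num)⟩
  set w0 : E (d + 1) → E ℓ := (halfBall d).indicator fun x => u x - c with hw0
  set g0 : Fin (d + 1) → E (d + 1) → E ℓ := fun i =>
    (halfBall d).indicator (weakPartial (halfBall d) i u) with hg0
  set h0 : Fin (d + 1) → Fin (d + 1) → E (d + 1) → E ℓ := fun i j =>
    (halfBall d).indicator (weakPartial (halfBall d) j (weakPartial (halfBall d) i u)) with hh0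
  have hconst : MemLp (fun _ : E (d + 1) => c) 2 (volume.restrict (halfBall d)) :=
    memLp_halfBall_of_continuous continuous_const
  have hw0m : MemLp w0 2 volume := (memLp_indicator_iff_restrict hm).2 (hu.1.sub hconst)
  have hg0m : ∀ i, MemLp (g0 i) 2 volume := fun i =>
    (memLp_indicator_iff_restrict hm).2 (P i).2.1
  have hh0m : ∀ i j, MemLp (h0 i j) 2 volume := fun i j =>
    (memLp_indicator_iff_restrict hm).2 ((P i).2.2 j).2
  have g1m : ∀ i, MemLp (fun x => χ x • g0 i x + pd i χ x • w0 x) 2 volume := fun i =>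
    MemLp.add (hχ.memLp_smul (hg0m i)) ((hχ.pd i).memLp_smul hw0m)
  have h1m : ∀ i j, MemLp (fun x => χ x • h0 i j x + pd j χ x • g0 i x) 2 volume := fun i j =>
    MemLp.add (hχ.memLp_smul (hh0m i j)) ((hχ.pd j).memLp_smul (hg0m i))
  have h2m : ∀ i j, MemLp (fun x => pd i χ x • g0 j x + pd j (pd i χ) x • w0 x) 2 volume :=
    fun i j => MemLp.add ((hχ.pd i).memLp_smul (hg0m j)) (((hχ.pd i).pd j).memLp_smul hw0m)
  refine ⟨fun x => χ x • w0 x, fun i x => χ x • g0 i x + pd i χ x • w0 x,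
    fun i j => (fun x => χ x • h0 i j x + pd j χ x • g0 i x) +
      (fun x => pd i χ x • g0 j x + pd j (pd i χ) x • w0 x),
    hχ.memLp_smul hw0m, g1m, fun i j => (h1m i j).add (h2m i j),
    fun i => (Ex i).1.smul_test hw0m (hg0m i) hχ, fun i j => ?_, ?_, ?_⟩
  · exact HasWeakPartial.add isOpen_univ ((hχ.memLp_smul (hg0m i)).restrict _) ((h1m i j).restrict _)
      (((hχ.pd i).memLp_smul hw0m).restrict _) ((h2m i j).restrict _)
      (((Ex i).2 j).smul_test (hg0m i) (hh0m i j) hχ)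
      ((Ex j).1.smul_test hw0m (hg0m j) (hχ.pd i))
  · intro x hx
    by_cases hxΩ : x ∈ halfBall d
    · have hx' : x ∉ tsupport χ := by
        rw [hsupp]
        exact fun h => hx ⟨hxΩ, h⟩
      have e0 : χ x = 0 := image_eq_zero_of_notMem_tsupport hx'
      have e1 : ∀ i, pd i χ x = 0 := fun i => pd_eq_zero_of_notMem hx'
      have e2 : ∀ i j, pd j (pd i χ) x = 0 := fun i j =>
        pd_eq_zero_of_notMem fun h => hx' (tsupport_pd_subset i h)
      simp [e0, e1, e2]
    · simp [hw0, hg0, hh0, Set.indicator_of_notMem hxΩ]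
  · intro x hx
    have loc : χ =ᶠ[𝓝 x] fun _ => (1 : ℝ) := by
      filter_upwards [Metric.isOpen_ball.mem_nhds hx.2] with y hy
      exact b.one_of_mem_closedBall (Metric.ball_subset_closedBall hy)
    have e0 : χ x = 1 := loc.eq_of_nhds
    have l1 : ∀ i, pd i χ =ᶠ[𝓝 x] fun _ => (0 : ℝ) := by
      intro i
      filter_upwards [loc.fderiv (𝕜 := ℝ)] with y hy
      simp [pd, hy]
    have e1 : ∀ i, pd i χ x = 0 := fun i => (l1 i).eq_of_nhds
    have e2 : ∀ i j, pd j (pd i χ) x = 0 := by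
      intro i j
      have := ((l1 i).fderiv (𝕜 := ℝ)).eq_of_nhds
      simp [pd, show fderiv ℝ (pd i χ) x = _ from this]
    simp [e0, e1, e2, hw0, hg0, hh0, Set.indicator_of_mem hx.1]

end Extension

/-! ### Mollification -/

section Mollify

open scoped Convolution

variable {m ℓ : ℕ}

/-- The translation action on L² is continuous. -/
theorem MemLp.tendsto_translate {w : E m → E ℓ} (hw : MemLp w 2 volume) {ε : ℝ≥0∞} (hε : 0 < ε) :
    ∀ᶠ t in 𝓝 (0 : E m), eLpNorm (fun x => w (x - t) - w x) 2 volume ≤ ε := by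
  have : Fact ((2 : ℝ≥0∞) ≠ ⊤) := ⟨by norm_num⟩
  have hc : Continuous fun t : E m => DomAddAct.mk (-t) +ᵥ hw.toLp w :=
    (DomAddAct.continuous_mk.comp continuous_neg).vadd continuous_const
  have h0 := hc.tendsto 0
  have e0 : DomAddAct.mk (-(0 : E m)) +ᵥ hw.toLp w = hw.toLp w := by simp
  rw [e0] at h0
  have h1 := (EMetric.tendsto_nhds.1 h0) ε hε
  filter_upwards [h1] with t ht
  rw [DomAddAct.mk_vadd_toLp, Lp.edist_toLp_toLp] at ht
  refine le_trans (le_of_eq ?_) ht.le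
  congr 1
  ext1 x
  simp [sub_eq_add_neg, add_comm]

/-- Jensen's inequality for the probability density k, as Cauchy–Schwarz applied to k^{1/2} and
k^{1/2} a. -/
theorem sq_lintegral_mul_le {k a : E m → ℝ≥0∞} (hk : Measurable k) (ha : Measurable a)
    (h1 : ∫⁻ t, k t = 1) : (∫⁻ t, k t * a t) ^ 2 ≤ ∫⁻ t, k t * a t ^ 2 := by
  have h := ENNReal.lintegral_mul_le_Lp_mul_Lq volume (p := 2) (q := 2)
    (by rw [Real.holderConjugate_iff]; norm_num)
    (f := fun t => k t ^ (1 / 2 : ℝ)) (g := fun t => k t ^ (1 / 2 : ℝ) * a t)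
    (hk.pow_const _).aemeasurable ((hk.pow_const _).mul ha).aemeasurable
  have hk2 : ∀ t, k t ^ (1 / 2 : ℝ) * k t ^ (1 / 2 : ℝ) = k t := by
    intro t
    rw [← ENNReal.rpow_add_of_nonneg _ _ (by norm_num) (by norm_num)]
    norm_num
  have e1 : ∀ t, (k t ^ (1 / 2 : ℝ)) ^ (2 : ℝ) = k t := by
    intro t
    rw [ENNReal.rpow_two, sq, hk2]
  have e2 : ∀ t, (k t ^ (1 / 2 : ℝ) * a t) ^ (2 : ℝ) = k t * a t ^ 2 := by
    intro t
    rw [ENNReal.rpow_two, mul_pow, sq (k t ^ (1 / 2 : ℝ)), hk2]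
  simp only [Pi.mul_apply, ← mul_assoc, hk2, e1, e2, h1, ENNReal.one_rpow, one_mul] at h
  calc (∫⁻ t, k t * a t) ^ 2 ≤ ((∫⁻ t, k t * a t ^ 2) ^ (1 / 2 : ℝ)) ^ 2 := by gcongr
    _ = _ := by
      rw [← ENNReal.rpow_natCast, ← ENNReal.rpow_mul]
      norm_num

theorem eLpNorm_two_sq {α F : Type*} [MeasurableSpace α] [NormedAddCommGroup F] (μ : Measure α)
    (f : α → F) : eLpNorm f 2 μ ^ 2 = ∫⁻ x, ‖f x‖ₑ ^ 2 ∂μ := by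
  rw [eLpNorm_eq_lintegral_rpow_enorm_toReal (by norm_num) (by norm_num),
    ← ENNReal.rpow_natCast, ← ENNReal.rpow_mul]
  norm_num

/-- K ⋆ w - w is an average of the differences w(· - t) - w, so Jensen and Tonelli bound its L² norm
by the largest translation error over the support of K. The support need not be centred at the
origin. -/
theorem eLpNorm_convolution_sub_le {K : E m → ℝ} (hK : Continuous K) (hKc : HasCompactSupport K)
    (hK0 : ∀ x, 0 ≤ K x) (hK1 : ∫ x, K x = 1) {w : E m → E ℓ} (hw : MemLp w 2 volume)
    {ε : ℝ≥0∞} (hε : ∀ t, K t ≠ 0 → eLpNorm (fun x => w (x - t) - w x) 2 volume ≤ ε) :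
    eLpNorm ((K ⋆[ContinuousLinearMap.lsmul ℝ ℝ, volume] w) - w) 2 volume ≤ ε := by
  -- Tonelli needs joint measurability of (x, t) ↦ w(x - t) - w(x), hence a measurable
  -- representative.
  wlog hsm : StronglyMeasurable w generalizing w
  · obtain ⟨w', hw', hww'⟩ := hw.1
    have hc : (K ⋆[ContinuousLinearMap.lsmul ℝ ℝ, volume] w) =
        (K ⋆[ContinuousLinearMap.lsmul ℝ ℝ, volume] w') :=
      convolution_congr _ EventuallyEq.rfl hww'
    have := this (hw.ae_eq hww') (fun t ht => ?_) hw'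
    · rw [hc, eLpNorm_congr_ae (show _ =ᵐ[volume]
        (K ⋆[ContinuousLinearMap.lsmul ℝ ℝ, volume] w') - w' from
          EventuallyEq.rfl.sub hww')]
      exact this
    · refine le_trans (le_of_eq (eLpNorm_congr_ae ?_)) (hε t ht)
      have h2 : ∀ᵐ x ∂(volume : Measure (E m)), w (x - t) = w' (x - t) :=
        (measurePreserving_sub_right volume t).quasiMeasurePreserving.ae hww'
      filter_upwards [hww', h2] with x h3 h4
      rw [h3, h4]
  have hloc : LocallyIntegrable w volume := hw.locallyIntegrable (by norm_num)
  have hex := hKc.convolutionExists_left (ContinuousLinearMap.lsmul ℝ ℝ) hK hloc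
  have hKi : Integrable K volume := hK.integrable_of_hasCompactSupport hKc
  have hk : Measurable fun t => ‖K t‖ₑ := hK.measurable.enorm
  have hk1 : ∫⁻ t, ‖K t‖ₑ = 1 := by
    have := ofReal_integral_eq_lintegral_ofReal hKi (Eventually.of_forall hK0)
    rw [hK1, ENNReal.ofReal_one] at this
    rw [this]
    refine lintegral_congr fun t => ?_
    rw [Real.enorm_of_nonneg (hK0 t)]
  have hwm : Measurable w := hsm.measurable
  have pt : ∀ x, ‖((K ⋆[ContinuousLinearMap.lsmul ℝ ℝ, volume] w) - w) x‖ₑ ^ 2 ≤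
      ∫⁻ t, ‖K t‖ₑ * ‖w (x - t) - w x‖ₑ ^ 2 := by
    intro x
    have e : ((K ⋆[ContinuousLinearMap.lsmul ℝ ℝ, volume] w) - w) x =
        ∫ t, K t • (w (x - t) - w x) := by
      simp only [Pi.sub_apply, smul_sub]
      have hi : Integrable (fun t => K t • w (x - t)) volume := hex x
      rw [integral_sub hi (hKi.smul_const _), integral_smul_const, hK1, one_smul]
      rfl
    rw [e]
    refine (pow_le_pow_left' (enorm_integral_le_lintegral_enorm _) 2).trans ?_
    simp only [enorm_smul]
    exact sq_lintegral_mul_le hk (by fun_prop) hk1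
  have h2 : eLpNorm ((K ⋆[ContinuousLinearMap.lsmul ℝ ℝ, volume] w) - w) 2 volume ^ 2 ≤ ε ^ 2 := by
    rw [eLpNorm_two_sq]
    calc _ ≤ ∫⁻ x, ∫⁻ t, ‖K t‖ₑ * ‖w (x - t) - w x‖ₑ ^ 2 := lintegral_mono pt
      _ = ∫⁻ t, ∫⁻ x, ‖K t‖ₑ * ‖w (x - t) - w x‖ₑ ^ 2 := by
        refine lintegral_lintegral_swap (Measurable.aemeasurable ?_)
        have : Measurable fun p : E m × E m => ‖K p.2‖ₑ := hk.comp measurable_snd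
        have h3 : Measurable fun p : E m × E m => w (p.1 - p.2) - w p.1 :=
          (hwm.comp (measurable_fst.sub measurable_snd)).sub (hwm.comp measurable_fst)
        exact this.mul (h3.enorm.pow_const 2)
      _ ≤ ∫⁻ t, ‖K t‖ₑ * ε ^ 2 := by
        refine lintegral_mono fun t => ?_
        rw [lintegral_const_mul _ (by fun_prop), ← eLpNorm_two_sq]
        by_cases ht : K t = 0
        · simp [ht]
        · gcongr
          exact hε t ht
      _ = ε ^ 2 := by rw [lintegral_mul_const _ hk, hk1, one_mul]
  exact (ENNReal.pow_le_pow_left_iff (by norm_num)).1 h2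

/-- Use t ↦ K(x - t) as a test function in the definition of the weak derivative. -/
theorem pd_convolution {K : E m → ℝ} (hK : ContDiff ℝ ∞ K) (hKc : HasCompactSupport K)
    {w g : E m → E ℓ} {i : Fin m} (hw : LocallyIntegrable w volume)
    (h : HasWeakPartial Set.univ i w g) :
    pd i (K ⋆[ContinuousLinearMap.lsmul ℝ ℝ, volume] w) =
      (K ⋆[ContinuousLinearMap.lsmul ℝ ℝ, volume] g) := by
  ext1 x
  have h1 := hKc.hasFDerivAt_convolution_left (ContinuousLinearMap.lsmul ℝ ℝ)
    (hK.of_le (by exact_mod_cast le_top)) hw x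
  have hcs := hKc.fderiv (𝕜 := ℝ)
  have hex := hcs.convolutionExists_left
    ((ContinuousLinearMap.lsmul ℝ ℝ : ℝ →L[ℝ] E ℓ →L[ℝ] E ℓ).precompL (E m))
    (hK.continuous_fderiv (by simp)) hw x
  have h2 : pd i (K ⋆[ContinuousLinearMap.lsmul ℝ ℝ, volume] w) x = ∫ t, pd i K t • w (x - t) := by
    rw [pd, h1.fderiv, convolution, ContinuousLinearMap.integral_apply hex]
    rfl
  have h3 : IsTestFunction Set.univ fun t => K (x - t) := by
    refine ⟨hK.comp (by fun_prop), ?_, Set.subset_univ _⟩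
    exact hKc.comp_homeomorph (Homeomorph.subLeft x)
  have h4 := h.2.2 _ h3
  have h5 : ∀ t, pd i (fun t => K (x - t)) t = - pd i K (x - t) := by
    intro t
    have hd : HasFDerivAt (fun t => x - t) (-ContinuousLinearMap.id ℝ (E m)) t := by
      simpa using (hasFDerivAt_id t).const_sub x
    have := ((diffAt hK (x - t)).hasFDerivAt.comp t hd).fderiv
    simp only [pd]
    change fderiv ℝ (K ∘ fun t => x - t) t _ = _
    rw [this]
    simp
  rw [h2, convolution_eq_swap]
  rw [partialDeriv_eq_pd] at h4
  simp only [h5, Measure.restrict_univ, neg_smul, integral_neg, neg_inj] at h4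
  rw [← integral_sub_left_eq_self _ _ x]
  simp only [sub_sub_cancel]
  exact h4

end Mollify

/-! ### Approximation by test functions of the open half ball. -/

section Approximation

open scoped Convolution

variable {d ℓ : ℕ}

/-- A mollifier supported in the upper half space. -/
def upperBump (d : ℕ) (k : ℕ) :
    ContDiffBump ((2 * (1 / (32 * ((k : ℝ) + 1)))) • EuclideanSpace.single (Fin.last d) (1 : ℝ)) :=
  ⟨1 / (32 * ((k : ℝ) + 1)) / 2, 1 / (32 * ((k : ℝ) + 1)), by positivity,
    half_lt_self (by positivity)⟩

/-- With r = 1/(32(k+1)) the kernel lives in the ball of radius r about 2r e_m, thus at heights at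
least r and at distance at most 3r from the origin. -/
theorem upperBump_support {k : ℕ} {t : E (d + 1)} (ht : (upperBump d k).normed volume t ≠ 0) :
    ‖t‖ ≤ 3 * (1 / (32 * ((k : ℝ) + 1))) ∧ 1 / (32 * ((k : ℝ) + 1)) ≤ t (Fin.last d) := by
  have h1 : t ∈ tsupport ((upperBump d k).normed volume) := subset_tsupport _ ht
  rw [ContDiffBump.tsupport_normed_eq, mem_closedBall_iff_norm] at h1
  set r := 1 / (32 * ((k : ℝ) + 1)) with hr
  have hr0 : 0 < r := by positivity
  change ‖t - (2 * r) • EuclideanSpace.single (Fin.last d) (1 : ℝ)‖ ≤ r at h1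
  constructor
  · have h2 := norm_add_le (t - (2 * r) • EuclideanSpace.single (Fin.last d) (1 : ℝ))
      ((2 * r) • EuclideanSpace.single (Fin.last d) (1 : ℝ))
    rw [sub_add_cancel, norm_smul, PiLp.norm_single, norm_one, mul_one,
      Real.norm_of_nonneg (by positivity)] at h2
    linarith
  · have h2 := PiLp.norm_apply_le (t - (2 * r) • EuclideanSpace.single (Fin.last d) (1 : ℝ))
      (Fin.last d)
    have h3 := neg_abs_le (t (Fin.last d) - 2 * r)
    simp only [PiLp.sub_apply, PiLp.smul_apply, PiLp.single_apply, if_true, smul_eq_mul, mul_one,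
      Real.norm_eq_abs] at h2
    linarith

/-- Convolution with a kernel supported at heights ≥ r lifts the support of w off the flat boundary
by r, and enlarges it by at most 3r; since 7/8 + 3/32 < 1, it stays in the unit ball. Derivatives
commute with the convolution, so all of them converge in L². -/
theorem exists_isW22Limit {w : E (d + 1) → E ℓ} {g : Fin (d + 1) → E (d + 1) → E ℓ}
    {h : Fin (d + 1) → Fin (d + 1) → E (d + 1) → E ℓ}
    (hw : MemLp w 2 volume) (hg : ∀ i, MemLp (g i) 2 volume) (hh : ∀ i j, MemLp (h i j) 2 volume)
    (hwg : ∀ i, HasWeakPartial Set.univ i w (g i))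
    (hgh : ∀ i j, HasWeakPartial Set.univ j (g i) (h i j))
    (hsupp : ∀ x, x ∉ halfBall d ∩ Metric.closedBall 0 (7 / 8) → w x = 0) :
    ∃ f, IsW22Limit (halfBall d) f w g h := by
  let K : ℕ → E (d + 1) → ℝ := fun k => (upperBump d k).normed volume
  have hK : ∀ k, ContDiff ℝ ∞ (K k) := fun k => (upperBump d k).contDiff_normed
  have hKc : ∀ k, HasCompactSupport (K k) := fun k => (upperBump d k).hasCompactSupport_normed
  let f : ℕ → E (d + 1) → E ℓ := fun k => (K k ⋆[ContinuousLinearMap.lsmul ℝ ℝ, volume] w)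
  have loc : ∀ {v : E (d + 1) → E ℓ}, MemLp v 2 volume → LocallyIntegrable v volume :=
    fun hv => hv.locallyIntegrable (by norm_num)
  have test : ∀ k, IsTestFunction (halfBall d) (f k) := by
    intro k
    set r := 1 / (32 * ((k : ℝ) + 1)) with hr
    have hr0 : 0 < r := by positivity
    have hr1 : r ≤ 1 / 32 := by
      rw [hr]
      apply one_div_le_one_div_of_le (by norm_num)
      have : (0 : ℝ) ≤ k := by positivity
      linarith
    let S : Set (E (d + 1)) := Metric.closedBall 0 (7 / 8 + 3 * r) ∩ {x | r ≤ x (Fin.last d)}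
    have hcl : IsClosed {x : E (d + 1) | r ≤ x (Fin.last d)} :=
      isClosed_le continuous_const (by fun_prop)
    have hS : IsCompact S := (isCompact_closedBall _ _).inter_right hcl
    have hsub : Function.support (f k) ⊆ S := by
      intro x hx
      by_contra hxS
      refine hx ?_
      have : ∀ t, K k t • w (x - t) = 0 := by
        intro t
        by_cases ht : K k t = 0
        · rw [ht, zero_smul]
        · obtain ⟨h1, h2⟩ := upperBump_support ht
          rw [hsupp (x - t), smul_zero]
          rintro ⟨⟨-, h3⟩, h4⟩
          refine hxS ⟨?_, ?_⟩
          · rw [mem_closedBall_zero_iff] at h4 ⊢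
            have := norm_add_le (x - t) t
            rw [sub_add_cancel] at this
            linarith
          · have h3' : 0 < x (Fin.last d) - t (Fin.last d) := h3
            change r ≤ x (Fin.last d)
            linarith
      change ∫ t, K k t • w (x - t) = 0
      simp [this]
    have hts : tsupport (f k) ⊆ S := closure_minimal hsub hS.isClosed
    refine ⟨(hKc k).contDiff_convolution_left _ (hK k) (loc hw),
      hS.of_isClosed_subset (isClosed_tsupport _) hts, fun x hx => ?_⟩
    obtain ⟨h1, h2⟩ := hts hx
    refine ⟨?_, lt_of_lt_of_le hr0 h2⟩
    rw [mem_closedBall_zero_iff] at h1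
    rw [mem_ball_zero_iff]
    linarith
  have conv : ∀ {v : E (d + 1) → E ℓ}, MemLp v 2 volume → Tendsto (fun k =>
      eLpNorm ((K k ⋆[ContinuousLinearMap.lsmul ℝ ℝ, volume] v) - v) 2 volume) atTop (𝓝 0) := by
    intro v hv
    rw [ENNReal.tendsto_nhds_zero]
    intro ε hε
    obtain ⟨δ, hδ, hball⟩ := Metric.eventually_nhds_iff.1 (MemLp.tendsto_translate hv hε)
    obtain ⟨N, hN⟩ := exists_nat_gt (1 / δ)
    filter_upwards [eventually_ge_atTop N] with k hk
    refine eLpNorm_convolution_sub_le (hK k).continuous (hKc k)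
      (fun x => (upperBump d k).nonneg_normed x) (upperBump d k).integral_normed hv
      fun t ht => hball ?_
    have h1 := (upperBump_support ht).1
    have hk' : (N : ℝ) ≤ k := by exact_mod_cast hk
    rw [dist_zero_right]
    refine h1.trans_lt ?_
    rw [div_lt_iff₀ hδ] at hN
    rw [mul_one_div, div_lt_iff₀ (by positivity)]
    nlinarith
  have d1 : ∀ k i, pd i (f k) = (K k ⋆[ContinuousLinearMap.lsmul ℝ ℝ, volume] g i) := fun k i =>
    pd_convolution (hK k) (hKc k) (loc hw) (hwg i)
  have d2 : ∀ k i j, pd j (pd i (f k)) = (K k ⋆[ContinuousLinearMap.lsmul ℝ ℝ, volume] h i j) :=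
    fun k i j => by
      rw [d1]
      exact pd_convolution (hK k) (hKc k) (loc (hg i)) (hgh i j)
  refine ⟨f, test, ⟨fun k => (test k).memLp 2 _, hw, conv hw⟩,
    fun i => ⟨fun k => ((test k).pd i).memLp 2 _, hg i, (conv (hg i)).congr fun k => ?_⟩,
    fun i j => ⟨fun k => (((test k).pd i).pd j).memLp 2 _, hh i j,
      (conv (hh i j)).congr fun k => ?_⟩⟩
  · simp only [d1]
  · simp only [d2]

end Approximation

/-! ### Deformations of the domain in a coordinate direction -/

section Shift

variable {m ℓ : ℕ}

/-- The deformation `x ↦ x - t η(x) e_p` of `ℝ^m`. -/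
def shift (η : E m → ℝ) (p : Fin m) (t : ℝ) (x : E m) : E m :=
  x - (t * η x) • EuclideanSpace.single p (1 : ℝ)

/-- `t` is so small that `shift η p t` is a diffeomorphism with controlled Jacobian. -/
structure IsSmallShift (η : E m → ℝ) (p : Fin m) (t : ℝ) : Prop where
  nonneg : 0 ≤ t
  le_one : t ≤ 1
  bij : Function.Bijective (shift η p t)
  jac : ∀ x, 1 / 2 ≤ 1 - t * pd p η x

theorem abs_pd_le_of_lipschitz {η : E m → ℝ} {L : NNReal} (hL : LipschitzWith L η) (p : Fin m)
    (x : E m) : |pd p η x| ≤ L := by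
  have h1 := norm_fderiv_le_of_lipschitz ℝ hL (x₀ := x)
  have h2 := (fderiv ℝ η x).le_opNorm (EuclideanSpace.single p (1 : ℝ))
  rw [PiLp.norm_single, norm_one, mul_one] at h2
  exact h2.trans h1

/-- If t times the Lipschitz constant of η is at most 1/2, the shift differs from the identity by a
contraction; this gives bijectivity and the lower bound on the Jacobian together. -/
theorem exists_isSmallShift {η : E m → ℝ} (hη : ContDiff ℝ ∞ η) (hc : HasCompactSupport η)
    (p : Fin m) : ∃ t₀ > 0, ∀ t, 0 ≤ t → t ≤ t₀ → IsSmallShift η p t := by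
  obtain ⟨L, hL⟩ := hη.lipschitzWith_of_hasCompactSupport hc (by simp)
  have hL0 : (0 : ℝ) ≤ L := L.2
  refine ⟨1 / (2 * (L + 1)), by positivity, fun t ht0 ht => ?_⟩
  have htL : t * L ≤ 1 / 2 := by
    have := mul_le_mul_of_nonneg_right ht (show (0 : ℝ) ≤ 2 * (L + 1) by positivity)
    rw [div_mul_cancel₀ _ (by positivity)] at this
    nlinarith
  have ht1 : t ≤ 1 := by
    refine ht.trans ?_
    rw [div_le_one (by positivity)]
    linarith
  have happ : ApproximatesLinearOn (shift η p t)
      ((ContinuousLinearEquiv.refl ℝ (E m) : E m ≃L[ℝ] E m) : E m →L[ℝ] E m) Set.univ (1 / 2) := by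
    intro x _ y _
    have e : shift η p t x - shift η p t y -
        ((ContinuousLinearEquiv.refl ℝ (E m) : E m ≃L[ℝ] E m) : E m →L[ℝ] E m) (x - y) =
        (t * (η y - η x)) • EuclideanSpace.single p (1 : ℝ) := by
      simp only [shift, ContinuousLinearEquiv.coe_refl, ContinuousLinearMap.id_apply, mul_sub,
        sub_smul]
      abel
    rw [e, norm_smul, PiLp.norm_single, norm_one, mul_one, norm_mul, Real.norm_of_nonneg ht0,
      norm_sub_rev]
    have h1 := hL.norm_sub_le x y
    calc t * ‖η x - η y‖ ≤ t * (L * ‖x - y‖) := by gcongr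
      _ = (t * L) * ‖x - y‖ := by ring
      _ ≤ 1 / 2 * ‖x - y‖ := by gcongr
      _ = _ := by norm_num
  have : Nontrivial (E m) := by
    refine ⟨⟨EuclideanSpace.single p 1, 0, fun h => ?_⟩⟩
    have := congrArg norm h
    simp at this
  have hcond : Subsingleton (E m) ∨ (1 / 2 : NNReal) <
      ‖((ContinuousLinearEquiv.refl ℝ (E m)).symm : E m →L[ℝ] E m)‖₊⁻¹ := by
    right
    have : ‖((ContinuousLinearEquiv.refl ℝ (E m)).symm : E m →L[ℝ] E m)‖₊ = 1 :=
      ContinuousLinearMap.nnnorm_id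
    rw [this]
    rw [inv_one]
    exact NNReal.half_lt_self one_ne_zero
  refine ⟨ht0, ht1, ⟨Set.injOn_univ.1 (happ.injOn hcond), happ.surjective hcond⟩, fun x => ?_⟩
  have h1 := (le_abs_self _).trans (abs_pd_le_of_lipschitz hL p x)
  nlinarith

theorem hasFDerivAt_shift {η : E m → ℝ} (hη : ContDiff ℝ ∞ η) (p : Fin m) (t : ℝ) (x : E m) :
    HasFDerivAt (shift η p t) (ContinuousLinearMap.id ℝ (E m) -
      (t • fderiv ℝ η x).smulRight (EuclideanSpace.single p (1 : ℝ))) x := by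
  refine (hasFDerivAt_id x).sub ?_
  exact ((diffAt hη x).hasFDerivAt.const_mul t).smul_const _

theorem contDiff_shift {η : E m → ℝ} (hη : ContDiff ℝ ∞ η) (p : Fin m) (t : ℝ) :
    ContDiff ℝ ∞ (shift η p t) := by
  unfold shift
  fun_prop

/-- The derivative is a rank one perturbation of the identity, so its determinant is one minus the
pairing of the functional with the vector. -/
theorem det_fderiv_shift (η : E m → ℝ) (p : Fin m) (t : ℝ) (x : E m) :
    (ContinuousLinearMap.id ℝ (E m) -
      (t • fderiv ℝ η x).smulRight (EuclideanSpace.single p (1 : ℝ))).det = 1 - t * pd p η x := by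
  have h := LinearMap.transvection.det (-(t • fderiv ℝ η x) : E m →L[ℝ] ℝ).toLinearMap
    (EuclideanSpace.single p (1 : ℝ))
  rw [ContinuousLinearMap.det]
  convert h using 2
  · ext1 y
    simp [LinearMap.transvection, sub_eq_add_neg]
  · simp [pd, sub_eq_add_neg]

namespace IsSmallShift

variable {η : E m → ℝ} {p : Fin m} {t : ℝ}

theorem integral_comp {G : Type*} [NormedAddCommGroup G] [NormedSpace ℝ G]
    (h : IsSmallShift η p t) (hη : ContDiff ℝ ∞ η) (F : E m → G) :
    ∫ x, (1 - t * pd p η x) • F (shift η p t x) = ∫ x, F x := by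
  have h1 := integral_image_eq_integral_abs_det_fderiv_smul volume MeasurableSet.univ
    (fun x _ => (hasFDerivAt_shift hη p t x).hasFDerivWithinAt) h.bij.1.injOn F
  rw [Set.image_univ, h.bij.2.range_eq] at h1
  simp only [det_fderiv_shift, Measure.restrict_univ] at h1
  rw [h1]
  refine integral_congr_ae (Eventually.of_forall fun x => ?_)
  simp only
  rw [abs_of_nonneg]
  have := h.jac x
  linarith

/-- The Jacobian is at least 1/2, so preimages have at most twice the volume. -/
theorem map_le (h : IsSmallShift η p t) (hη : ContDiff ℝ ∞ η) :
    (volume : Measure (E m)).map (shift η p t) ≤ (2 : ℝ≥0∞) • volume := by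
  have hm : Measurable (shift η p t) := (contDiff_shift hη p t).continuous.measurable
  refine Measure.le_iff.2 fun s hs => ?_
  have h1 := lintegral_image_eq_lintegral_abs_det_fderiv_mul volume MeasurableSet.univ
    (fun x _ => (hasFDerivAt_shift hη p t x).hasFDerivWithinAt) h.bij.1.injOn (s.indicator 1)
  rw [Set.image_univ, h.bij.2.range_eq] at h1
  simp only [det_fderiv_shift, Measure.restrict_univ] at h1
  rw [lintegral_indicator_one hs] at h1
  rw [Measure.map_apply hm hs, Measure.smul_apply, smul_eq_mul, h1,
    ← lintegral_indicator_one (hm hs), ← lintegral_const_mul' _ _ (by norm_num)]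
  refine lintegral_mono fun x => ?_
  by_cases hx : shift η p t x ∈ s
  · rw [Set.indicator_of_mem (show x ∈ shift η p t ⁻¹' s from hx), Set.indicator_of_mem hx]
    simp only [Pi.one_apply, mul_one]
    have h2 := h.jac x
    have h3 : (1 : ℝ) ≤ 2 * |1 - t * pd p η x| := by
      have := le_abs_self (1 - t * pd p η x)
      linarith
    calc (1 : ℝ≥0∞) = ENNReal.ofReal 1 := by simp
      _ ≤ ENNReal.ofReal (2 * |1 - t * pd p η x|) := ENNReal.ofReal_le_ofReal h3
      _ = _ := by rw [ENNReal.ofReal_mul (by norm_num)]; norm_num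
  · rw [Set.indicator_of_notMem (show x ∉ shift η p t ⁻¹' s from hx)]
    exact zero_le

theorem ae_comp (h : IsSmallShift η p t) (hη : ContDiff ℝ ∞ η) {P : E m → Prop}
    (hP : ∀ᵐ x, P x) : ∀ᵐ x, P (shift η p t x) := by
  have hm : Measurable (shift η p t) := (contDiff_shift hη p t).continuous.measurable
  have hac : (volume : Measure (E m)).map (shift η p t) ≪ volume :=
    (Measure.absolutelyContinuous_of_le (h.map_le hη)).trans Measure.smul_absolutelyContinuous
  exact ae_of_ae_map hm.aemeasurable (hac.ae_le hP)

theorem tendstoL2 {F : Type*} [NormedAddCommGroup F] {f : ℕ → E m → F} {g : E m → F}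
    (h : IsSmallShift η p t) (hη : ContDiff ℝ ∞ η) (hf : TendstoL2 volume f g) :
    TendstoL2 volume (fun k x => f k (shift η p t x)) (fun x => g (shift η p t x)) :=
  hf.comp (contDiff_shift hη p t).continuous.measurable (by norm_num) (h.map_le hη)

theorem integrable_comp (h : IsSmallShift η p t) (hη : ContDiff ℝ ∞ η) {F : E m → ℝ}
    (hF : Integrable F volume) : Integrable (fun x => F (shift η p t x)) volume := by
  have hm : Measurable (shift η p t) := (contDiff_shift hη p t).continuous.measurable
  have h1 : Integrable F (volume.map (shift η p t)) :=
    (hF.smul_measure (by norm_num)).mono_measure (h.map_le hη)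
  exact h1.comp_measurable hm

theorem integral_comp_le (h : IsSmallShift η p t) (hη : ContDiff ℝ ∞ η) {F : E m → ℝ}
    (hF : Integrable F volume) (hF0 : ∀ x, 0 ≤ F x) :
    ∫ x, F (shift η p t x) ≤ 2 * ∫ x, F x := by
  have hm : Measurable (shift η p t) := (contDiff_shift hη p t).continuous.measurable
  have h1 : ∫ x, F (shift η p t x) = ∫ x, F x ∂(volume.map (shift η p t)) := by
    rw [integral_map hm.aemeasurable]
    exact ((hF.smul_measure (c := 2) (by norm_num)).mono_measure (h.map_le hη)).1
  rw [h1]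
  refine (integral_mono_measure (h.map_le hη) (Eventually.of_forall hF0)
    (hF.smul_measure (by norm_num))).trans ?_
  rw [integral_smul_measure]
  simp

end IsSmallShift

/-- Composition with `shift η p t` changes integrals against a smooth weight by `O(t)`. -/
theorem exists_bound_integral_mul_comp_shift {Ω : Set (E m)} {η a : E m → ℝ}
    (hη : IsTestFunction Ω η) (ha : IsTestFunction Ω a) (p : Fin m) :
    ∃ C, 0 ≤ C ∧ ∀ t, IsSmallShift η p t → ∀ F : E m → ℝ, Integrable F volume →
      |(∫ x, a x * F (shift η p t x)) - ∫ x, a x * F x| ≤ C * t * ∫ x, |F x| := by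
  obtain ⟨L, hL⟩ := hη.1.lipschitzWith_of_hasCompactSupport hη.2.1 (by simp)
  obtain ⟨M, hM⟩ := ha.1.lipschitzWith_of_hasCompactSupport ha.2.1 (by simp)
  obtain ⟨A, hA⟩ := ha.bounded
  obtain ⟨B, hB⟩ := hη.bounded
  have hA0 : 0 ≤ A := (norm_nonneg _).trans (hA 0)
  have hB0 : 0 ≤ B := (norm_nonneg _).trans (hB 0)
  refine ⟨2 * (M * B + L * A), by positivity, fun t h F hF => ?_⟩
  have ht := h.nonneg
  have hFc := h.integrable_comp hη.1 hF
  have hbd : ∀ b : E m → ℝ, Continuous b → (∃ C, ∀ x, ‖b x‖ ≤ C) →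
      Integrable (fun x => b x * F (shift η p t x)) volume := by
    rintro b hb ⟨C, hC⟩
    exact hFc.bdd_mul hb.aestronglyMeasurable (Eventually.of_forall hC)
  have hsc := (contDiff_shift hη.1 p t).continuous
  have e1 := h.integral_comp hη.1 fun x => a x * F x
  have hi1 := hbd a ha.1.continuous ⟨A, hA⟩
  have hi2 : Integrable (fun x => ((1 - t * pd p η x) * a (shift η p t x)) * F (shift η p t x))
      volume := by
    refine hbd _ ((continuous_const.sub (continuous_const.mul
      (contDiff_pd hη.1 p).continuous)).mul (ha.1.continuous.comp hsc)) ⟨(1 + t * L) * A, ?_⟩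
    intro x
    rw [norm_mul]
    gcongr
    · refine (norm_sub_le _ _).trans ?_
      rw [norm_one, norm_mul, Real.norm_of_nonneg ht]
      gcongr
      exact abs_pd_le_of_lipschitz hL p x
    · exact hA _
  -- The change of variables moves the difference from F, which is merely integrable, to the smooth
  -- weight a and the Jacobian, both of which vary by O(t).
  have e2 : (∫ x, a x * F (shift η p t x)) - ∫ x, a x * F x =
      ∫ x, (a x - (1 - t * pd p η x) * a (shift η p t x)) * F (shift η p t x) := by
    rw [← e1]
    simp only [smul_eq_mul, sub_mul (a _) _ (F _)]
    rw [integral_sub hi1 hi2]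
    simp only [mul_assoc]
  rw [e2]
  have pt : ∀ x, |a x - (1 - t * pd p η x) * a (shift η p t x)| ≤ (M * B + L * A) * t := by
    intro x
    have e3 : a x - (1 - t * pd p η x) * a (shift η p t x) =
        (a x - a (shift η p t x)) + t * pd p η x * a (shift η p t x) := by ring
    rw [e3]
    refine (abs_add_le _ _).trans ?_
    have h1 : |a x - a (shift η p t x)| ≤ M * (t * B) := by
      refine (hM.norm_sub_le _ _).trans ?_
      gcongr
      simp only [shift, sub_sub_cancel]
      rw [norm_smul, PiLp.norm_single, norm_one, mul_one, norm_mul, Real.norm_of_nonneg ht]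
      gcongr
      exact hB x
    have h2 : |t * pd p η x * a (shift η p t x)| ≤ t * L * A := by
      rw [abs_mul, abs_mul, abs_of_nonneg ht]
      gcongr
      · exact abs_pd_le_of_lipschitz hL p x
      · exact hA _
    linarith
  have hi3 : Integrable (fun x => |F (shift η p t x)|) volume := hFc.abs
  calc |∫ x, (a x - (1 - t * pd p η x) * a (shift η p t x)) * F (shift η p t x)|
      ≤ ∫ x, (M * B + L * A) * t * |F (shift η p t x)| := by
        rw [← Real.norm_eq_abs]
        refine norm_integral_le_of_norm_le (hi3.const_mul _) (Eventually.of_forall fun x => ?_)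
        rw [norm_mul]
        exact mul_le_mul_of_nonneg_right (pt x) (abs_nonneg _)
    _ = (M * B + L * A) * t * ∫ x, |F (shift η p t x)| := integral_const_mul _ _
    _ ≤ (M * B + L * A) * t * (2 * ∫ x, |F x|) := by
        gcongr
        exact h.integral_comp_le hη.1 hF.abs fun x => abs_nonneg _
    _ = _ := by ring

/-! ### Derivatives of deformed maps -/

theorem pd_comp_shift {F : Type*} [NormedAddCommGroup F] [NormedSpace ℝ F] {η : E m → ℝ}
    (hη : ContDiff ℝ ∞ η) {f : E m → F} (hf : ContDiff ℝ ∞ f) (p i : Fin m) (t : ℝ) :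
    pd i (fun x => f (shift η p t x)) = (fun x => pd i f (shift η p t x)) -
      fun x => (t * pd i η x) • pd p f (shift η p t x) := by
  ext1 x
  have h := ((diffAt hf (shift η p t x)).hasFDerivAt.comp x (hasFDerivAt_shift hη p t x)).fderiv
  simp only [pd, Pi.sub_apply]
  change fderiv ℝ (f ∘ shift η p t) x _ = _
  rw [h]
  simp

theorem pd_pd_comp_shift {F : Type*} [NormedAddCommGroup F] [NormedSpace ℝ F] {η : E m → ℝ}
    (hη : ContDiff ℝ ∞ η) {f : E m → F} (hf : ContDiff ℝ ∞ f) (p i j : Fin m) (t : ℝ) :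
    pd j (pd i (fun x => f (shift η p t x))) =
      (fun x => pd j (pd i f) (shift η p t x)) -
      (fun x => (t * pd j η x) • pd p (pd i f) (shift η p t x)) -
      (fun x => (t * pd i η x) • pd j (pd p f) (shift η p t x)) +
      (fun x => (t ^ 2 * (pd i η x * pd j η x)) • pd p (pd p f) (shift η p t x)) -
      (fun x => (t * pd j (pd i η) x) • pd p f (shift η p t x)) := by
  have hs := contDiff_shift hη p t
  have hc : ∀ q, ContDiff ℝ ∞ fun x => pd q f (shift η p t x) := fun q => (contDiff_pd hf q).comp hs
  have ha : ContDiff ℝ ∞ fun x => t * pd i η x := contDiff_const.mul (contDiff_pd hη i)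
  have hpa : ∀ x, pd j (fun x => t * pd i η x) x = t * pd j (pd i η) x := by
    intro x
    have h0 : pd j (fun _ : E m => t) x = 0 := by simp [pd]
    rw [pd_mul contDiff_const (contDiff_pd hη i), h0, zero_mul, add_zero]
  rw [pd_comp_shift hη hf, pd_sub (hc i) (g := fun x => (t * pd i η x) • pd p f (shift η p t x)) (ha.smul (hc p)),
    pd_comp_shift hη (contDiff_pd hf i)]
  ext1 x
  simp only [Pi.sub_apply, Pi.add_apply, pd_smul ha (hc p), hpa,
    pd_comp_shift hη (contDiff_pd hf p)]
  simp only [smul_sub, smul_smul, sq]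
  rw [show t * pd i η x * (t * pd j η x) = t * t * (pd i η x * pd j η x) by ring]
  abel

/-- The chain rule for a W^{2,2} limit: it holds for the smooth f k, and each term is a bounded
weight times a composition that converges in L². -/
theorem IsW22Limit.comp_shift {Ω : Set (E m)} {f : ℕ → E m → E ℓ} {w : E m → E ℓ}
    {g : Fin m → E m → E ℓ} {h : Fin m → Fin m → E m → E ℓ} (H : IsW22Limit Ω f w g h)
    {Ω' : Set (E m)} {η : E m → ℝ} (hη : IsTestFunction Ω' η) {p : Fin m} {t : ℝ}
    (ht : IsSmallShift η p t)
    (htest : ∀ k, IsTestFunction Ω fun x => f k (shift η p t x)) :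
    IsW22Limit Ω (fun k x => f k (shift η p t x)) (fun x => w (shift η p t x))
      (fun i => (fun x => g i (shift η p t x)) - fun x => (t * pd i η x) • g p (shift η p t x))
      (fun i j => (fun x => h i j (shift η p t x)) -
        (fun x => (t * pd j η x) • h i p (shift η p t x)) -
        (fun x => (t * pd i η x) • h p j (shift η p t x)) +
        (fun x => (t ^ 2 * (pd i η x * pd j η x)) • h p p (shift η p t x)) -
        (fun x => (t * pd j (pd i η) x) • g p (shift η p t x))) := by
  have bd : ∀ a : E m → ℝ, IsTestFunction Ω' a → ∀ {F : ℕ → E m → E ℓ} {G : E m → E ℓ},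
      TendstoL2 volume F G → TendstoL2 volume (fun k x => a x • F k x) (fun x => a x • G x) := by
    intro a ha F G hFG
    obtain ⟨C, hC⟩ := ha.bounded
    exact hFG.smul_bounded ha.1.continuous.aestronglyMeasurable hC
  have hi : ∀ i, IsTestFunction Ω' fun x => t * pd i η x := fun i =>
    (hη.pd i).smul_left (a := fun _ => t) contDiff_const
  have hij : ∀ i j, IsTestFunction Ω' fun x => t * pd j (pd i η) x := fun i j =>
    ((hη.pd i).pd j).smul_left (a := fun _ => t) contDiff_const
  have hij' : ∀ i j, IsTestFunction Ω' fun x => t ^ 2 * (pd i η x * pd j η x) := fun i j =>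
    ((hη.pd j).smul_left (hη.pd i).1).smul_left (a := fun _ => t ^ 2) contDiff_const
  refine ⟨htest, ht.tendstoL2 hη.1 H.lim, fun i => ?_, fun i j => ?_⟩
  · simp only [pd_comp_shift hη.1 (H.test _).1]
    exact (ht.tendstoL2 hη.1 (H.lim_pd i)).sub (bd _ (hi i) (ht.tendstoL2 hη.1 (H.lim_pd p)))
  · simp only [pd_pd_comp_shift hη.1 (H.test _).1]
    exact ((((ht.tendstoL2 hη.1 (H.lim_pd_pd i j)).sub
      (bd _ (hi j) (ht.tendstoL2 hη.1 (H.lim_pd_pd i p)))).sub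
      (bd _ (hi i) (ht.tendstoL2 hη.1 (H.lim_pd_pd p j)))).add
      (bd _ (hij' i j) (ht.tendstoL2 hη.1 (H.lim_pd_pd p p)))).sub
      (bd _ (hij i j) (ht.tendstoL2 hη.1 (H.lim_pd p)))

theorem IsW22Limit.sub {Ω : Set (E m)} {f f' : ℕ → E m → E ℓ} {w w' : E m → E ℓ}
    {g g' : Fin m → E m → E ℓ} {h h' : Fin m → Fin m → E m → E ℓ} (H : IsW22Limit Ω f w g h)
    (H' : IsW22Limit Ω f' w' g' h') :
    IsW22Limit Ω (fun k => f k - f' k) (w - w') (fun i => g i - g' i)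
      (fun i j => h i j - h' i j) := by
  refine ⟨fun k => (H.test k).sub (H'.test k), H.lim.sub H'.lim, fun i => ?_, fun i j => ?_⟩
  · simp only [pd_sub (H.test _).1 (H'.test _).1]
    exact (H.lim_pd i).sub (H'.lim_pd i)
  · simp only [pd_sub (H.test _).1 (H'.test _).1,
      pd_sub (contDiff_pd (H.test _).1 i) (contDiff_pd (H'.test _).1 i)]
    exact (H.lim_pd_pd i j).sub (H'.lim_pd_pd i j)

end Shift

/-! ### Comparison of energies -/

section Energy

variable {d ℓ : ℕ}

/-- `w` is, near the origin, the extension of `u - c` by zero from the half ball, with first and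
second derivatives `g` and `h`; it is a limit of test functions `f k` in `W^{2,2}`. -/
structure IsLocalExtension (u : E (d + 1) → E ℓ) (c : E ℓ) (f : ℕ → E (d + 1) → E ℓ)
    (w : E (d + 1) → E ℓ) (g : Fin (d + 1) → E (d + 1) → E ℓ)
    (h : Fin (d + 1) → Fin (d + 1) → E (d + 1) → E ℓ) : Prop where
  lim : IsW22Limit (halfBall d) f w g h
  zero : ∀ x, x ∉ halfBall d → w x = 0 ∧ (∀ i, g i x = 0) ∧ ∀ i j, h i j x = 0
  eq_near : ∀ x ∈ halfBall d ∩ Metric.ball 0 (3 / 4), w x = u x - c ∧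
    (∀ i, g i x = weakPartial (halfBall d) i u x) ∧
    ∀ i j, h i j x = weakPartial (halfBall d) j (weakPartial (halfBall d) i u) x

theorem HasConstantFlatBoundaryValue.exists_isLocalExtension {u : E (d + 1) → E ℓ} {c : E ℓ}
    (hu : MemWk2 (halfBall d) 2 u) (hc : HasConstantFlatBoundaryValue u c) :
    ∃ f w g h, IsLocalExtension u c f w g h := by
  obtain ⟨w, g, h, hw, hg, hh, hwg, hgh, hsupp, heq⟩ := hc.exists_extension hu
  obtain ⟨f, hf⟩ := exists_isW22Limit hw hg hh hwg hgh fun x hx => (hsupp x hx).1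
  exact ⟨f, w, g, h, hf, fun x hx => hsupp x fun h => hx h.1, heq⟩

/-- The trace `∑ i, h i i` of a Hessian. -/
def traceHess {m : ℕ} (h : Fin m → Fin m → E m → E ℓ) (x : E m) : E ℓ := ∑ i, h i i x

theorem IsW22Limit.memLp_traceHess {m : ℕ} {Ω : Set (E m)} {f : ℕ → E m → E ℓ} {w : E m → E ℓ}
    {g : Fin m → E m → E ℓ} {h : Fin m → Fin m → E m → E ℓ} (H : IsW22Limit Ω f w g h) :
    MemLp (traceHess h) 2 volume :=
  memLp_finsetSum _ fun i _ => (H.lim_pd_pd i i).mem_lim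

/-- Transfers minimality from u to its cut-off extension w. The competitor is v = u - (w - w'): it
equals c + w' in the ball of radius 3/4 and u elsewhere, and u - v is a limit of test functions. -/
theorem IsMinimizingBiharmonic.integral_traceHess_le {N : Set (E ℓ)} {u : E (d + 1) → E ℓ}
    {c : E ℓ} {f f' : ℕ → E (d + 1) → E ℓ} {w w' : E (d + 1) → E ℓ}
    {g g' : Fin (d + 1) → E (d + 1) → E ℓ} {h h' : Fin (d + 1) → Fin (d + 1) → E (d + 1) → E ℓ}
    (hmin : IsMinimizingBiharmonic (halfBall d) N u) (hext : IsLocalExtension u c f w g h)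
    (hlim : IsW22Limit (halfBall d) f' w' g' h')
    (hzero : ∀ x, x ∉ halfBall d → traceHess h' x = 0)
    (hout : ∀ x ∈ halfBall d, x ∉ Metric.ball (0 : E (d + 1)) (3 / 4) →
      w' x = w x ∧ traceHess h' x = traceHess h x)
    (hN : ∀ᵐ x, x ∈ halfBall d ∩ Metric.ball (0 : E (d + 1)) (3 / 4) → c + w' x ∈ N) :
    ∫ x, ‖traceHess h x‖ ^ 2 ≤ ∫ x, ‖traceHess h' x‖ ^ 2 := by
  have hO := isOpen_halfBall (d := d)
  have D := hext.lim.sub hlim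
  have P := fun i => hmin.1.1.weakPartial_props hO i
  set v : E (d + 1) → E ℓ := u - (w - w') with hv
  have hu0 : MemLp u 2 (volume.restrict (halfBall d)) := hmin.1.1.1
  have v1 : ∀ i, HasWeakPartial (halfBall d) i v (weakPartial (halfBall d) i u - (g i - g' i)) :=
    fun i => (P i).1.sub hO hu0 (P i).2.1 (D.lim.mem_lim.restrict _)
      ((D.lim_pd i).mem_lim.restrict _) (D.hasWeakPartial hO i)
  have v2 : ∀ i j, HasWeakPartial (halfBall d) j (weakPartial (halfBall d) i u - (g i - g' i))
      (weakPartial (halfBall d) j (weakPartial (halfBall d) i u) - (h i j - h' i j)) :=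
    fun i j => ((P i).2.2 j).1.sub hO (P i).2.1 ((P i).2.2 j).2 ((D.lim_pd i).mem_lim.restrict _)
      ((D.lim_pd_pd i j).mem_lim.restrict _) (D.hasWeakPartial' hO i j)
  have vmem : MemWk2 (halfBall d) 2 v :=
    ⟨hu0.sub (D.lim.mem_lim.restrict _), fun i => ⟨_, v1 i,
      (P i).2.1.sub ((D.lim_pd i).mem_lim.restrict _), fun j => ⟨_, v2 i j,
        ((P i).2.2 j).2.sub ((D.lim_pd_pd i j).mem_lim.restrict _)⟩⟩⟩
  have vN : ∀ᵐ x ∂(volume.restrict (halfBall d)), v x ∈ N := by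
    filter_upwards [hmin.1.2, ae_restrict_of_ae hN, ae_restrict_mem hO.measurableSet]
      with x hx1 hx2 hx3
    by_cases hb : x ∈ Metric.ball (0 : E (d + 1)) (3 / 4)
    · have e : v x = c + w' x := by
        simp only [hv, Pi.sub_apply, (hext.eq_near x ⟨hx3, hb⟩).1]
        abel
      rw [e]
      exact hx2 ⟨hx3, hb⟩
    · have e : v x = u x := by
        simp [hv, (hout x hx3 hb).1]
      rwa [e]
  have huv : MemWk2Zero (halfBall d) 2 (u - v) := by
    rw [hv, sub_sub_cancel]
    exact D.memWk2Zero hO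
  have hle := hmin.2 v ⟨vmem, vN⟩ huv
  have lapv : ∀ᵐ x ∂(volume.restrict (halfBall d)), weakLaplacian (halfBall d) v x =
      weakLaplacian (halfBall d) u x - (traceHess h x - traceHess h' x) := by
    have a : ∀ i, weakPartial (halfBall d) i (weakPartial (halfBall d) i v) =ᵐ[volume.restrict
        (halfBall d)] weakPartial (halfBall d) i (weakPartial (halfBall d) i u)
          - (h i i - h' i i) := fun i =>
      ((v2 i i).congr hO ((v1 i).weakPartial_ae hO).symm EventuallyEq.rfl).weakPartial_ae hO
    filter_upwards [ae_all_iff.2 a] with x hx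
    simp only [weakLaplacian, traceHess, hx, Pi.sub_apply, Finset.sum_sub_distrib]
  have hLu : MemLp (weakLaplacian (halfBall d) u) 2 (volume.restrict (halfBall d)) :=
    memLp_finsetSum _ fun i _ => ((P i).2.2 i).2
  have hH := hext.lim.memLp_traceHess.restrict (halfBall d)
  have hH' := hlim.memLp_traceHess.restrict (halfBall d)
  have hLv : MemLp (weakLaplacian (halfBall d) v) 2 (volume.restrict (halfBall d)) :=
    (hLu.sub (hH.sub hH')).ae_eq (lapv.mono fun x hx => hx.symm)
  -- Although w has a different energy from u outside the ball of radius 3/4, the energy differences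
  -- agree: inside, Δw = Δu, and outside, Δw' = Δw.
  have key : ∀ᵐ x ∂(volume.restrict (halfBall d)), ‖weakLaplacian (halfBall d) v x‖ ^ 2 -
      ‖weakLaplacian (halfBall d) u x‖ ^ 2 = ‖traceHess h' x‖ ^ 2 - ‖traceHess h x‖ ^ 2 := by
    filter_upwards [lapv, ae_restrict_mem hO.measurableSet] with x hx hx3
    by_cases hb : x ∈ Metric.ball (0 : E (d + 1)) (3 / 4)
    · have e : traceHess h x = weakLaplacian (halfBall d) u x := by
        simp only [traceHess, weakLaplacian, (hext.eq_near x ⟨hx3, hb⟩).2.2]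
      rw [hx, e]
      simp
    · rw [hx, (hout x hx3 hb).2]
      simp
  have key2 := integral_congr_ae key
  have sq : ∀ {F : E (d + 1) → E ℓ}, MemLp F 2 (volume.restrict (halfBall d)) →
      Integrable (fun x => ‖F x‖ ^ 2) (volume.restrict (halfBall d)) := fun hF =>
    hF.integrable_norm_pow (by norm_num)
  rw [integral_sub (sq hLv) (sq hLu), integral_sub (sq hH') (sq hH)] at key2
  have full : ∀ {F : E (d + 1) → E ℓ}, (∀ x, x ∉ halfBall d → F x = 0) →
      ∫ x in halfBall d, ‖F x‖ ^ 2 = ∫ x, ‖F x‖ ^ 2 := fun hF =>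
    setIntegral_eq_integral_of_forall_compl_eq_zero fun x hx => by simp [hF x hx]
  rw [full (F := traceHess h') hzero, full (F := traceHess h) fun x hx => by
    simp [traceHess, (hext.zero x hx).2.2]] at key2
  simp only [hessianEnergy] at hle
  linarith

end Energy

/-! ### The first variation -/

section FirstVariation

/-- Expands the energy density to first order in t, with all terms of order t² and higher absorbed
by Cauchy–Schwarz and t ≤ 1. -/
theorem norm_sq_sub_add_le {V : Type*} [NormedAddCommGroup V] [InnerProductSpace ℝ V]
    (a p q : V) {t : ℝ} (ht0 : 0 ≤ t) (ht1 : t ≤ 1) :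
    ‖a - t • p + t ^ 2 • q‖ ^ 2 ≤ ‖a‖ ^ 2 - 2 * t * inner ℝ a p +
      3 * t ^ 2 * (‖a‖ ^ 2 + ‖p‖ ^ 2 + ‖q‖ ^ 2) := by
  rw [norm_add_sq_real, norm_sub_sq_real, inner_sub_left, inner_smul_right, inner_smul_right,
    inner_smul_left, inner_smul_right, norm_smul, norm_smul]
  simp only [conj_trivial, Real.norm_eq_abs, abs_of_nonneg ht0, abs_of_nonneg (sq_nonneg t)]
  have h1 := real_inner_le_norm a q
  have h2 := neg_le_of_abs_le (abs_real_inner_le_norm p q)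
  have h3 : 2 * (‖a‖ * ‖q‖) ≤ ‖a‖ ^ 2 + ‖q‖ ^ 2 := by nlinarith [sq_nonneg (‖a‖ - ‖q‖)]
  have h4 : 2 * (‖p‖ * ‖q‖) ≤ ‖p‖ ^ 2 + ‖q‖ ^ 2 := by nlinarith [sq_nonneg (‖p‖ - ‖q‖)]
  have e1 : t ^ 2 * (2 * inner ℝ a q) ≤ t ^ 2 * (‖a‖ ^ 2 + ‖q‖ ^ 2) := by gcongr; linarith
  have e2 : t ^ 2 * (t * -(2 * inner ℝ p q)) ≤ t ^ 2 * (‖p‖ ^ 2 + ‖q‖ ^ 2) := by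
    gcongr
    have : 0 ≤ ‖p‖ ^ 2 + ‖q‖ ^ 2 := by positivity
    nlinarith
  have e3 : t ^ 2 * (t ^ 2 * ‖q‖ ^ 2) ≤ t ^ 2 * ‖q‖ ^ 2 := by
    gcongr
    exact mul_le_of_le_one_left (by positivity) (pow_le_one₀ ht0 ht1)
  have e4 : 0 ≤ t ^ 2 * ‖a‖ ^ 2 := by positivity
  have e5 : 0 ≤ t ^ 2 * ‖p‖ ^ 2 := by positivity
  nlinarith

variable {m ℓ : ℕ}

/-- The derivative at `t = 0` of `∫ ‖Δ (w ∘ shift η p t)‖²`. -/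
def firstVariation (η : E m → ℝ) (p : Fin m) (g : Fin m → E m → E ℓ)
    (h : Fin m → Fin m → E m → E ℓ) : ℝ :=
  (∫ x, pd p η x * ‖traceHess h x‖ ^ 2) -
    2 * ((∑ i, ∫ x, pd i η x * inner ℝ (traceHess h x) (h i p x + h p i x)) +
      ∫ x, (∑ i, pd i (pd i η) x) * inner ℝ (traceHess h x) (g p x))

/-- The Hessian of the deformed map, as in `IsW22Limit.comp_shift`. -/
def shiftHess (η : E m → ℝ) (p : Fin m) (t : ℝ) (g : Fin m → E m → E ℓ)
    (h : Fin m → Fin m → E m → E ℓ) (i j : Fin m) : E m → E ℓ :=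
  (fun x => h i j (shift η p t x)) -
    (fun x => (t * pd j η x) • h i p (shift η p t x)) -
    (fun x => (t * pd i η x) • h p j (shift η p t x)) +
    (fun x => (t ^ 2 * (pd i η x * pd j η x)) • h p p (shift η p t x)) -
    (fun x => (t * pd j (pd i η) x) • g p (shift η p t x))

theorem traceHess_shiftHess (η : E m → ℝ) (p : Fin m) (t : ℝ) (g : Fin m → E m → E ℓ)
    (h : Fin m → Fin m → E m → E ℓ) (x : E m) :
    traceHess (shiftHess η p t g h) x = traceHess h (shift η p t x) -
      t • ((∑ i, pd i η x • (h i p (shift η p t x) + h p i (shift η p t x))) +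
        (∑ i, pd i (pd i η) x) • g p (shift η p t x)) +
      t ^ 2 • (∑ i, pd i η x * pd i η x) • h p p (shift η p t x) := by
  simp only [traceHess, shiftHess, Pi.sub_apply, Pi.add_apply, Finset.sum_sub_distrib,
    Finset.sum_add_distrib, smul_add, Finset.smul_sum, Finset.sum_smul, smul_smul]
  abel

/-- Only an upper bound with error O(t²) is needed, since minimality is used in one direction. No
derivative of the Hessian is available: smooth weights absorb the displacement in the linear terms.
-/
theorem exists_bound_integral_traceHess_shiftHess {Ω Ω' : Set (E m)} {f : ℕ → E m → E ℓ}
    {w : E m → E ℓ} {g : Fin m → E m → E ℓ} {h : Fin m → Fin m → E m → E ℓ}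
    (H : IsW22Limit Ω f w g h) {η : E m → ℝ} (hη : IsTestFunction Ω' η) (p : Fin m) :
    ∃ C, 0 ≤ C ∧ ∀ t, IsSmallShift η p t →
      MemLp (traceHess (shiftHess η p t g h)) 2 volume →
      ∫ x, ‖traceHess (shiftHess η p t g h) x‖ ^ 2 ≤
        (∫ x, ‖traceHess h x‖ ^ 2) + t * firstVariation η p g h + C * t ^ 2 := by
  classical
  have mg := fun i => (H.lim_pd i).mem_lim
  have mh := fun i j => (H.lim_pd_pd i j).mem_lim
  have mH := H.memLp_traceHess
  set T : E m → ℝ := fun x => (∑ i, ∑ j, ‖h i j x‖) + ∑ i, ‖g i x‖ with hT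
  have T0 : ∀ x, 0 ≤ T x := fun x => by positivity
  have mT : MemLp T 2 volume :=
    (memLp_finsetSum _ fun i _ => memLp_finsetSum _ fun j _ => (mh i j).norm).add
      (memLp_finsetSum _ fun i _ => (mg i).norm)
  have mT2 : Integrable (fun x => T x ^ 2) volume := mT.integrable_sq
  have bG : ∀ i x, ‖g i x‖ ≤ T x := fun i x =>
    (Finset.single_le_sum (f := fun i => ‖g i x‖) (fun _ _ => norm_nonneg _)
      (Finset.mem_univ i)).trans (le_add_of_nonneg_left (by positivity))
  have brow : ∀ i x, ∑ j, ‖h i j x‖ ≤ T x := fun i x =>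
    (Finset.single_le_sum (f := fun i => ∑ j, ‖h i j x‖)
      (fun _ _ => Finset.sum_nonneg fun _ _ => norm_nonneg _) (Finset.mem_univ i)).trans
      (le_add_of_nonneg_right (by positivity))
  have bh : ∀ i j x, ‖h i j x‖ ≤ T x := fun i j x =>
    (Finset.single_le_sum (f := fun j => ‖h i j x‖) (fun _ _ => norm_nonneg _)
      (Finset.mem_univ j)).trans (brow i x)
  have bcol : ∀ q x, ∑ i, ‖h i q x‖ ≤ T x := fun q x =>
    (Finset.sum_le_sum fun i _ => Finset.single_le_sum (f := fun j => ‖h i j x‖)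
      (fun _ _ => norm_nonneg _) (Finset.mem_univ q)).trans
      (le_add_of_nonneg_right (by positivity))
  have bH : ∀ x, ‖traceHess h x‖ ≤ T x := fun x =>
    (norm_sum_le _ _).trans ((Finset.sum_le_sum fun i _ => Finset.single_le_sum
      (f := fun j => ‖h i j x‖) (fun _ _ => norm_nonneg _) (Finset.mem_univ i)).trans
      (le_add_of_nonneg_right (by positivity)))
  have hlap : IsTestFunction Ω' fun x => ∑ i, pd i (pd i η) x := by
    refine ⟨ContDiff.sum fun i _ => ((hη.pd i).pd i).1, ?_, ?_⟩
    · refine hη.2.1.mono' fun x hx => ?_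
      by_contra hx'
      exact hx (Finset.sum_eq_zero fun i _ => pd_eq_zero_of_notMem fun h' =>
        hx' (tsupport_pd_subset i h'))
    · refine (closure_minimal (fun x hx => ?_) (isClosed_tsupport η)).trans hη.2.2
      by_contra hx'
      exact hx (Finset.sum_eq_zero fun i _ => pd_eq_zero_of_notMem fun h' =>
        hx' (tsupport_pd_subset i h'))
  obtain ⟨B, hB0, hB1, hB2, hB3⟩ : ∃ B, 0 ≤ B ∧ (∀ i x, |pd i η x| ≤ B) ∧
      (∀ x, |∑ i, pd i (pd i η) x| ≤ B) ∧ ∀ x, |∑ i, pd i η x * pd i η x| ≤ B := by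
    choose b hb using fun i => (hη.pd i).bounded
    obtain ⟨b', hb'⟩ := hlap.bounded
    have hb0 : ∀ i, 0 ≤ b i := fun i => (norm_nonneg _).trans (hb i 0)
    have hb0' : 0 ≤ b' := (norm_nonneg _).trans (hb' 0)
    have s1 : 0 ≤ ∑ i, b i := Finset.sum_nonneg fun i _ => hb0 i
    have s2 : 0 ≤ ∑ i, b i * b i := Finset.sum_nonneg fun i _ => mul_nonneg (hb0 i) (hb0 i)
    refine ⟨(∑ i, b i) + b' + ∑ i, b i * b i, by linarith, fun i x => ?_, fun x => ?_,
      fun x => ?_⟩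
    · have h1 := Finset.single_le_sum (f := b) (fun i _ => hb0 i) (Finset.mem_univ i)
      have h3 : |pd i η x| ≤ b i := hb i x
      linarith
    · have h3 : |∑ i, pd i (pd i η) x| ≤ b' := hb' x
      linarith
    · have h3 : |∑ i, pd i η x * pd i η x| ≤ ∑ i, b i * b i := by
        refine (Finset.abs_sum_le_sum_abs _ _).trans (Finset.sum_le_sum fun i _ => ?_)
        rw [abs_mul]
        exact mul_le_mul (hb i x) (hb i x) (abs_nonneg _) (hb0 i)
      linarith
  have inn : ∀ {F G : E m → E ℓ}, MemLp F 2 volume → MemLp G 2 volume →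
      Integrable (fun x => inner ℝ (F x) (G x)) volume := fun hF hG =>
    TendstoL2.integrable_bilin (innerSL ℝ) hF hG
  have F0 : Integrable (fun x => ‖traceHess h x‖ ^ 2) volume := mH.integrable_norm_pow (by norm_num)
  have F1 : ∀ i, Integrable (fun x => inner ℝ (traceHess h x) (h i p x + h p i x)) volume :=
    fun i => inn mH ((mh i p).add (mh p i))
  have F2 : Integrable (fun x => inner ℝ (traceHess h x) (g p x)) volume := inn mH (mg p)
  obtain ⟨C0, hC0, key0⟩ := exists_bound_integral_mul_comp_shift hη (hη.pd p) p
  choose C1 hC1 key1 using fun i => exists_bound_integral_mul_comp_shift hη (hη.pd i) p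
  obtain ⟨C2, hC2, key2⟩ := exists_bound_integral_mul_comp_shift hη hlap p
  -- The terms with C0, C1, C2 come from undoing the composition in the linear terms. In the
  -- remainder, 3B counts two Hessian contributions and one from Δη, and the factor 2 is the bound
  -- on the push-forward.
  refine ⟨C0 * (∫ x, |‖traceHess h x‖ ^ 2|) +
    2 * ((∑ i, C1 i * ∫ x, |inner ℝ (traceHess h x) (h i p x + h p i x)|) +
      C2 * ∫ x, |inner ℝ (traceHess h x) (g p x)|) +
    3 * ((1 + (3 * B) ^ 2 + B ^ 2) * (2 * ∫ x, T x ^ 2)), ?_, fun t ht hmem => ?_⟩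
  · have := integral_nonneg (μ := (volume : Measure (E m))) (f := fun x => T x ^ 2)
      fun x => sq_nonneg (T x)
    have := fun i => integral_nonneg (μ := (volume : Measure (E m)))
      (f := fun x => |inner ℝ (traceHess h x) (h i p x + h p i x)|) fun x => abs_nonneg _
    have := Finset.sum_nonneg fun i (_ : i ∈ Finset.univ) => mul_nonneg (hC1 i) (this i)
    positivity
  have t0 := ht.nonneg
  have G0 := ht.integrable_comp hη.1 F0
  have G1 := fun i => ht.integrable_comp hη.1 (F1 i)
  have G2 := ht.integrable_comp hη.1 F2
  have G3 := ht.integrable_comp hη.1 mT2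
  have bm : ∀ {a F : E m → ℝ}, IsTestFunction Ω' a → Integrable F volume →
      Integrable (fun x => a x * F x) volume := fun ha hF => by
    obtain ⟨C, hC⟩ := ha.bounded
    exact hF.bdd_mul ha.1.continuous.aestronglyMeasurable (Eventually.of_forall hC)
  have I0 := bm (hη.pd p) G0
  have I1 := fun i => bm (hη.pd i) (G1 i)
  have I1s : Integrable (fun x => ∑ i, pd i η x * inner ℝ (traceHess h (shift η p t x))
      (h i p (shift η p t x) + h p i (shift η p t x))) volume :=
    integrable_finsetSum _ fun i _ => I1 i
  have I2 := bm hlap G2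
  have pt : ∀ x, ‖traceHess (shiftHess η p t g h) x‖ ^ 2 ≤ ‖traceHess h (shift η p t x)‖ ^ 2 -
      2 * t * ((∑ i, pd i η x * inner ℝ (traceHess h (shift η p t x))
        (h i p (shift η p t x) + h p i (shift η p t x))) + (∑ i, pd i (pd i η) x) *
        inner ℝ (traceHess h (shift η p t x)) (g p (shift η p t x))) +
      3 * t ^ 2 * ((1 + (3 * B) ^ 2 + B ^ 2) * T (shift η p t x) ^ 2) := by
    intro x
    rw [traceHess_shiftHess]
    refine (norm_sq_sub_add_le _ _ _ t0 ht.le_one).trans ?_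
    set y := shift η p t x
    have e1 : inner ℝ (traceHess h y) ((∑ i, pd i η x • (h i p y + h p i y)) +
        (∑ i, pd i (pd i η) x) • g p y) = (∑ i, pd i η x * inner ℝ (traceHess h y)
          (h i p y + h p i y)) + (∑ i, pd i (pd i η) x) * inner ℝ (traceHess h y) (g p y) := by
      simp only [inner_add_right, inner_sum, inner_smul_right]
    rw [e1]
    have n1 : ‖(∑ i, pd i η x • (h i p y + h p i y)) + (∑ i, pd i (pd i η) x) • g p y‖ ≤
        3 * B * T y := by
      refine (norm_add_le _ _).trans ?_
      have a1 : ‖∑ i, pd i η x • (h i p y + h p i y)‖ ≤ B * T y + B * T y := by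
        calc _ ≤ ∑ i, (B * ‖h i p y‖ + B * ‖h p i y‖) := by
              refine (norm_sum_le _ _).trans (Finset.sum_le_sum fun i _ => ?_)
              rw [norm_smul, ← mul_add]
              exact mul_le_mul (hB1 i x) (norm_add_le _ _) (norm_nonneg _) hB0
          _ ≤ _ := by
              rw [Finset.sum_add_distrib, ← Finset.mul_sum, ← Finset.mul_sum]
              exact add_le_add (mul_le_mul_of_nonneg_left (bcol p y) hB0)
                (mul_le_mul_of_nonneg_left (brow p y) hB0)
      have a2 : ‖(∑ i, pd i (pd i η) x) • g p y‖ ≤ B * T y := by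
        rw [norm_smul]
        exact mul_le_mul (hB2 x) (bG p y) (norm_nonneg _) hB0
      linarith
    have n2 : ‖(∑ i, pd i η x * pd i η x) • h p p y‖ ≤ B * T y := by
      rw [norm_smul]
      exact mul_le_mul (hB3 x) (bh p p y) (norm_nonneg _) hB0
    have n1' := pow_le_pow_left₀ (norm_nonneg _) n1 2
    have n2' := pow_le_pow_left₀ (norm_nonneg _) n2 2
    have n0' := pow_le_pow_left₀ (norm_nonneg _) (bH y) 2
    gcongr
    calc _ ≤ T y ^ 2 + (3 * B * T y) ^ 2 + (B * T y) ^ 2 := add_le_add (add_le_add n0' n1') n2'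
      _ = _ := by ring
  have int1 := integral_mono (hmem.integrable_norm_pow (by norm_num))
    ((G0.sub ((I1s.add I2).const_mul (2 * t))).add
      ((G3.const_mul (1 + (3 * B) ^ 2 + B ^ 2)).const_mul (3 * t ^ 2))) pt
  rw [integral_add' (G0.sub ((I1s.add I2).const_mul (2 * t)))
      ((G3.const_mul (1 + (3 * B) ^ 2 + B ^ 2)).const_mul (3 * t ^ 2)),
    integral_sub' G0 ((I1s.add I2).const_mul (2 * t)), integral_const_mul, integral_const_mul,
    integral_const_mul, integral_add' I1s I2, integral_finsetSum _ fun i _ => I1 i] at int1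
  -- The Jacobian 1 - t ∂_pη supplies the first term of the first variation.
  have cv : ∫ x, ‖traceHess h (shift η p t x)‖ ^ 2 = (∫ x, ‖traceHess h x‖ ^ 2) +
      t * ∫ x, pd p η x * ‖traceHess h (shift η p t x)‖ ^ 2 := by
    have := ht.integral_comp hη.1 fun x => ‖traceHess h x‖ ^ 2
    simp only [smul_eq_mul, sub_mul, one_mul, mul_assoc] at this
    rw [integral_sub G0 (I0.const_mul t), integral_const_mul] at this
    linarith
  rw [cv] at int1
  have k0 := (abs_le.1 (key0 t ht _ F0)).2
  have k1 : ∑ i, ∫ x, pd i η x * inner ℝ (traceHess h x) (h i p x + h p i x) ≤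
      (∑ i, ∫ x, pd i η x * inner ℝ (traceHess h (shift η p t x))
        (h i p (shift η p t x) + h p i (shift η p t x))) +
      t * ∑ i, C1 i * ∫ x, |inner ℝ (traceHess h x) (h i p x + h p i x)| := by
    rw [Finset.mul_sum, ← Finset.sum_add_distrib]
    refine Finset.sum_le_sum fun i _ => ?_
    have := (abs_le.1 (key1 i t ht _ (F1 i))).1
    linarith
  have k2 := (abs_le.1 (key2 t ht _ F2)).1
  have k3 := ht.integral_comp_le hη.1 mT2 fun x => sq_nonneg (T x)
  have k3' : 3 * t ^ 2 * ((1 + (3 * B) ^ 2 + B ^ 2) * ∫ x, T (shift η p t x) ^ 2) ≤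
      3 * t ^ 2 * ((1 + (3 * B) ^ 2 + B ^ 2) * (2 * ∫ x, T x ^ 2)) := by gcongr
  have k0' := mul_le_mul_of_nonneg_left k0 t0
  have k1' := mul_le_mul_of_nonneg_left k1 t0
  have k2' := mul_le_mul_of_nonneg_left k2 t0
  simp only [firstVariation]
  refine int1.trans ?_
  linarith

end FirstVariation

/-! ### Sign of the first variation -/

section Sign

variable {d ℓ : ℕ}

theorem shift_eq_self {m : ℕ} {η : E m → ℝ} {p : Fin m} {t : ℝ} {x : E m} (hx : x ∉ tsupport η) :
    shift η p t x = x := by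
  simp [shift, image_eq_zero_of_notMem_tsupport hx]

theorem traceHess_shiftHess_eq_self {m : ℕ} {η : E m → ℝ} {p : Fin m} {t : ℝ}
    {g : Fin m → E m → E ℓ} {h : Fin m → Fin m → E m → E ℓ} {x : E m} (hx : x ∉ tsupport η) :
    traceHess (shiftHess η p t g h) x = traceHess h x := by
  have e1 : ∀ i, pd i η x = 0 := fun i => pd_eq_zero_of_notMem hx
  have e2 : ∀ i, pd i (pd i η) x = 0 := fun i =>
    pd_eq_zero_of_notMem fun h' => hx (tsupport_pd_subset i h')
  rw [traceHess_shiftHess, shift_eq_self hx]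
  simp [e1, e2]

theorem shift_last_le {η : E (d + 1) → ℝ} (h0 : ∀ x, 0 ≤ η x) {t : ℝ} (ht : 0 ≤ t)
    (x : E (d + 1)) : shift η (Fin.last d) t x (Fin.last d) ≤ x (Fin.last d) := by
  simp [shift, mul_nonneg ht (h0 x)]

/-- The shift lowers points, so a point whose image has positive height already has positive height.
This is where the sign of tη matters for the boundary condition. -/
theorem IsTestFunction.comp_shift {η : E (d + 1) → ℝ} (hη : IsTestFunction (Metric.ball 0 1) η)
    (h0 : ∀ x, 0 ≤ η x) {t : ℝ} (ht : 0 ≤ t) {f : E (d + 1) → E ℓ}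
    (hf : IsTestFunction (halfBall d) f) :
    IsTestFunction (halfBall d) fun x => f (shift η (Fin.last d) t x) := by
  have hs := contDiff_shift hη.1 (Fin.last d) t
  have hsub : tsupport (fun x => f (shift η (Fin.last d) t x)) ⊆
      shift η (Fin.last d) t ⁻¹' tsupport f :=
    tsupport_comp_subset_preimage f hs.continuous
  have hun : tsupport (fun x => f (shift η (Fin.last d) t x)) ⊆ tsupport f ∪ tsupport η := by
    intro x hx
    by_cases hx' : x ∈ tsupport η
    · exact Or.inr hx'
    · have := hsub hx
      rw [Set.mem_preimage, shift_eq_self hx'] at this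
      exact Or.inl this
  refine ⟨hf.1.comp hs, (hf.2.1.union hη.2.1).of_isClosed_subset (isClosed_tsupport _) hun,
    fun x hx => ⟨?_, ?_⟩⟩
  · exact Set.union_subset (hf.2.2.trans halfBall_subset_ball) hη.2.2 (hun hx)
  · exact lt_of_lt_of_le (hf.2.2 (hsub hx)).2 (shift_last_le h0 ht x)

/-- Compare with c + w ∘ shift for small t > 0, divide the resulting inequality by t and let t
decrease to zero. -/
theorem IsMinimizingBiharmonic.firstVariation_nonneg {N : Set (E ℓ)} {u : E (d + 1) → E ℓ}
    {c : E ℓ} {f : ℕ → E (d + 1) → E ℓ} {w : E (d + 1) → E ℓ}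
    {g : Fin (d + 1) → E (d + 1) → E ℓ} {h : Fin (d + 1) → Fin (d + 1) → E (d + 1) → E ℓ}
    (hmin : IsMinimizingBiharmonic (halfBall d) N u) (hext : IsLocalExtension u c f w g h)
    (hcN : c ∈ N) {η : E (d + 1) → ℝ} (hη : IsTestFunction (Metric.ball 0 1) η)
    (h0 : ∀ x, 0 ≤ η x) (hsupp : tsupport η ⊆ Metric.closedBall 0 (1 / 2)) :
    0 ≤ firstVariation η (Fin.last d) g h := by
  have hO := isOpen_halfBall (d := d)
  obtain ⟨t₀, ht₀, hsmall⟩ := exists_isSmallShift hη.1 hη.2.1 (Fin.last d)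
  obtain ⟨B, hB⟩ := hη.bounded
  have hB0 : 0 ≤ B := (norm_nonneg _).trans (hB 0)
  obtain ⟨C, hC, hbound⟩ := exists_bound_integral_traceHess_shiftHess hext.lim hη (Fin.last d)
  -- The second bound gives tη < 1/4, so the support of η, inside the closed ball of radius 1/2, is
  -- moved within the ball of radius 3/4, where w = u - c.
  have key : ∀ t, 0 < t → t ≤ min t₀ (1 / (8 * (B + 1))) →
      0 ≤ firstVariation η (Fin.last d) g h + C * t := by
    intro t ht htm
    have hts := hsmall t ht.le (htm.trans (min_le_left _ _))
    have htB : ∀ x, t * η x < 1 / 4 := by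
      intro x
      have h1 := htm.trans (min_le_right _ _)
      rw [le_div_iff₀ (by positivity)] at h1
      have h2 : η x ≤ B := (le_abs_self _).trans (hB x)
      have h3 : t * η x ≤ t * B := by gcongr
      nlinarith
    have hlim := hext.lim.comp_shift hη hts fun k => (hη.comp_shift h0 ht.le (hext.lim.test k))
    have hle := hmin.integral_traceHess_le hext hlim
      (fun x hx => ?_) (fun x _ hx' => ?_) ?_
    · have h2 := hbound t hts hlim.memLp_traceHess
      have h3 : ∫ x, ‖traceHess h x‖ ^ 2 ≤
          ∫ x, ‖traceHess (shiftHess η (Fin.last d) t g h) x‖ ^ 2 := hle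
      have h4 : 0 ≤ t * (firstVariation η (Fin.last d) g h + C * t) := by nlinarith
      exact nonneg_of_mul_nonneg_right h4 ht
    · change traceHess (shiftHess η (Fin.last d) t g h) x = 0
      by_cases hxη : x ∈ tsupport η
      · have hb : x ∈ Metric.ball (0 : E (d + 1)) 1 := hη.2.2 hxη
        have hs : shift η (Fin.last d) t x ∉ halfBall d := fun h' =>
          hx ⟨hb, lt_of_lt_of_le h'.2 (shift_last_le h0 ht.le x)⟩
        obtain ⟨-, z1, z2⟩ := hext.zero _ hs
        rw [traceHess_shiftHess]
        simp [traceHess, z1, z2]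
      · rw [traceHess_shiftHess_eq_self hxη]
        simp [traceHess, (hext.zero x hx).2.2]
    · have hxη : x ∉ tsupport η := fun h' =>
        hx' (Metric.closedBall_subset_ball (by norm_num) (hsupp h'))
      exact ⟨by simp only [shift_eq_self hxη], traceHess_shiftHess_eq_self hxη⟩
    · have hu := (ae_restrict_iff' hO.measurableSet).1 hmin.1.2
      filter_upwards [hts.ae_comp hη.1 hu] with x hx hx'
      -- Either the competitor takes a value of u at the shifted point, or that point has left the
      -- half ball and the value is c.
      by_cases hs : shift η (Fin.last d) t x ∈ halfBall d
      · have hb : shift η (Fin.last d) t x ∈ Metric.ball (0 : E (d + 1)) (3 / 4) := by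
          by_cases hxη : x ∈ tsupport η
          · have h1 := hsupp hxη
            rw [mem_closedBall_zero_iff] at h1
            rw [mem_ball_zero_iff, shift]
            refine (norm_sub_le _ _).trans_lt ?_
            rw [norm_smul, PiLp.norm_single, norm_one, mul_one,
              Real.norm_of_nonneg (mul_nonneg ht.le (h0 x))]
            linarith [htB x]
          · rw [shift_eq_self hxη]
            exact hx'.2
        rw [(hext.eq_near _ ⟨hs, hb⟩).1, add_sub_cancel]
        exact hx hs
      · rw [(hext.zero _ hs).1, add_zero]
        exact hcN
  by_contra hneg
  push Not at hneg
  set A := firstVariation η (Fin.last d) g h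
  set s := min t₀ (1 / (8 * (B + 1)))
  have hs : 0 < s := by positivity
  have h1 : 0 < -A / (2 * (C + 1)) := div_pos (neg_pos.2 hneg) (by positivity)
  have h2 := key (min s (-A / (2 * (C + 1)))) (lt_min hs h1) (min_le_left _ _)
  have h3 : C * min s (-A / (2 * (C + 1))) ≤ (C + 1) * (-A / (2 * (C + 1))) := by
    refine mul_le_mul (by linarith) (min_le_right _ _) (lt_min hs h1).le (by positivity)
  have h4 : (C + 1) * (-A / (2 * (C + 1))) = -A / 2 := by field_simp
  linarith

end Sign

/-! ### Homogeneous maps -/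

section Homogeneous

variable {d ℓ : ℕ}

theorem smul_mem_halfBall {x : E (d + 1)} {t : ℝ} (ht : 0 < t) (ht1 : t ≤ 1)
    (hx : x ∈ halfBall d) : t • x ∈ halfBall d := by
  refine ⟨?_, ?_⟩
  · have := hx.1
    rw [mem_ball_zero_iff] at this ⊢
    rw [norm_smul, Real.norm_of_nonneg ht.le]
    nlinarith [norm_nonneg x]
  · have h2 : 0 < x (Fin.last d) := hx.2
    change 0 < t * x (Fin.last d)
    positivity

theorem pd_apply {m : ℕ} (i j : Fin m) (x : E m) :
    pd i (fun x : E m => x j) x = if j = i then 1 else 0 := by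
  have h : HasFDerivAt (fun x : E m => x j) (EuclideanSpace.proj j : E m →L[ℝ] ℝ) x :=
    (EuclideanSpace.proj j : E m →L[ℝ] ℝ).hasFDerivAt
  rw [pd, h.fderiv]
  simp

theorem contDiff_apply_coord {m : ℕ} (j : Fin m) : ContDiff ℝ ∞ fun x : E m => x j := by
  fun_prop

theorem fderiv_apply_self {m : ℕ} (φ : E m → ℝ) (y v : E m) :
    fderiv ℝ φ y v = ∑ j, v j * pd j φ y := by
  have : v = ∑ j, v j • EuclideanSpace.single j (1 : ℝ) := by
    ext k
    simp [Finset.sum_apply, Pi.single_apply]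
  conv_lhs => rw [this]
  simp [pd]

/-- The weak form of x·∇u = 0. By homogeneity s^{d+1} ∫ φ(sx) u(x) dx does not depend on s ≥ 1;
differentiate at s = 1. -/
theorem IsHomogeneousDegreeZero.integral_radial_eq_zero {u : E (d + 1) → E ℓ}
    (hu : MemLp u 2 (volume.restrict (halfBall d))) (hhom : IsHomogeneousDegreeZero u)
    {φ : E (d + 1) → ℝ} (hφ : IsTestFunction (halfBall d) φ) :
    ∫ x in halfBall d, (((d : ℝ) + 1) * φ x + ∑ j, x j * pd j φ x) • u x = 0 := by
  have hO := isOpen_halfBall (d := d)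
  have hfin : IsFiniteMeasure (volume.restrict (halfBall d)) :=
    ⟨by
      rw [Measure.restrict_apply_univ]
      exact (measure_mono halfBall_subset_ball).trans_lt measure_ball_lt_top⟩
  have hui : Integrable u (volume.restrict (halfBall d)) := hu.integrable (by norm_num)
  obtain ⟨C, hC⟩ := (hφ.2.1.fderiv (𝕜 := ℝ)).exists_bound_of_continuous
    (hφ.1.continuous_fderiv (by simp))
  obtain ⟨C', hC'⟩ := hφ.bounded
  have hC0 : 0 ≤ C := (norm_nonneg _).trans (hC 0)
  have hder := hasDerivAt_integral_of_dominated_loc_of_deriv_le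
    (μ := volume.restrict (halfBall d)) (F := fun (s : ℝ) x => φ (s • x) • u x)
    (F' := fun s x => (fderiv ℝ φ (s • x) x) • u x) (x₀ := 1) (s := Set.univ)
    (bound := fun x => C * ‖u x‖) univ_mem
    (Eventually.of_forall fun s => ((hφ.1.continuous.comp
      (continuous_const_smul s)).aestronglyMeasurable).smul hu.1)
    (hui.bdd_smul C' (hφ.1.continuous.comp
      (continuous_const_smul (1 : ℝ))).aestronglyMeasurable (Eventually.of_forall fun x => hC' _))
    ?_ ?_ (hui.norm.const_mul C) ?_
  rotate_left
  · have hc := hφ.1.continuous_fderiv (by simp)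
    have hc' : Continuous fun x => fderiv ℝ φ ((1 : ℝ) • x) x := by fun_prop
    exact hc'.aestronglyMeasurable.smul hu.1
  · filter_upwards [ae_restrict_mem hO.measurableSet] with x hx s _
    rw [norm_smul]
    gcongr
    refine ((fderiv ℝ φ (s • x)).le_opNorm x).trans ?_
    have hx1 : ‖x‖ ≤ 1 := (mem_ball_zero_iff.1 hx.1).le
    calc _ ≤ C * 1 := mul_le_mul (hC _) hx1 (norm_nonneg _) hC0
      _ = C := mul_one C
  · refine Eventually.of_forall fun x s _ => ?_
    have h1 : HasDerivAt (fun s : ℝ => s • x) x s := by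
      simpa using (hasDerivAt_id s).smul_const x
    exact ((diffAt hφ.1 (s • x)).hasFDerivAt.comp_hasDerivAt s h1).smul_const (u x)
  have hpow : HasDerivAt (fun s : ℝ => s ^ (d + 1)) ((d : ℝ) + 1) 1 := by
    simpa using hasDerivAt_pow (d + 1) (1 : ℝ)
  have hJ := hpow.smul hder.2
  have hconst : ∀ s : ℝ, 1 < s → s ^ (d + 1) • ∫ x in halfBall d, φ (s • x) • u x =
      ∫ x in halfBall d, φ x • u x := by
    intro s hs
    have hs0 : 0 < s := by linarith
    have e1 : ∫ x in halfBall d, φ (s • x) • u x = ∫ x, φ (s • x) • u (s⁻¹ • (s • x)) := by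
      simp only [inv_smul_smul₀ hs0.ne']
      refine setIntegral_eq_integral_of_forall_compl_eq_zero fun x hx => ?_
      rw [hφ.eq_zero, zero_smul]
      intro h'
      refine hx ?_
      have := smul_mem_halfBall (inv_pos.2 hs0) (inv_le_one_of_one_le₀ hs.le) h'
      rwa [inv_smul_smul₀ hs0.ne'] at this
    have e2 := Measure.integral_comp_smul (volume : Measure (E (d + 1)))
      (fun y => φ y • u (s⁻¹ • y)) s
    rw [e1, e2, finrank_euclideanSpace_fin, abs_of_pos (by positivity), smul_smul,
      mul_inv_cancel₀ (by positivity), one_smul, ← setIntegral_smul_of_test hφ]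
    refine integral_congr_ae ?_
    filter_upwards [hhom s⁻¹ (inv_pos.2 hs0) (inv_lt_one_of_one_lt₀ hs)] with x hx
    rw [hx]
  -- For s ≥ 1 the support of φ(s·) stays in the half ball and u is evaluated at contracted points,
  -- so a one-sided derivative is used; it agrees with the two-sided one in `hJ`.
  have hJ2 : HasDerivWithinAt (fun s : ℝ => s ^ (d + 1) • ∫ x in halfBall d, φ (s • x) • u x) 0
      (Set.Ici 1) 1 := by
    refine (hasDerivWithinAt_const (1 : ℝ) (Set.Ici 1) (∫ x in halfBall d, φ x • u x)).congr ?_ ?_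
    · intro s hs
      rcases (Set.mem_Ici.1 hs).eq_or_lt with h | h
      · simp [← h]
      · exact hconst s h
    · simp
  have huniq := (uniqueDiffWithinAt_Ici (1 : ℝ)).eq_deriv _ hJ.hasDerivWithinAt hJ2
  simp only [one_pow, one_smul] at huniq
  have i1 : Integrable (fun x => φ x • u x) (volume.restrict (halfBall d)) :=
    hui.bdd_smul C' hφ.1.continuous.aestronglyMeasurable (Eventually.of_forall hC')
  have i2 : Integrable (fun x => (fderiv ℝ φ x x) • u x) (volume.restrict (halfBall d)) := by
    simpa using hder.1
  have i3 : Integrable (fun x => ((d : ℝ) + 1) • φ x • u x) (volume.restrict (halfBall d)) := by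
    change Integrable (((d : ℝ) + 1) • fun x => φ x • u x) _
    exact i1.smul _
  rw [← integral_smul, ← integral_add i2 i3] at huniq
  rw [← huniq]
  refine integral_congr_ae (Eventually.of_forall fun x => ?_)
  simp only [fderiv_apply_self, smul_smul, add_smul]
  abel

theorem ae_eq_zero_of_integral_test {m : ℕ} {Ω : Set (E m)} (hΩ : IsOpen Ω) {F : E m → E ℓ}
    (hF : LocallyIntegrableOn F Ω volume)
    (h : ∀ φ : E m → ℝ, IsTestFunction Ω φ → ∫ x in Ω, φ x • F x = 0) :
    ∀ᵐ x ∂(volume.restrict Ω), F x = 0 := by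
  refine (ae_restrict_iff' hΩ.measurableSet).2 ?_
  refine hΩ.ae_eq_zero_of_integral_contDiff_smul_eq_zero hF fun φ hφ hc hs => ?_
  rw [← setIntegral_smul_of_test ⟨hφ, hc, hs⟩]
  exact h φ ⟨hφ, hc, hs⟩

theorem memLp_coord_smul (j : Fin (d + 1)) {a : E (d + 1) → E ℓ}
    (ha : MemLp a 2 (volume.restrict (halfBall d))) :
    MemLp (fun x => x j • a x) 2 (volume.restrict (halfBall d)) := by
  have hO := isOpen_halfBall (d := d)
  have hc : Continuous fun x : E (d + 1) => x j := by fun_prop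
  refine MemLp.of_le_mul (c := 1) ha (hc.aestronglyMeasurable.smul ha.1) ?_
  filter_upwards [ae_restrict_mem hO.measurableSet] with x hx
  rw [norm_smul]
  gcongr
  exact (PiLp.norm_apply_le x j).trans (mem_ball_zero_iff.1 hx.1).le

theorem locallyIntegrableOn_of_memLp {a : E (d + 1) → E ℓ}
    (ha : MemLp a 2 (volume.restrict (halfBall d))) :
    LocallyIntegrableOn a (halfBall d) volume := by
  have hfin : IsFiniteMeasure (volume.restrict (halfBall d)) :=
    ⟨by
      rw [Measure.restrict_apply_univ]
      exact (measure_mono halfBall_subset_ball).trans_lt measure_ball_lt_top⟩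
  have : IntegrableOn a (halfBall d) volume := ha.integrable (by norm_num)
  exact this.locallyIntegrableOn

theorem integral_test_smul_sum {φ : E (d + 1) → ℝ} (hφ : IsTestFunction (halfBall d) φ)
    {a : Fin (d + 1) → E (d + 1) → E ℓ} (ha : ∀ j, MemLp (a j) 2 (volume.restrict (halfBall d))) :
    ∫ x in halfBall d, φ x • ∑ j, x j • a j x = ∑ j, ∫ x in halfBall d, (φ x * x j) • a j x := by
  rw [← integral_finsetSum]
  · refine integral_congr_ae (Eventually.of_forall fun x => ?_)
    simp only [Finset.smul_sum, smul_smul]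
  · intro j _
    exact TendstoL2.integrable_bilin (ContinuousLinearMap.lsmul ℝ ℝ)
      ((hφ.smul_right (contDiff_apply_coord j)).memLp 2 _) (ha j)

theorem IsHomogeneousDegreeZero.euler_ae {u : E (d + 1) → E ℓ}
    (hu : MemWk2 (halfBall d) 2 u) (hhom : IsHomogeneousDegreeZero u) :
    ∀ᵐ x ∂(volume.restrict (halfBall d)), ∑ j, x j • weakPartial (halfBall d) j u x = 0 := by
  have hO := isOpen_halfBall (d := d)
  have P := fun i => hu.weakPartial_props hO i
  have hu0 : MemLp u 2 (volume.restrict (halfBall d)) := hu.1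
  refine ae_eq_zero_of_integral_test hO (locallyIntegrableOn_of_memLp
    (memLp_finsetSum _ fun j _ => memLp_coord_smul j (P j).2.1)) fun φ hφ => ?_
  have ht : ∀ j : Fin (d + 1), IsTestFunction (halfBall d) fun x => φ x * x j := fun j =>
    hφ.smul_right (contDiff_apply_coord j)
  rw [integral_test_smul_sum hφ fun j => (P j).2.1]
  have e : ∀ j, ∫ x in halfBall d, (φ x * x j) • weakPartial (halfBall d) j u x =
      - ∫ x in halfBall d, (φ x + x j * pd j φ x) • u x := by
    intro j
    have h1 := (P j).1.2.2 _ (ht j)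
    rw [partialDeriv_eq_pd] at h1
    rw [← neg_eq_iff_eq_neg.2 h1]
    congr 1
    refine integral_congr_ae (Eventually.of_forall fun x => ?_)
    simp only [pd_mul hφ.1 (contDiff_apply_coord j), pd_apply, if_true, mul_one]
    rw [mul_comm (x j)]
  rw [Finset.sum_congr rfl fun j _ => e j, Finset.sum_neg_distrib, ← integral_finsetSum]
  · rw [← neg_zero, ← hhom.integral_radial_eq_zero hu0 hφ]
    congr 1
    refine integral_congr_ae (Eventually.of_forall fun x => ?_)
    simp only
    rw [← Finset.sum_smul, Finset.sum_add_distrib]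
    simp
  · intro j _
    exact TendstoL2.integrable_bilin (ContinuousLinearMap.lsmul ℝ ℝ)
      (MemLp.add (hφ.memLp 2 _) (((hφ.pd j).smul_left (contDiff_apply_coord j)).memLp 2 _)) hu0

/-- The weak ∂_i of the Euler relation: test x_j ∂_j u against ∂_iφ, where the term j = i produces
the extra ∂_i u. -/
theorem IsHomogeneousDegreeZero.euler_hessian_ae {u : E (d + 1) → E ℓ}
    (hu : MemWk2 (halfBall d) 2 u) (hhom : IsHomogeneousDegreeZero u) (i : Fin (d + 1)) :
    ∀ᵐ x ∂(volume.restrict (halfBall d)),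
      ∑ j, x j • weakPartial (halfBall d) i (weakPartial (halfBall d) j u) x =
        - weakPartial (halfBall d) i u x := by
  have hO := isOpen_halfBall (d := d)
  have P := fun i => hu.weakPartial_props hO i
  have m1 : MemLp (fun x => ∑ j, x j • weakPartial (halfBall d) i (weakPartial (halfBall d) j u) x)
      2 (volume.restrict (halfBall d)) :=
    memLp_finsetSum _ fun j _ => memLp_coord_smul j ((P j).2.2 i).2
  have main : ∀ᵐ x ∂(volume.restrict (halfBall d)),
      (∑ j, x j • weakPartial (halfBall d) i (weakPartial (halfBall d) j u) x) +
        weakPartial (halfBall d) i u x = 0 := by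
    refine ae_eq_zero_of_integral_test hO (locallyIntegrableOn_of_memLp
      (m1.add (P i).2.1)) fun φ hφ => ?_
    have int : ∀ {φ : E (d + 1) → ℝ} {a : E (d + 1) → E ℓ}, IsTestFunction (halfBall d) φ →
        MemLp a 2 (volume.restrict (halfBall d)) →
        Integrable (fun x => φ x • a x) (volume.restrict (halfBall d)) := fun hφ ha =>
      TendstoL2.integrable_bilin (ContinuousLinearMap.lsmul ℝ ℝ) (hφ.memLp 2 _) ha
    have ht : ∀ j : Fin (d + 1), IsTestFunction (halfBall d) fun x => φ x * x j := fun j =>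
      hφ.smul_right (contDiff_apply_coord j)
    simp only [smul_add]
    rw [integral_add (int hφ m1) (int hφ (P i).2.1), integral_test_smul_sum hφ fun j =>
      ((P j).2.2 i).2]
    have ht' : ∀ j : Fin (d + 1), IsTestFunction (halfBall d) fun x => pd i φ x * x j := fun j =>
      (hφ.pd i).smul_right (contDiff_apply_coord j)
    have e : ∀ j, ∫ x in halfBall d, (φ x * x j) •
        weakPartial (halfBall d) i (weakPartial (halfBall d) j u) x =
        - ((if j = i then ∫ x in halfBall d, φ x • weakPartial (halfBall d) j u x else 0) +
          ∫ x in halfBall d, (pd i φ x * x j) • weakPartial (halfBall d) j u x) := by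
      intro j
      have h1 := ((P j).2.2 i).1.2.2 _ (ht j)
      rw [partialDeriv_eq_pd] at h1
      rw [← neg_eq_iff_eq_neg.2 h1]
      congr 1
      simp only [pd_mul hφ.1 (contDiff_apply_coord j), pd_apply]
      split_ifs with hij
      · simp only [mul_one, add_smul]
        exact integral_add (int hφ (P j).2.1) (int (ht' j) (P j).2.1)
      · simp
    rw [Finset.sum_congr rfl fun j _ => e j, Finset.sum_neg_distrib, Finset.sum_add_distrib,
      ← integral_test_smul_sum (hφ.pd i) fun j => (P j).2.1]
    have z : ∫ x in halfBall d, pd i φ x • ∑ j, x j • weakPartial (halfBall d) j u x = 0 := by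
      rw [← integral_zero (E (d + 1)) (E ℓ) (μ := volume.restrict (halfBall d))]
      refine integral_congr_ae ?_
      filter_upwards [hhom.euler_ae hu] with x hx
      rw [hx, smul_zero]
    rw [z]
    simp
  filter_upwards [main] with x hx
  exact eq_neg_of_add_eq_zero_left hx

end Homogeneous

/-! ### Radial weights -/

section Radial

variable {m : ℕ}

/-- The `k`-th derivative of `expNegInvGlue` at `s` is `(gluePoly k).eval s⁻¹ * expNegInvGlue s`. -/
def gluePoly : ℕ → Polynomial ℝ
  | 0 => 1
  | k + 1 => Polynomial.X ^ 2 * (gluePoly k - Polynomial.derivative (gluePoly k))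

/-- The `k`-th derivative of `expNegInvGlue`, at `1 / 4 - ‖x‖ ^ 2`. -/
def radialWeight (k : ℕ) (x : E m) : ℝ :=
  (gluePoly k).eval (1 / 4 - ‖x‖ ^ 2)⁻¹ * expNegInvGlue (1 / 4 - ‖x‖ ^ 2)

theorem pd_norm_sq (i : Fin m) (x : E m) : pd i (fun x : E m => ‖x‖ ^ 2) x = 2 * x i := by
  rw [pd, (hasStrictFDerivAt_norm_sq x).hasFDerivAt.fderiv]
  simp [EuclideanSpace.inner_single_right]

theorem contDiff_radialWeight (k : ℕ) : ContDiff ℝ ∞ (radialWeight k : E m → ℝ) :=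
  (expNegInvGlue.contDiff_polynomial_eval_inv_mul (n := ⊤) (gluePoly k)).comp
    (contDiff_const.sub (contDiff_norm_sq ℝ))

theorem pd_radialWeight (k : ℕ) (i : Fin m) (x : E m) :
    pd i (radialWeight k) x = x i * (-2 * radialWeight (k + 1) x) := by
  have h1 := expNegInvGlue.hasDerivAt_polynomial_eval_inv_mul (gluePoly k) (1 / 4 - ‖x‖ ^ 2)
  have h2 : HasFDerivAt (fun x : E m => 1 / 4 - ‖x‖ ^ 2) (-fderiv ℝ (fun x : E m => ‖x‖ ^ 2) x) x :=
    (diffAt (contDiff_norm_sq ℝ) x).hasFDerivAt.const_sub _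
  have h3 := (HasDerivAt.comp_hasFDerivAt (f := fun x : E m => 1 / 4 - ‖x‖ ^ 2) x h1 h2).fderiv
  rw [pd, show (radialWeight k : E m → ℝ) = (fun s => (gluePoly k).eval s⁻¹ * expNegInvGlue s) ∘
    fun x : E m => 1 / 4 - ‖x‖ ^ 2 from rfl, h3]
  have h4 := pd_norm_sq i x
  simp only [pd] at h4
  simp only [smul_apply, neg_apply, h4, smul_eq_mul,
    radialWeight, gluePoly]
  ring

theorem radialWeight_eq_zero (k : ℕ) {x : E m} (hx : x ∉ Metric.ball (0 : E m) (1 / 2)) :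
    radialWeight k x = 0 := by
  rw [mem_ball_zero_iff, not_lt] at hx
  rw [radialWeight, expNegInvGlue.zero_of_nonpos, mul_zero]
  nlinarith

theorem tsupport_radialWeight_subset (k : ℕ) :
    tsupport (radialWeight k : E m → ℝ) ⊆ Metric.closedBall 0 (1 / 2) := by
  refine closure_minimal (fun x hx => ?_) Metric.isClosed_closedBall
  by_contra hx'
  exact hx (radialWeight_eq_zero k fun h => hx' (Metric.ball_subset_closedBall h))

theorem isTestFunction_radialWeight (k : ℕ) :
    IsTestFunction (Metric.ball (0 : E m) 1) (radialWeight k) :=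
  ⟨contDiff_radialWeight k, (isCompact_closedBall _ _).of_isClosed_subset (isClosed_tsupport _)
    (tsupport_radialWeight_subset k), (tsupport_radialWeight_subset k).trans
      (Metric.closedBall_subset_ball (by norm_num))⟩

theorem quarter_sub_norm_sq_pos {x : E m} (hx : x ∈ Metric.ball (0 : E m) (1 / 2)) :
    0 < 1 / 4 - ‖x‖ ^ 2 := by
  rw [mem_ball_zero_iff] at hx
  nlinarith [norm_nonneg x]

theorem radialWeight_zero_nonneg (x : E m) : 0 ≤ radialWeight 0 x := by
  simp [radialWeight, gluePoly, expNegInvGlue.nonneg]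

theorem radialWeight_one_pos {x : E m} (hx : x ∈ Metric.ball (0 : E m) (1 / 2)) :
    0 < radialWeight 1 x := by
  have h := quarter_sub_norm_sq_pos hx
  refine mul_pos ?_ (expNegInvGlue.pos_of_pos h)
  have e : ∀ y : ℝ, (gluePoly 1).eval y = y ^ 2 := fun y => by simp [gluePoly]
  rw [e]
  exact pow_pos (inv_pos.2 h) 2

/-- The second derivative of exp(-1/s) is s⁻³(s⁻¹ - 2) exp(-1/s), positive for 0 < s < 1/2. Here s =
1/4 - |x|² is at most 1/4; this is why the weights are cut at radius 1/2. -/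
theorem radialWeight_two_pos {x : E m} (hx : x ∈ Metric.ball (0 : E m) (1 / 2)) :
    0 < radialWeight 2 x := by
  have h := quarter_sub_norm_sq_pos hx
  refine mul_pos ?_ (expNegInvGlue.pos_of_pos h)
  set s := 1 / 4 - ‖x‖ ^ 2 with hs
  have e : ∀ y : ℝ, (gluePoly 2).eval y = y ^ 2 * (y * (y - 2)) := fun y => by
    simp only [gluePoly, Polynomial.derivative_one, sub_zero, mul_one, Polynomial.derivative_X_sq,
      Polynomial.eval_mul, Polynomial.eval_sub, Polynomial.eval_pow, Polynomial.eval_X,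
      Polynomial.eval_C]
    ring
  have h4 : 4 ≤ s⁻¹ := by
    rw [le_inv_comm₀ (by norm_num) h]
    have := sq_nonneg ‖x‖
    rw [hs]
    norm_num
  rw [e]
  have : 0 < s⁻¹ - 2 := by linarith
  positivity

theorem radialWeight_nonneg {k : ℕ} (hk : ∀ x : E m, x ∈ Metric.ball (0 : E m) (1 / 2) →
    0 < radialWeight k x) (x : E m) : 0 ≤ radialWeight k x := by
  by_cases hx : x ∈ Metric.ball (0 : E m) (1 / 2)
  · exact (hk x hx).le
  · rw [radialWeight_eq_zero k hx]

end Radial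

/-! ### Integration by parts for limits -/

section Parts

variable {m ℓ : ℕ} {Ω : Set (E m)}

theorem IsTestFunction.integrable_mul_inner {a : E m → ℝ} (ha : IsTestFunction Ω a)
    {F G : E m → E ℓ} (hF : MemLp F 2 volume) (hG : MemLp G 2 volume) :
    Integrable (fun x => a x * inner ℝ (F x) (G x)) volume := by
  have := TendstoL2.integrable_bilin (innerSL ℝ) (ha.memLp_smul hF) hG
  simp only [← real_inner_smul_left]
  exact this

theorem IsTestFunction.tendsto_integral_mul_inner {a : E m → ℝ} (ha : IsTestFunction Ω a)
    {F G : ℕ → E m → E ℓ} {F₀ G₀ : E m → E ℓ} (hF : TendstoL2 volume F F₀)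
    (hG : TendstoL2 volume G G₀) :
    Tendsto (fun k => ∫ x, a x * inner ℝ (F k x) (G k x)) atTop
      (𝓝 (∫ x, a x * inner ℝ (F₀ x) (G₀ x))) := by
  obtain ⟨C, hC⟩ := ha.bounded
  have := (hF.smul_bounded ha.1.continuous.aestronglyMeasurable hC).tendsto_integral_bilin
    (innerSL ℝ) hG
  simp only [← real_inner_smul_left]
  exact this

/-- The product ⟨F₀, G₀⟩ is only integrable, so the product rule is applied to the approximants and
each of the three integrals passes to the limit. -/
theorem integral_pd_mul_inner {a : E m → ℝ} (ha : IsTestFunction Ω a) (j : Fin m)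
    {F G : ℕ → E m → E ℓ} {F₀ G₀ F₁ G₁ : E m → E ℓ} (hFs : ∀ k, ContDiff ℝ ∞ (F k))
    (hGs : ∀ k, ContDiff ℝ ∞ (G k)) (hF : TendstoL2 volume F F₀) (hG : TendstoL2 volume G G₀)
    (hF' : TendstoL2 volume (fun k => pd j (F k)) F₁)
    (hG' : TendstoL2 volume (fun k => pd j (G k)) G₁) :
    ∫ x, pd j a x * inner ℝ (F₀ x) (G₀ x) =
      -((∫ x, a x * inner ℝ (F₁ x) (G₀ x)) + ∫ x, a x * inner ℝ (F₀ x) (G₁ x)) := by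
  refine tendsto_nhds_unique ((ha.pd j).tendsto_integral_mul_inner hF hG)
    (((ha.tendsto_integral_mul_inner hF' hG).add
      (ha.tendsto_integral_mul_inner hF hG')).neg.congr fun k => ?_)
  have h := integral_smul_pd ha ((hFs k).inner ℝ (hGs k)) j
  simp only [smul_eq_mul, pd_inner (hFs k) (hGs k), mul_add] at h
  rw [h, integral_add (ha.integrable_mul_inner (hF.mem k) (hG'.mem k))
    (ha.integrable_mul_inner (hF'.mem k) (hG.mem k)), add_comm]

theorem TendstoL2.ae_unique {F : ℕ → E m → E ℓ} {F₀ F₁ : E m → E ℓ}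
    (h : TendstoL2 volume F F₀) (h' : TendstoL2 volume F F₁) : F₀ =ᵐ[volume] F₁ := by
  have h1 := (h.sub h').tendsto
  simp only [sub_self, zero_sub] at h1
  have h2 := tendsto_nhds_unique tendsto_const_nhds h1
  rw [eLpNorm_neg, eLpNorm_eq_zero_iff (h.mem_lim.sub h'.mem_lim).1 (by norm_num)] at h2
  filter_upwards [h2] with x hx
  exact sub_eq_zero.1 hx

theorem TendstoL2.comp_lipschitz {V W α : Type*} [NormedAddCommGroup V] [NormedAddCommGroup W]
    [MeasurableSpace α] {μ : Measure α} {F : ℕ → α → V} {F₀ : α → V} (h : TendstoL2 μ F F₀)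
    {b : V → W} {L : NNReal} (hb : LipschitzWith L b) (hb0 : b 0 = 0) :
    TendstoL2 μ (fun k x => b (F k x)) (fun x => b (F₀ x)) := by
  refine ⟨fun k => hb.comp_memLp hb0 (h.mem k), hb.comp_memLp hb0 h.mem_lim, ?_⟩
  have h1 : Tendsto (fun k => ENNReal.ofReal L * eLpNorm (F k - F₀) 2 μ) atTop (𝓝 0) := by
    simpa only [mul_zero] using ENNReal.Tendsto.const_mul h.tendsto (Or.inr ENNReal.ofReal_ne_top)
  refine tendsto_of_tendsto_of_tendsto_of_le_of_le tendsto_const_nhds h1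
    (fun _ => zero_le) fun k => ?_
  refine eLpNorm_le_mul_eLpNorm_of_ae_le_mul (Eventually.of_forall fun x => ?_) 2
  exact hb.norm_sub_le _ _

end Parts

/-! ### The extension of a homogeneous map -/

section Rigidity

variable {d ℓ : ℕ} {u : E (d + 1) → E ℓ} {c : E ℓ} {f : ℕ → E (d + 1) → E ℓ}
  {w : E (d + 1) → E ℓ} {g : Fin (d + 1) → E (d + 1) → E ℓ}
  {h : Fin (d + 1) → Fin (d + 1) → E (d + 1) → E ℓ}

theorem IsW22Limit.hess_symm {m : ℕ} {Ω : Set (E m)} {f : ℕ → E m → E ℓ} {w : E m → E ℓ}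
    {g : Fin m → E m → E ℓ} {h : Fin m → Fin m → E m → E ℓ} (H : IsW22Limit Ω f w g h)
    (i j : Fin m) : ∀ᵐ x, h i j x = h j i x := by
  have h1 := H.lim_pd_pd i j
  simp only [pd_comm (H.test _).1 j i] at h1
  exact h1.ae_unique (H.lim_pd_pd j i)

theorem ball_half_subset {m : ℕ} :
    Metric.ball (0 : E m) (1 / 2) ⊆ Metric.ball 0 (3 / 4) :=
  Metric.ball_subset_ball (by norm_num)

namespace IsLocalExtension

theorem euler (hext : IsLocalExtension u c f w g h) (hu : MemWk2 (halfBall d) 2 u)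
    (hhom : IsHomogeneousDegreeZero u) :
    ∀ᵐ x, x ∈ Metric.ball (0 : E (d + 1)) (1 / 2) → ∑ j, x j • g j x = 0 := by
  filter_upwards [(ae_restrict_iff' isOpen_halfBall.measurableSet).1 (hhom.euler_ae hu)]
    with x hx hb
  by_cases hΩ : x ∈ halfBall d
  · simp only [(hext.eq_near x ⟨hΩ, ball_half_subset hb⟩).2.1]
    exact hx hΩ
  · simp [(hext.zero x hΩ).2.1]

theorem euler_hessian (hext : IsLocalExtension u c f w g h) (hu : MemWk2 (halfBall d) 2 u)
    (hhom : IsHomogeneousDegreeZero u) (i : Fin (d + 1)) :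
    ∀ᵐ x, x ∈ Metric.ball (0 : E (d + 1)) (1 / 2) → ∑ j, x j • h j i x = - g i x := by
  filter_upwards [(ae_restrict_iff' isOpen_halfBall.measurableSet).1 (hhom.euler_hessian_ae hu i)]
    with x hx hb
  by_cases hΩ : x ∈ halfBall d
  · simp only [(hext.eq_near x ⟨hΩ, ball_half_subset hb⟩).2.2,
      (hext.eq_near x ⟨hΩ, ball_half_subset hb⟩).2.1]
    exact hx hΩ
  · simp [(hext.zero x hΩ).2.1, (hext.zero x hΩ).2.2]

/-- A Pohozaev type identity with a radial weight `ψ`, `∇ψ = κ x`. -/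
theorem integral_radial_mul_traceHess (hext : IsLocalExtension u c f w g h)
    (hu : MemWk2 (halfBall d) 2 u) (hhom : IsHomogeneousDegreeZero u) {Ω : Set (E (d + 1))}
    {ψ κ : E (d + 1) → ℝ} (hψ : IsTestFunction Ω ψ) (hκ : ∀ i x, pd i ψ x = x i * κ x)
    (hκ0 : ∀ x, x ∉ Metric.ball (0 : E (d + 1)) (1 / 2) → κ x = 0) (p : Fin (d + 1)) :
    ∫ x, ψ x * inner ℝ (traceHess h x) (g p x) =
      ∑ i, (1 / 2) * ∫ x, (x p * κ x) * inner ℝ (g i x) (g i x) := by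
  have L := hext.lim
  have mg := fun i => (L.lim_pd i).mem_lim
  have mh := fun i j => (L.lim_pd_pd i j).mem_lim
  have sm := fun i k => contDiff_pd (L.test k).1 i
  -- Integrate by parts in x_i, use the symmetry of the Hessian, and recognize ⟨∂_i u, ∂_p∂_i u⟩ as
  -- half of ∂_p |∂_i u|².
  have key : ∀ i, ∫ x, ψ x * inner ℝ (h i i x) (g p x) =
      (1 / 2) * (∫ x, (x p * κ x) * inner ℝ (g i x) (g i x)) -
        ∫ x, (x i * κ x) * inner ℝ (g i x) (g p x) := by
    intro i
    have a1 := integral_pd_mul_inner hψ i (sm i) (sm p) (L.lim_pd i) (L.lim_pd p)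
      (L.lim_pd_pd i i) (L.lim_pd_pd p i)
    have a2 := integral_pd_mul_inner hψ p (sm i) (sm i) (L.lim_pd i) (L.lim_pd i)
      (L.lim_pd_pd i p) (L.lim_pd_pd i p)
    have a3 : ∫ x, ψ x * inner ℝ (g i x) (h p i x) = ∫ x, ψ x * inner ℝ (g i x) (h i p x) := by
      refine integral_congr_ae ?_
      filter_upwards [L.hess_symm p i] with x hx
      rw [hx]
    have a4 : ∫ x, ψ x * inner ℝ (h i p x) (g i x) = ∫ x, ψ x * inner ℝ (g i x) (h i p x) := by
      refine integral_congr_ae (Eventually.of_forall fun x => ?_)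
      simp only [real_inner_comm]
    simp only [hκ] at a1 a2
    rw [a3] at a1
    rw [a4] at a2
    linarith
  have e1 : ∫ x, ψ x * inner ℝ (traceHess h x) (g p x) =
      ∑ i, ∫ x, ψ x * inner ℝ (h i i x) (g p x) := by
    rw [← integral_finsetSum _ fun i _ => hψ.integrable_mul_inner (mh i i) (mg p)]
    simp only [traceHess, sum_inner, Finset.mul_sum]
  -- The summed cross term contains the radial derivative of u, which vanishes.
  have e2 : ∑ i, ∫ x, (x i * κ x) * inner ℝ (g i x) (g p x) = 0 := by
    rw [← integral_finsetSum]
    · rw [← integral_zero (E (d + 1)) ℝ (μ := volume)]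
      refine integral_congr_ae ?_
      filter_upwards [hext.euler hu hhom] with x hx
      by_cases hb : x ∈ Metric.ball (0 : E (d + 1)) (1 / 2)
      · have : ∑ i, x i * κ x * inner ℝ (g i x) (g p x) =
            κ x * inner ℝ (∑ i, x i • g i x) (g p x) := by
          rw [sum_inner, Finset.mul_sum]
          refine Finset.sum_congr rfl fun i _ => ?_
          rw [real_inner_smul_left]
          ring
        rw [this, hx hb, inner_zero_left, mul_zero]
      · simp [hκ0 x hb]
    · intro i _
      have := (hψ.pd i).integrable_mul_inner (mg i) (mg p)
      simpa only [hκ] using this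
  rw [e1, Finset.sum_congr rfl fun i _ => key i, Finset.sum_sub_distrib, e2, sub_zero]

/-- The scaling identity for the Dirichlet energy of a homogeneous map. -/
theorem integral_scaling (hext : IsLocalExtension u c f w g h)
    (hu : MemWk2 (halfBall d) 2 u) (hhom : IsHomogeneousDegreeZero u) (p i : Fin (d + 1)) :
    2 * ∫ x, (x p * (‖x‖ ^ 2 * radialWeight 3 x)) * inner ℝ (g i x) (g i x) =
      d * ∫ x, (x p * radialWeight 2 x) * inner ℝ (g i x) (g i x) := by
  have L := hext.lim
  have mg := fun i => (L.lim_pd i).mem_lim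
  have mh := fun i j => (L.lim_pd_pd i j).mem_lim
  have sm := fun i k => contDiff_pd (L.test k).1 i
  have tq : IsTestFunction (Metric.ball (0 : E (d + 1)) 1) fun x => x p * radialWeight 2 x :=
    (isTestFunction_radialWeight 2).smul_left (contDiff_apply_coord p)
  have tq3 : IsTestFunction (Metric.ball (0 : E (d + 1)) 1)
      fun x => x p * (‖x‖ ^ 2 * radialWeight 3 x) :=
    ((isTestFunction_radialWeight 3).smul_left (a := fun x : E (d + 1) => ‖x‖ ^ 2)
      (contDiff_norm_sq ℝ)).smul_left (contDiff_apply_coord p)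
  have ta : ∀ j : Fin (d + 1), IsTestFunction (Metric.ball (0 : E (d + 1)) 1)
      fun x => x j * (x p * radialWeight 2 x) := fun j => tq.smul_left (contDiff_apply_coord j)
  have a1 : ∀ j, ∫ x, pd j (fun x : E (d + 1) => x j * (x p * radialWeight 2 x)) x *
      inner ℝ (g i x) (g i x) =
      -2 * ∫ x, (x j * (x p * radialWeight 2 x)) * inner ℝ (h i j x) (g i x) := by
    intro j
    have := integral_pd_mul_inner (ta j) j (sm i) (sm i) (L.lim_pd i) (L.lim_pd i)
      (L.lim_pd_pd i j) (L.lim_pd_pd i j)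
    have e : ∫ x, (x j * (x p * radialWeight 2 x)) * inner ℝ (g i x) (h i j x) =
        ∫ x, (x j * (x p * radialWeight 2 x)) * inner ℝ (h i j x) (g i x) := by
      refine integral_congr_ae (Eventually.of_forall fun x => ?_)
      simp only [real_inner_comm]
    rw [e] at this
    linarith
  have a2 := Finset.sum_congr (rfl : (Finset.univ : Finset (Fin (d + 1))) = _) fun j _ => a1 j
  rw [← Finset.mul_sum, ← integral_finsetSum _ fun j _ =>
      ((ta j).pd j).integrable_mul_inner (mg i) (mg i),
    ← integral_finsetSum _ fun j _ => (ta j).integrable_mul_inner (mh i j) (mg i)] at a2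
  -- The divergence of the field x · (x_p G''). In d + 2, d + 1 is the dimension and 1 the degree of
  -- x_p.
  have e1 : ∫ x, ∑ j, pd j (fun x : E (d + 1) => x j * (x p * radialWeight 2 x)) x *
      inner ℝ (g i x) (g i x) =
      ((d : ℝ) + 2) * (∫ x, (x p * radialWeight 2 x) * inner ℝ (g i x) (g i x)) -
      2 * ∫ x, (x p * (‖x‖ ^ 2 * radialWeight 3 x)) * inner ℝ (g i x) (g i x) := by
    rw [← integral_const_mul, ← integral_const_mul, ← integral_sub
      ((tq.integrable_mul_inner (mg i) (mg i)).const_mul _)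
      ((tq3.integrable_mul_inner (mg i) (mg i)).const_mul _)]
    refine integral_congr_ae (Eventually.of_forall fun x => ?_)
    simp only
    rw [← Finset.sum_mul]
    have : ∑ j, pd j (fun x : E (d + 1) => x j * (x p * radialWeight 2 x)) x =
        ((d : ℝ) + 2) * (x p * radialWeight 2 x) - 2 * (x p * (‖x‖ ^ 2 * radialWeight 3 x)) := by
      have hj : ∀ j, pd j (fun x : E (d + 1) => x j * (x p * radialWeight 2 x)) x =
          x p * radialWeight 2 x + (if p = j then x j * radialWeight 2 x else 0) -
            2 * (x p * (x j ^ 2 * radialWeight 3 x)) := by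
        intro j
        rw [pd_mul (contDiff_apply_coord j)
            ((contDiff_apply_coord p).mul (contDiff_radialWeight 2)),
          pd_mul (contDiff_apply_coord p) (contDiff_radialWeight 2), pd_radialWeight, pd_apply,
          pd_apply, if_pos rfl]
        by_cases hpj : p = j
        · subst hpj
          simp only [if_true]
          ring
        · simp only [hpj, if_false]
          ring
      have hn : ∑ j, 2 * (x p * (x j ^ 2 * radialWeight 3 x)) =
          2 * (x p * (‖x‖ ^ 2 * radialWeight 3 x)) := by
        rw [EuclideanSpace.real_norm_sq_eq, Finset.sum_mul, Finset.mul_sum, Finset.mul_sum]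
      rw [Finset.sum_congr rfl fun j _ => hj j, Finset.sum_sub_distrib, Finset.sum_add_distrib, hn]
      simp
      ring
    rw [this]
    ring
  -- The derivative ∂_i u is homogeneous of degree -1.
  have e2 : ∫ x, ∑ j, (x j * (x p * radialWeight 2 x)) * inner ℝ (h i j x) (g i x) =
      - ∫ x, (x p * radialWeight 2 x) * inner ℝ (g i x) (g i x) := by
    rw [← integral_neg]
    refine integral_congr_ae ?_
    filter_upwards [hext.euler_hessian hu hhom i, ae_all_iff.2 fun j => L.hess_symm i j]
      with x hx hs
    by_cases hb : x ∈ Metric.ball (0 : E (d + 1)) (1 / 2)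
    · have : ∑ j, (x j * (x p * radialWeight 2 x)) * inner ℝ (h i j x) (g i x) =
          (x p * radialWeight 2 x) * inner ℝ (∑ j, x j • h j i x) (g i x) := by
        rw [sum_inner, Finset.mul_sum]
        refine Finset.sum_congr rfl fun j _ => ?_
        rw [real_inner_smul_left, hs j]
        ring
      rw [this, hx hb, inner_neg_left]
      ring
    · simp [radialWeight_eq_zero 2 hb]
  rw [e1, e2] at a2
  linarith

/-- Let S = Σ ∫ x_p G'' |∂_i u|². By the Pohozaev identity, ∫ G' ⟨Δu, ∂_p u⟩ = -S; with the scaling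
identity, ∫ |x|² G'' ⟨Δu, ∂_p u⟩ = (2-d)S/2. The bracket doubled in `firstVariation` becomes -4S +
2(d+1)S + 2(2-d)S = 2S, so the dimension drops out. -/
theorem firstVariation_eq (hext : IsLocalExtension u c f w g h)
    (hu : MemWk2 (halfBall d) 2 u) (hhom : IsHomogeneousDegreeZero u) (p : Fin (d + 1)) :
    firstVariation (radialWeight 0) p g h =
      -2 * (∫ x, (x p * radialWeight 1 x) * inner ℝ (traceHess h x) (traceHess h x)) -
      4 * ∑ i, ∫ x, (x p * radialWeight 2 x) * inner ℝ (g i x) (g i x) := by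
  have L := hext.lim
  have mg := fun i => (L.lim_pd i).mem_lim
  have mh := fun i j => (L.lim_pd_pd i j).mem_lim
  have mH := L.memLp_traceHess
  have t1 : IsTestFunction (Metric.ball (0 : E (d + 1)) 1) (radialWeight 1) :=
    isTestFunction_radialWeight 1
  have t2 : IsTestFunction (Metric.ball (0 : E (d + 1)) 1) fun x => ‖x‖ ^ 2 * radialWeight 2 x :=
    (isTestFunction_radialWeight 2).smul_left (a := fun x : E (d + 1) => ‖x‖ ^ 2)
      (contDiff_norm_sq ℝ)
  have tq : IsTestFunction (Metric.ball (0 : E (d + 1)) 1) fun x => x p * radialWeight 2 x :=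
    (isTestFunction_radialWeight 2).smul_left (contDiff_apply_coord p)
  have tq3 : IsTestFunction (Metric.ball (0 : E (d + 1)) 1)
      fun x => x p * (‖x‖ ^ 2 * radialWeight 3 x) :=
    ((isTestFunction_radialWeight 3).smul_left (a := fun x : E (d + 1) => ‖x‖ ^ 2)
      (contDiff_norm_sq ℝ)).smul_left (contDiff_apply_coord p)
  have f1 : ∫ x, pd p (radialWeight 0) x * ‖traceHess h x‖ ^ 2 =
      -2 * ∫ x, (x p * radialWeight 1 x) * inner ℝ (traceHess h x) (traceHess h x) := by
    rw [← integral_const_mul]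
    refine integral_congr_ae (Eventually.of_forall fun x => ?_)
    simp only [pd_radialWeight, real_inner_self_eq_norm_sq]
    ring
  -- Since ∇η is radial, the Hessian is contracted with x, and the Euler relation for ∂_p u applies.
  have f2 : ∑ i, ∫ x, pd i (radialWeight 0) x * inner ℝ (traceHess h x) (h i p x + h p i x) =
      4 * ∫ x, radialWeight 1 x * inner ℝ (traceHess h x) (g p x) := by
    have hint : ∀ i, Integrable (fun x => pd i (radialWeight 0) x *
        inner ℝ (traceHess h x) (h i p x + h p i x)) volume := fun i =>
      ((isTestFunction_radialWeight 0).pd i).integrable_mul_inner mH ((mh i p).add (mh p i))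
    rw [← integral_finsetSum _ fun i _ => hint i, ← integral_const_mul]
    refine integral_congr_ae ?_
    filter_upwards [hext.euler_hessian hu hhom p, ae_all_iff.2 fun j => L.hess_symm p j]
      with x hx hs
    by_cases hb : x ∈ Metric.ball (0 : E (d + 1)) (1 / 2)
    · have : ∑ i, pd i (radialWeight 0) x * inner ℝ (traceHess h x) (h i p x + h p i x) =
          (-4 * radialWeight 1 x) * inner ℝ (traceHess h x) (∑ i, x i • h i p x) := by
        rw [inner_sum, Finset.mul_sum]
        refine Finset.sum_congr rfl fun i _ => ?_
        rw [real_inner_smul_right, hs i, inner_add_right, pd_radialWeight]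
        ring
      rw [this, hx hb, inner_neg_right]
      ring
    · simp [pd_radialWeight, radialWeight_eq_zero 1 hb]
  have lap : ∀ x : E (d + 1), ∑ i, pd i (pd i (radialWeight 0)) x =
      -2 * ((d : ℝ) + 1) * radialWeight 1 x + 4 * (‖x‖ ^ 2 * radialWeight 2 x) := by
    intro x
    have hi : ∀ i, pd i (pd i (radialWeight 0)) x =
        -2 * radialWeight 1 x + x i ^ 2 * (4 * radialWeight 2 x) := by
      intro i
      have e : pd i (radialWeight 0 : E (d + 1) → ℝ) = fun x => (-2 * x i) * radialWeight 1 x := by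
        ext1 y
        rw [pd_radialWeight]
        ring
      have e2 : pd i (fun x : E (d + 1) => -2 * x i) x = -2 := by
        rw [pd_mul contDiff_const (contDiff_apply_coord i), pd_apply]
        simp [pd]
      rw [e, pd_mul (contDiff_const.mul (contDiff_apply_coord i)) (contDiff_radialWeight 1), e2,
        pd_radialWeight]
      ring
    have hn : ∑ i, x i ^ 2 * (4 * radialWeight 2 x) = ‖x‖ ^ 2 * (4 * radialWeight 2 x) := by
      rw [EuclideanSpace.real_norm_sq_eq, Finset.sum_mul]
    rw [Finset.sum_congr rfl fun i _ => hi i, Finset.sum_add_distrib, hn]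
    simp
    ring
  have f3 : ∫ x, (∑ i, pd i (pd i (radialWeight 0)) x) * inner ℝ (traceHess h x) (g p x) =
      -2 * ((d : ℝ) + 1) * (∫ x, radialWeight 1 x * inner ℝ (traceHess h x) (g p x)) +
      4 * ∫ x, (‖x‖ ^ 2 * radialWeight 2 x) * inner ℝ (traceHess h x) (g p x) := by
    rw [← integral_const_mul, ← integral_const_mul, ← integral_add
      ((t1.integrable_mul_inner mH (mg p)).const_mul _)
      ((t2.integrable_mul_inner mH (mg p)).const_mul _)]
    refine integral_congr_ae (Eventually.of_forall fun x => ?_)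
    simp only [lap]
    ring
  have p1 := hext.integral_radial_mul_traceHess hu hhom t1 (κ := fun x => -2 * radialWeight 2 x)
    (fun i x => pd_radialWeight 1 i x) (fun x hx => by simp [radialWeight_eq_zero 2 hx]) p
  have p2 := hext.integral_radial_mul_traceHess hu hhom t2
    (κ := fun x => 2 * radialWeight 2 x - 2 * (‖x‖ ^ 2 * radialWeight 3 x))
    (fun i x => by
      rw [pd_mul (contDiff_norm_sq ℝ) (contDiff_radialWeight 2), pd_norm_sq, pd_radialWeight]
      ring) (fun x hx => by simp [radialWeight_eq_zero 2 hx, radialWeight_eq_zero 3 hx]) p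
  have q1 : ∀ i, ∫ x, (x p * (-2 * radialWeight 2 x)) * inner ℝ (g i x) (g i x) =
      -2 * ∫ x, (x p * radialWeight 2 x) * inner ℝ (g i x) (g i x) := by
    intro i
    rw [← integral_const_mul]
    refine integral_congr_ae (Eventually.of_forall fun x => ?_)
    simp only
    ring
  have q2 : ∀ i, ∫ x, (x p * (2 * radialWeight 2 x - 2 * (‖x‖ ^ 2 * radialWeight 3 x))) *
      inner ℝ (g i x) (g i x) =
      (2 - (d : ℝ)) * ∫ x, (x p * radialWeight 2 x) * inner ℝ (g i x) (g i x) := by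
    intro i
    have := hext.integral_scaling hu hhom p i
    rw [sub_mul, ← this, ← integral_const_mul, ← integral_const_mul, ← integral_sub
      ((tq.integrable_mul_inner (mg i) (mg i)).const_mul _)
      ((tq3.integrable_mul_inner (mg i) (mg i)).const_mul _)]
    refine integral_congr_ae (Eventually.of_forall fun x => ?_)
    simp only
    ring
  simp only [q1, ← Finset.mul_sum] at p1
  simp only [q2, ← Finset.mul_sum] at p2
  rw [firstVariation, f1, f2, f3, p1, p2]
  ring

end IsLocalExtension

end Rigidity

/-! ### Rigidity -/

section Rigidity

variable {d ℓ : ℕ} {u : E (d + 1) → E ℓ} {c : E ℓ} {f : ℕ → E (d + 1) → E ℓ}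
  {w : E (d + 1) → E ℓ} {g : Fin (d + 1) → E (d + 1) → E ℓ}
  {h : Fin (d + 1) → Fin (d + 1) → E (d + 1) → E ℓ}

/-- Composed with w, such a function acts as an indicator wherever w is either zero or at least δ in
norm, yet it respects weak derivatives. -/
theorem exists_smooth_truncation {δ : ℝ} (hδ : 0 < δ) :
    ∃ b : E ℓ → ℝ, ContDiff ℝ ∞ b ∧ (∃ L, LipschitzWith L b) ∧ (∃ L, LipschitzWith L (fderiv ℝ b)) ∧
      b 0 = 0 ∧ fderiv ℝ b 0 = 0 ∧ ∀ y, δ ≤ ‖y‖ → b y = 1 ∧ fderiv ℝ b y = 0 := by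
  let B : ContDiffBump (0 : E ℓ) := ⟨δ / 3, δ / 2, by positivity, by linarith⟩
  have hB : ContDiff ℝ ∞ (B : E ℓ → ℝ) := B.contDiff
  have hb : ContDiff ℝ ∞ fun y => 1 - B y := contDiff_const.sub hB
  have hf : fderiv ℝ (fun y => 1 - B y) = fun y => -fderiv ℝ B y := by
    ext1 y
    exact fderiv_const_sub 1
  have hL := ContDiff.lipschitzWith_of_hasCompactSupport B.hasCompactSupport hB (by simp)
  have hL' := ContDiff.lipschitzWith_of_hasCompactSupport (B.hasCompactSupport.fderiv ℝ)
    (hB.fderiv_right (m := ∞) (by simp)) (by simp)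
  obtain ⟨L, hL⟩ := hL
  obtain ⟨L', hL'⟩ := hL'
  refine ⟨fun y => 1 - B y, hb, ⟨L, ?_⟩, ⟨L', ?_⟩, ?_, ?_, fun y hy => ⟨?_, ?_⟩⟩
  · refine LipschitzWith.of_dist_le_mul fun x y => ?_
    rw [dist_sub_left]
    exact hL.dist_le_mul x y
  · rw [hf]
    refine LipschitzWith.of_dist_le_mul fun x y => ?_
    rw [dist_neg_neg]
    exact hL'.dist_le_mul x y
  · simp [B.one_of_mem_closedBall (Metric.mem_closedBall_self (by positivity))]
  · rw [hf]
    have : (B : E ℓ → ℝ) =ᶠ[𝓝 0] fun _ => 1 := B.eventuallyEq_one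
    simp [this.fderiv_eq]
  · have : B y = 0 := B.zero_of_le_dist (by
      rw [dist_zero_right]
      change δ / 2 ≤ ‖y‖
      linarith)
    simp [this]
  · rw [hf]
    have : y ∉ tsupport (B : E ℓ → ℝ) := by
      rw [B.tsupport_eq, mem_closedBall_zero_iff, not_le]
      change δ / 2 < ‖y‖
      linarith
    have h2 := (notMem_tsupport_iff_eventuallyEq.1 this).fderiv_eq (𝕜 := ℝ)
    simp [h2]

theorem measure_halfBall_inter_ball_ne_zero (d : ℕ) :
    volume (halfBall d ∩ Metric.ball 0 (1 / 2)) ≠ 0 := by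
  refine (isOpen_halfBall.inter Metric.isOpen_ball).measure_ne_zero _
    ⟨EuclideanSpace.single (Fin.last d) (1 / 4), ⟨?_, ?_⟩, ?_⟩
  · simp
    norm_num
  · simp
  · simp
    norm_num

theorem ae_eq_zero_of_integral_eq_zero {γ F : E (d + 1) → ℝ}
    (hγ : ∀ x, x ∈ Metric.ball (0 : E (d + 1)) (1 / 2) → 0 < γ x)
    (hγ0 : ∀ x, x ∉ Metric.ball (0 : E (d + 1)) (1 / 2) → γ x = 0)
    (hF : ∀ x, 0 ≤ F x) (hF0 : ∀ x, x ∉ halfBall d → F x = 0)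
    (hint : Integrable (fun x => (x (Fin.last d) * γ x) * F x) volume)
    (h0 : ∫ x, (x (Fin.last d) * γ x) * F x = 0) :
    ∀ᵐ x, x ∈ Metric.ball (0 : E (d + 1)) (1 / 2) → F x = 0 := by
  have hnn : ∀ x, 0 ≤ (x (Fin.last d) * γ x) * F x := by
    intro x
    by_cases hb : x ∈ Metric.ball (0 : E (d + 1)) (1 / 2)
    · by_cases hΩ : x ∈ halfBall d
      · exact mul_nonneg (mul_nonneg (le_of_lt hΩ.2) (hγ x hb).le) (hF x)
      · simp [hF0 x hΩ]
    · simp [hγ0 x hb]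
  filter_upwards [(integral_eq_zero_iff_of_nonneg hnn hint).1 h0] with x hx hb
  by_cases hΩ : x ∈ halfBall d
  · exact (mul_eq_zero.1 hx).resolve_left (mul_pos hΩ.2 (hγ x hb)).ne'
  · exact hF0 x hΩ

theorem integral_mul_nonneg {γ F : E (d + 1) → ℝ} (hγ : ∀ x, 0 ≤ γ x) (hF : ∀ x, 0 ≤ F x)
    (hF0 : ∀ x, x ∉ halfBall d → F x = 0) :
    0 ≤ ∫ x, (x (Fin.last d) * γ x) * F x := by
  refine integral_nonneg fun x => ?_
  by_cases hΩ : x ∈ halfBall d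
  · exact mul_nonneg (mul_nonneg (le_of_lt hΩ.2) (hγ x)) (hF x)
  · simp [hF0 x hΩ]

namespace IsLocalExtension

theorem inner_self_eq_zero_of_notMem (hext : IsLocalExtension u c f w g h) (i : Fin (d + 1))
    (x : E (d + 1)) (hx : x ∉ halfBall d) : inner ℝ (g i x) (g i x) = 0 := by
  rw [(hext.zero x hx).2.1 i, inner_zero_left]

/-- The boundary value lies in a closed target. -/
theorem boundaryValue_mem (hext : IsLocalExtension u c f w g h) {N : Set (E ℓ)} (hN : IsClosed N)
    (huN : ∀ᵐ x ∂(volume.restrict (halfBall d)), u x ∈ N) : c ∈ N := by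
  by_contra hc
  obtain ⟨δ, hδ, hball⟩ := Metric.isOpen_iff.1 hN.isOpen_compl c hc
  obtain ⟨b, hb, ⟨L, hL⟩, ⟨L', hL'⟩, hb0, hb0', hbδ⟩ := exists_smooth_truncation (ℓ := ℓ) hδ
  have H := hext.lim
  set p := Fin.last d
  -- A ball of radius δ about c misses the target, so u - c cannot be small. Then b(w) is the
  -- indicator of the half ball near the origin.
  have far : ∀ᵐ x, x ∈ halfBall d ∩ Metric.ball 0 (1 / 2) → δ ≤ ‖w x‖ := by
    filter_upwards [(ae_restrict_iff' isOpen_halfBall.measurableSet).1 huN] with x hx hxb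
    by_contra hlt
    refine hball ?_ (hx hxb.1)
    rw [mem_ball_iff_norm, ← (hext.eq_near x ⟨hxb.1, ball_half_subset hxb.2⟩).1]
    exact not_le.1 hlt
  have tγ := isTestFunction_radialWeight (m := d + 1) 0
  obtain ⟨C, hC⟩ := tγ.bounded
  have lim1 := TendstoL2.tendsto_integral_smul ((tγ.pd p).memLp 2 volume) (H.lim.comp_lipschitz hL hb0)
  have lim2 := TendstoL2.tendsto_integral_bilin (ContinuousLinearMap.id ℝ (E ℓ →L[ℝ] ℝ))
    ((H.lim.comp_lipschitz hL' hb0').smul_bounded tγ.1.continuous.aestronglyMeasurable hC)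
    (H.lim_pd p)
  -- By the chain rule the weak gradient of b(w) is zero, since the derivative of b vanishes at
  -- every value w takes near the origin. An indicator jumping across the plane contradicts this.
  have key : ∫ x, pd p (radialWeight 0) x • b (w x) = 0 := by
    have e : ∀ k, ∫ x, pd p (radialWeight 0) x • b (f k x) = -∫ x,
        ContinuousLinearMap.id ℝ (E ℓ →L[ℝ] ℝ) (radialWeight 0 x • fderiv ℝ b (f k x))
          (pd p (f k) x) := by
      intro k
      refine (integral_smul_pd tγ (hb.comp (H.test k).1) p).trans (congrArg Neg.neg ?_)
      refine integral_congr_ae (Eventually.of_forall fun x => ?_)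
      have h1 := fderiv_comp x (diffAt hb (f k x)) (diffAt (H.test k).1 x)
      simp [pd, h1]
    have h1 := tendsto_nhds_unique (lim1.congr e) lim2.neg
    rw [h1, neg_eq_zero, ← integral_zero (E (d + 1)) ℝ (μ := volume)]
    refine integral_congr_ae ?_
    filter_upwards [far] with x hx
    by_cases hB : x ∈ Metric.ball (0 : E (d + 1)) (1 / 2)
    · by_cases hΩ : x ∈ halfBall d
      · simp [(hbδ _ (hx ⟨hΩ, hB⟩)).2]
      · simp [(hext.zero x hΩ).1, hb0']
    · simp [radialWeight_eq_zero 0 hB]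
  have nul : ∀ᵐ x, x ∉ halfBall d ∩ Metric.ball 0 (1 / 2) := by
    have i1 : Integrable (fun x => pd p (radialWeight 0) x • |b (w x)|) volume :=
      TendstoL2.integrable_bilin (ContinuousLinearMap.lsmul ℝ ℝ) ((tγ.pd p).memLp 2 volume)
        (H.lim.comp_lipschitz hL hb0).mem_lim.norm
    have i2 : Integrable (fun x => (x p * radialWeight 1 x) * |b (w x)|) volume := by
      refine (i1.const_mul (-1 / 2)).congr (Eventually.of_forall fun x => ?_)
      simp only [pd_radialWeight, smul_eq_mul]
      ring
    have i3 : ∫ x, (x p * radialWeight 1 x) * |b (w x)| = 0 := by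
      have : ∫ x, (x p * radialWeight 1 x) * |b (w x)| =
          (-1 / 2) * ∫ x, pd p (radialWeight 0) x • b (w x) := by
        rw [← integral_const_mul]
        refine integral_congr_ae ?_
        filter_upwards [far] with x hx
        simp only [pd_radialWeight, smul_eq_mul]
        by_cases hB : x ∈ Metric.ball (0 : E (d + 1)) (1 / 2)
        · by_cases hΩ : x ∈ halfBall d
          · simp [(hbδ _ (hx ⟨hΩ, hB⟩)).1]
            ring
          · simp [(hext.zero x hΩ).1, hb0]
        · simp [radialWeight_eq_zero 1 hB]
      rw [this, key, mul_zero]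
    filter_upwards [far, ae_eq_zero_of_integral_eq_zero (fun x => radialWeight_one_pos)
      (fun x => radialWeight_eq_zero 1) (fun x => abs_nonneg (b (w x)))
      (fun x hx => by simp [(hext.zero x hx).1, hb0]) i2 i3] with x hx hx0 hmem
    have := hx0 hmem.2
    simp [(hbδ _ (hx hmem)).1] at this
  exact measure_halfBall_inter_ball_ne_zero d (measure_eq_zero_iff_ae_notMem.2 nul)

/-- The first variation is nonnegative, but `firstVariation_eq` exhibits it as minus a sum of
nonnegative integrals; each must vanish. The normal component suffices for what follows. -/
theorem normal_derivative_eq_zero (hext : IsLocalExtension u c f w g h)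
    (hu : MemWk2 (halfBall d) 2 u) (hhom : IsHomogeneousDegreeZero u)
    (hfv : 0 ≤ firstVariation (radialWeight 0) (Fin.last d) g h) :
    ∀ᵐ x, x ∈ Metric.ball (0 : E (d + 1)) (1 / 2) → g (Fin.last d) x = 0 := by
  have mg := fun i => (hext.lim.lim_pd i).mem_lim
  have A : 0 ≤ ∫ x, (x (Fin.last d) * radialWeight 1 x) *
      inner ℝ (traceHess h x) (traceHess h x) :=
    integral_mul_nonneg (radialWeight_nonneg fun x => radialWeight_one_pos)
      (fun x => real_inner_self_nonneg)
      fun x hx => by simp [traceHess, (hext.zero x hx).2.2]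
  have I : ∀ i, 0 ≤ ∫ x, (x (Fin.last d) * radialWeight 2 x) * inner ℝ (g i x) (g i x) :=
    fun i => integral_mul_nonneg (radialWeight_nonneg fun x => radialWeight_two_pos)
      (fun x => real_inner_self_nonneg) (hext.inner_self_eq_zero_of_notMem i)
  rw [hext.firstVariation_eq hu hhom] at hfv
  have h0 : ∫ x, (x (Fin.last d) * radialWeight 2 x) *
      inner ℝ (g (Fin.last d) x) (g (Fin.last d) x) = 0 :=
    (Finset.sum_eq_zero_iff_of_nonneg fun i _ => I i).1
      (le_antisymm (by linarith) (Finset.sum_nonneg fun i _ => I i)) _ (Finset.mem_univ _)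
  have tq : IsTestFunction (Metric.ball (0 : E (d + 1)) 1)
      fun x => x (Fin.last d) * radialWeight 2 x :=
    (isTestFunction_radialWeight 2).smul_left (contDiff_apply_coord _)
  filter_upwards [ae_eq_zero_of_integral_eq_zero (fun x => radialWeight_two_pos)
    (fun x => radialWeight_eq_zero 2) (fun x => real_inner_self_nonneg)
    (hext.inner_self_eq_zero_of_notMem _) (tq.integrable_mul_inner (mg _) (mg _)) h0] with x hx hb
  exact inner_self_eq_zero.1 (hx hb)

/-- Integrating ∂_m(η |w|²) = ∂_mη |w|² leaves ∫ x_m G' |w|² = 0. The integrand is nonnegative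
because w vanishes below the plane, so w = 0. -/
theorem eq_zero_of_normal_derivative (hext : IsLocalExtension u c f w g h)
    (hg : ∀ᵐ x, x ∈ Metric.ball (0 : E (d + 1)) (1 / 2) → g (Fin.last d) x = 0) :
    ∀ᵐ x, x ∈ Metric.ball (0 : E (d + 1)) (1 / 2) → w x = 0 := by
  have H := hext.lim
  have mw := H.lim.mem_lim
  have sm := fun k => (H.test k).1
  have tq : IsTestFunction (Metric.ball (0 : E (d + 1)) 1)
      fun x => x (Fin.last d) * radialWeight 1 x :=
    (isTestFunction_radialWeight 1).smul_left (contDiff_apply_coord _)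
  have e := integral_pd_mul_inner (isTestFunction_radialWeight (m := d + 1) 0) (Fin.last d) sm sm
    H.lim H.lim (H.lim_pd _) (H.lim_pd _)
  have z : ∀ᵐ x, radialWeight 0 x * inner ℝ (g (Fin.last d) x) (w x) = 0 := by
    filter_upwards [hg] with x hx
    by_cases hB : x ∈ Metric.ball (0 : E (d + 1)) (1 / 2)
    · simp [hx hB]
    · simp [radialWeight_eq_zero 0 hB]
  have z1 : ∫ x, radialWeight 0 x * inner ℝ (g (Fin.last d) x) (w x) = 0 :=
    integral_eq_zero_of_ae z
  have z2 : ∫ x, radialWeight 0 x * inner ℝ (w x) (g (Fin.last d) x) = 0 := by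
    simpa only [real_inner_comm] using z1
  have h0 : ∫ x, (x (Fin.last d) * radialWeight 1 x) * inner ℝ (w x) (w x) = 0 := by
    have : ∫ x, pd (Fin.last d) (radialWeight 0) x * inner ℝ (w x) (w x) =
        -2 * ∫ x, (x (Fin.last d) * radialWeight 1 x) * inner ℝ (w x) (w x) := by
      rw [← integral_const_mul]
      refine integral_congr_ae (Eventually.of_forall fun x => ?_)
      simp only [pd_radialWeight]
      ring
    rw [this, z1, z2] at e
    linarith
  filter_upwards [ae_eq_zero_of_integral_eq_zero (fun x => radialWeight_one_pos)
    (fun x => radialWeight_eq_zero 1) (fun x => real_inner_self_nonneg)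
    (fun x hx => by rw [(hext.zero x hx).1, inner_zero_left])
    (tq.integrable_mul_inner mw mw) h0] with x hx hb
  exact inner_self_eq_zero.1 (hx hb)

end IsLocalExtension

/-- A map which is homogeneous of degree `0` and constant near the origin is constant. -/
theorem IsHomogeneousDegreeZero.ae_eq_of_near (hhom : IsHomogeneousDegreeZero u)
    (hc : ∀ᵐ x, x ∈ halfBall d ∩ Metric.ball 0 (1 / 2) → u x = c) :
    ∀ᵐ x ∂(volume.restrict (halfBall d)), u x = c := by
  have q : Measure.QuasiMeasurePreserving (fun x : E (d + 1) => (1 / 2 : ℝ) • x) volume volume := by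
    refine ⟨measurable_const_smul _, ?_⟩
    rw [Measure.map_addHaar_smul _ (by norm_num)]
    exact Measure.smul_absolutelyContinuous
  have h1 := hhom (1 / 2) (by norm_num) (by norm_num)
  rw [ae_restrict_iff' isOpen_halfBall.measurableSet] at h1 ⊢
  filter_upwards [h1, q.ae hc] with x hx hx' hΩ
  rw [← hx hΩ]
  refine hx' ⟨smul_mem_halfBall (by norm_num) (by norm_num) hΩ, ?_⟩
  have := hΩ.1
  rw [mem_ball_zero_iff] at this ⊢
  rw [norm_smul, Real.norm_of_nonneg (by norm_num)]
  linarith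

theorem IsMinimizingBiharmonic.ae_eq_const {N : Set (E ℓ)} (hN : IsClosed N)
    (hmin : IsMinimizingBiharmonic (halfBall d) N u) (hhom : IsHomogeneousDegreeZero u)
    (hc : HasConstantFlatBoundaryValue u c) :
    c ∈ N ∧ ∀ᵐ x ∂(volume.restrict (halfBall d)), u x = c := by
  obtain ⟨f, w, g, h, hext⟩ := hc.exists_isLocalExtension hmin.1.1
  have hcN := hext.boundaryValue_mem hN hmin.1.2
  refine ⟨hcN, hhom.ae_eq_of_near ?_⟩
  have hfv := hmin.firstVariation_nonneg hext hcN (isTestFunction_radialWeight 0)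
    radialWeight_zero_nonneg (tsupport_radialWeight_subset 0)
  filter_upwards [hext.eq_zero_of_normal_derivative
    (hext.normal_derivative_eq_zero hmin.1.1 hhom hfv)] with x hx hxb
  have := hx hxb.2
  rw [(hext.eq_near x ⟨hxb.1, ball_half_subset hxb.2⟩).1] at this
  exact sub_eq_zero.1 this

end Rigidity

end BiharmonicMaps

end

/-! ### The theorem for an embedded compact manifold. -/

theorem mainTheorem3 {d n ℓ : ℕ}
    {M : Type*} [TopologicalSpace M] [ChartedSpace (EuclideanSpace ℝ (Fin n)) M]
    [IsManifold (𝓡 n) ∞ M] [CompactSpace M]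
    (ι : M → EuclideanSpace ℝ (Fin ℓ))
    (hι : Manifold.IsSmoothEmbedding (𝓡 n) 𝓘(ℝ, EuclideanSpace ℝ (Fin ℓ)) ∞ ι)
    (u₀ : EuclideanSpace ℝ (Fin (d + 1)) → EuclideanSpace ℝ (Fin ℓ))
    (hmin : BiharmonicMaps.IsMinimizingBiharmonic (BiharmonicMaps.halfBall d) (Set.range ι) u₀)
    (hhom : BiharmonicMaps.IsHomogeneousDegreeZero u₀)
    (hbdry : ∃ c : EuclideanSpace ℝ (Fin ℓ), BiharmonicMaps.HasConstantFlatBoundaryValue u₀ c) :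
    ∃ b ∈ Set.range ι,
      ∀ᵐ x ∂(MeasureTheory.volume.restrict (BiharmonicMaps.halfBall d)), u₀ x = b := by
  obtain ⟨c, hc⟩ := hbdry
  have hN : IsClosed (Set.range ι) := (isCompact_range hι.isEmbedding.continuous).isClosed
  obtain ⟨hcN, hu⟩ := hmin.ae_eq_const hN hhom hc
  exact ⟨c, hcN, hu⟩
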